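/- Graphs are finite undirected multigraphs (loops and parallel edges allowed). An embedding of a graph $G$ into the torus $T^2=\mathbb R/\mathbb Z\times\mathbb R/\mathbb Z$ maps distinct vertices to distinct points and each edge to a continuous curve joining the images of its ends, such that each curve is injective on its interior, no curve interior contains the image of a vertex, and the interiors of the curves of distinct edges are disjoint. A graph is \emph{toroidal} if it has such an embedding. For a graph $G$, a graph of the form $G\cup e$ is obtained from $G$ in one of three ways: (i) subdivide an edge of $G$ once by a new vertex $u$, and add a new vertex $v$, an edge $uv$ and a loop at $v$; (ii) subdivide an edge of $G$ twice by new vertices $u$ and $v$, and add an edge $uv$ (parallel to the segment between them); (iii) subdivide two distinct edges $a,b$ of $G$ once each, by new vertices $u$ and $v$ respectively, and add an edge $uv$; this last graph is written $G\cup(a\text{–}b)$. If $G$ is cubic, so is $G\cup e$. Let $G_1$ be the cubic graph with vertices $A,B,C,A',B',C',1,2,3,4$ and edges $AA',BB',CC'$, $A1,A2,B1,B2,C1,C2$, $A'3,A'4,B'3,B'4,C'3,C'4$. In $G_1\cup(a\text{–}b)$ let $x$ and $y$ denote the vertices subdividing $a$ and $b$, respectively, and put $$\begin{aligned} H_4&=G_1\cup(AA'\text{–}BB')\cup(Ax\text{–}CC'),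 & H_5&=G_1\cup(AA'\text{–}BB')\cup(A1\text{–}B2),\\ H_6&=G_1\cup(A1\text{–}B2)\cup(Ax\text{–}By), & H_7&=G_1\cup(A1\text{–}B2)\cup(Ax\text{–}B1),\\ H_8&=G_1\cup(A1\text{–}B2)\cup(A2\text{–}B1), & H_9&=G_1\cup(AA'\text{–}BB')\cup(xy\text{–}CC'). \end{aligned}$$ Let $G_1\cup e_1$ be any graph obtained from $G_1$ by adding an edge in one of the ways (i)–(iii), and let $G_1\cup e_1\cup e_2$ be any graph obtained from $G_1\cup e_1$ by adding an edge in one of these ways. If $G_1\cup e_1\cup e_2$ is not isomorphic to any of $H_4,H_5,H_6,H_7,H_8,H_9$, then it is toroidal. -/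

import Mathlib

namespace CubicTorus

open scoped Graph

universe u v w z

/-! Graphs are Mathlib's multigraphs `Graph α β`: loops and parallel edges are allowed,
since adding an edge to a simple graph can create them. -/

/-- The multigraph on all of `α` whose edges are all of `β`, the edge `e` having
the (unordered) pair of ends `ends e`. -/
def ofEnds {α : Type u} {β : Type v} (ends : β → Sym2 α) : Graph α β where
  vertexSet := Set.univ
  IsLink e x y := ends e = s(x, y)
  isLink_symm := fun _ _ => ⟨fun _ _ h => h.trans Sym2.eq_swap⟩
  eq_or_eq_of_isLink_of_isLink := by
    intro e x y v w h h'
    rcases Sym2.eq_iff.1 (h.symm.trans h') with h | h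
    · exact Or.inl h.1
    · exact Or.inr h.1
  left_mem_of_isLink := fun _ _ _ _ => Set.mem_univ _

/-- Isomorphism of multigraphs. -/
def Isomorphic {α : Type u} {β : Type v} {γ : Type w} {δ : Type z}
    (G : Graph α β) (H : Graph γ δ) : Prop :=
  ∃ (φ : V(G) ≃ V(H)) (ψ : E(G) ≃ E(H)),
    ∀ (e : E(G)) (x y : V(G)), G.IsLink e x y ↔ H.IsLink (ψ e) (φ x) (φ y)

/-- `K` arises from `G` by subdividing the edge `e` once, with new vertex `u`:
if `e` joins `x` and `y`, then in `K` the edge `e` joins `x` and `u`, and a new edge `e'`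
joins `u` and `y`. (Either end of `e` may play the role of `x`.) -/
def IsSubdivision {α : Type u} {β : Type v} (G K : Graph α β) (e : β) (u : α) : Prop :=
  ∃ (x y : α) (e' : β), G.IsLink e x y ∧ u ∉ V(G) ∧ e' ∉ E(G) ∧
    V(K) = insert u V(G) ∧
    ∀ (f : β) (a b : α), K.IsLink f a b ↔
      (f ≠ e ∧ G.IsLink f a b) ∨ (f = e ∧ s(a, b) = s(x, u)) ∨ (f = e' ∧ s(a, b) = s(u, y))

/-- `K` arises from `G` by adding one new edge `e` with ends `u` and `v`
(together with its ends, if they are not yet vertices). -/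
def IsJoin {α : Type u} {β : Type v} (G K : Graph α β) (e : β) (u v : α) : Prop :=
  e ∉ E(G) ∧ V(K) = insert u (insert v V(G)) ∧
    ∀ (f : β) (a b : α), K.IsLink f a b ↔ G.IsLink f a b ∨ (f = e ∧ s(a, b) = s(u, v))

/-- `IsAddEdge G K`: the graph `K` is of the form `G ∪ e`, in one of three ways. -/
inductive IsAddEdge {α : Type u} {β : Type v} (G K : Graph α β) : Prop
  /-- Subdivide an edge `e₁` once by `u`, add a new vertex `v`, the edge `uv` and the loop `vv`. -/
  | pendantLoop (e₁ f l : β) (u v : α) (S T : Graph α β) (hS : IsSubdivision G S e₁ u)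
      (hv : v ∉ V(S)) (hT : IsJoin S T f u v) (hK : IsJoin T K l v v) : IsAddEdge G K
  /-- Subdivide an edge `e₁` twice, by `u` and by `v`, and add the edge `uv`. -/
  | sameEdge (e₁ f : β) (u v : α) (S T : Graph α β) (hS : IsSubdivision G S e₁ u)
      (hT : IsSubdivision S T e₁ v) (hK : IsJoin T K f u v) : IsAddEdge G K
  /-- Subdivide two distinct edges `e₁`, `e₂` of `G` once each, by `u` and by `v`, and add the
  edge `uv`. -/
  | twoEdges (e₁ e₂ f : β) (u v : α) (S T : Graph α β) (he₁ : e₁ ∈ E(G)) (he₂ : e₂ ∈ E(G))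
      (hne : e₁ ≠ e₂) (hS : IsSubdivision G S e₁ u) (hT : IsSubdivision S T e₂ v)
      (hK : IsJoin T K f u v) : IsAddEdge G K

/-- An embedding of the multigraph `G` into a topological space `X`: distinct vertices go to
distinct points, and every edge goes to a continuous curve between the images of its ends which
is simple (closed, if the edge is a loop), whose interior contains no image of a vertex and
does not meet the interior of the curve of any other edge. -/
structure Embedding {α : Type u} {β : Type v} (G : Graph α β) (X : Type w)
    [TopologicalSpace X] where
  vert : V(G) → X
  curve : E(G) → C(unitInterval, X)
  vert_injective : Function.Injective vert
  curve_ends : ∀ (e : E(G)) (x y : V(G)), G.IsLink e x y →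
    s(curve e 0, curve e 1) = s(vert x, vert y)
  curve_injOn : ∀ e : E(G), Set.InjOn (curve e) (Set.Ioo 0 1)
  curve_ne_vert : ∀ (e : E(G)), ∀ t ∈ Set.Ioo (0 : unitInterval) 1, ∀ x : V(G),
    curve e t ≠ vert x
  curve_ne_curve : ∀ e f : E(G), e ≠ f → ∀ s ∈ Set.Ioo (0 : unitInterval) 1,
    ∀ t ∈ Set.Ioo (0 : unitInterval) 1, curve e s ≠ curve f t

/-- A graph is toroidal if it embeds into the torus `ℝ/ℤ × ℝ/ℤ`. -/
def Toroidal {α : Type u} {β : Type v} (G : Graph α β) : Prop :=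
  Nonempty (Embedding G (UnitAddCircle × UnitAddCircle))

/-! In the explicit graphs below the vertices are numbered
`A = 0, B = 1, C = 2, A' = 3, B' = 4, C' = 5`, then the vertices called `1, 2, 3, 4` are
`6, 7, 8, 9`; the vertices created by the first added edge are `x = 10, y = 11`, those created by
the second one are `12, 13`. The notation `(a–b)` is the edge added between edges `a` and `b`. -/

/-- The graph `G₁`: two disjoint copies of `K_{2,3}`, with parts `{1, 2}`, `{A, B, C}` and
`{3, 4}`, `{A', B', C'}`, joined by the three edges `AA'`, `BB'`, `CC'`. -/
def G1 : Graph (Fin 10) (Fin 15) :=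
  ofEnds
    ![s(0, 3), s(1, 4), s(2, 5),
     s(0, 6), s(0, 7), s(1, 6), s(1, 7), s(2, 6), s(2, 7),
     s(3, 8), s(3, 9), s(4, 8), s(4, 9), s(5, 8), s(5, 9)]

/-- `G₁ ∪ (AA'–BB') ∪ (Ax–CC')`, where `x` subdivides `AA'` and `y` subdivides `BB'`. -/
def H4 : Graph (Fin 14) (Fin 21) :=
  ofEnds
    ![s(0, 12), s(1, 11), s(2, 13), s(0, 6), s(0, 7), s(1, 6), s(1, 7),
     s(2, 6), s(2, 7), s(3, 8), s(3, 9), s(4, 8), s(4, 9), s(5, 8),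
     s(5, 9), s(10, 3), s(11, 4), s(10, 11), s(12, 10), s(13, 5), s(12, 13)]

/-- `G₁ ∪ (AA'–BB') ∪ (A1–B2)`, where `x` subdivides `AA'` and `y` subdivides `BB'`. -/
def H5 : Graph (Fin 14) (Fin 21) :=
  ofEnds
    ![s(0, 10), s(1, 11), s(2, 5), s(0, 12), s(0, 7), s(1, 6), s(1, 13),
     s(2, 6), s(2, 7), s(3, 8), s(3, 9), s(4, 8), s(4, 9), s(5, 8),
     s(5, 9), s(10, 3), s(11, 4), s(10, 11), s(12, 6), s(13, 7), s(12, 13)]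

/-- `G₁ ∪ (A1–B2) ∪ (Ax–By)`, where `x` subdivides `A1` and `y` subdivides `B2`. -/
def H6 : Graph (Fin 14) (Fin 21) :=
  ofEnds
    ![s(0, 3), s(1, 4), s(2, 5), s(0, 12), s(0, 7), s(1, 6), s(1, 13),
     s(2, 6), s(2, 7), s(3, 8), s(3, 9), s(4, 8), s(4, 9), s(5, 8),
     s(5, 9), s(10, 6), s(11, 7), s(10, 11), s(12, 10), s(13, 11), s(12, 13)]

/-- `G₁ ∪ (A1–B2) ∪ (Ax–B1)`, where `x` subdivides `A1` and `y` subdivides `B2`. -/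
def H7 : Graph (Fin 14) (Fin 21) :=
  ofEnds
    ![s(0, 3), s(1, 4), s(2, 5), s(0, 12), s(0, 7), s(1, 13), s(1, 11),
     s(2, 6), s(2, 7), s(3, 8), s(3, 9), s(4, 8), s(4, 9), s(5, 8),
     s(5, 9), s(10, 6), s(11, 7), s(10, 11), s(12, 10), s(13, 6), s(12, 13)]

/-- `G₁ ∪ (A1–B2) ∪ (A2–B1)`, where `x` subdivides `A1` and `y` subdivides `B2`. -/
def H8 : Graph (Fin 14) (Fin 21) :=
  ofEnds
    ![s(0, 3), s(1, 4), s(2, 5), s(0, 10), s(0, 12), s(1, 13), s(1, 11),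
     s(2, 6), s(2, 7), s(3, 8), s(3, 9), s(4, 8), s(4, 9), s(5, 8),
     s(5, 9), s(10, 6), s(11, 7), s(10, 11), s(12, 7), s(13, 6), s(12, 13)]

/-- `G₁ ∪ (AA'–BB') ∪ (xy–CC')`, where `x` subdivides `AA'` and `y` subdivides `BB'`. -/
def H9 : Graph (Fin 14) (Fin 21) :=
  ofEnds
    ![s(0, 10), s(1, 11), s(2, 13), s(0, 6), s(0, 7), s(1, 6), s(1, 7),
     s(2, 6), s(2, 7), s(3, 8), s(3, 9), s(4, 8), s(4, 9), s(5, 8),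
     s(5, 9), s(10, 3), s(11, 4), s(10, 12), s(12, 11), s(13, 5), s(12, 13)]

end CubicTorus

/-!
A theta graph drawn on the torus cuts it into a single hexagonal face, and every chord drawn
through a face cuts it in two; in this way `G₁`, with some additional arcs, is drawn so that each
face carries an explicit parametrization by a rectangle. Relabelling such a drawing by symmetries
of `G₁`, and drawing an edge through a face, gives for each `G₁ ∪ e₁` a few toroidal drawings.
If inner points of two edges lie on a common face of one of these, then the edges can be joined
through that face. The pairs of edges of `G₁ ∪ e₁` which share a face in none of them are those
whose joining gives one of `H₄, …, H₉`.
-/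

namespace CubicTorus

open Set Function unitInterval
open scoped Graph

/-! ### Open arcs -/

theorem injOn_Ioo_of_disjoint {X : Type*} {Γ : ℝ → X} {a b c : ℝ} (hab : a < b) (hbc : b < c)
    (hleft : InjOn Γ (Ioo a b)) (hright : InjOn Γ (Ioo b c))
    (hdisj : Disjoint (Γ '' Ioo a b) (Γ '' Ioo b c)) (hb : Γ b ∉ Γ '' Ioo a b)
    (hb' : Γ b ∉ Γ '' Ioo b c) : InjOn Γ (Ioo a c) := by
  have hne : ∀ {s t : ℝ} {A B : Set ℝ}, s ∈ A → t ∈ B → Disjoint (Γ '' A) (Γ '' B) →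
      Γ s ≠ Γ t := fun hs ht hAB h =>
    disjoint_left.1 hAB (mem_image_of_mem Γ hs) (h ▸ mem_image_of_mem Γ ht)
  have hunion : Ioo a c = Ioo a b ∪ insert b (Ioo b c) := by
    rw [Ioo_insert_left hbc, Ioo_union_Ico_eq_Ioo hab hbc.le]
  have hb_disj : Disjoint (Ioo a b) (insert b (Ioo b c)) := by
    rw [Ioo_insert_left hbc]
    exact disjoint_left.2 fun t ht ht' => ht.2.not_ge ht'.1
  have himage : Disjoint (Γ '' Ioo a b) (Γ '' insert b (Ioo b c)) := by
    rw [image_insert_eq]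
    exact disjoint_insert_right.2 ⟨hb, hdisj⟩
  rw [hunion, injOn_union hb_disj, injOn_insert (by simp)]
  exact ⟨hleft, ⟨hright, hb'⟩, fun s hs t ht => hne hs ht himage⟩

section OpenArc

variable {X : Type*} [TopologicalSpace X] {S T : Set X} {p q r : X}

/-- `S` is the interior of a curve from `p` to `q` which is injective on its interior; `p = q` is
allowed. -/
def OpenArc (S : Set X) (p q : X) : Prop :=
  ∃ Γ : ℝ → X, Continuous Γ ∧ Γ 0 = p ∧ Γ 1 = q ∧ InjOn Γ (Ioo 0 1) ∧ Γ '' Ioo 0 1 = S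

theorem openArc_image {Γ : ℝ → X} (hΓ : Continuous Γ) {a b : ℝ} (hab : a < b)
    (hinj : InjOn Γ (Ioo a b)) : OpenArc (Γ '' Ioo a b) (Γ a) (Γ b) := by
  have hpos : 0 < b - a := sub_pos.2 hab
  have himage : ((b - a) * · + a) '' Ioo 0 1 = Ioo a b := by
    simp [image_affine_Ioo hpos]
  refine ⟨Γ ∘ ((b - a) * · + a), by fun_prop, by simp, by simp, ?_, by rw [image_comp, himage]⟩
  refine hinj.comp (fun s _ t _ hst => ?_) (mapsTo_iff_image_subset.2 himage.subset)
  exact mul_left_cancel₀ hpos.ne' (add_right_cancel hst)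

theorem OpenArc.exists_unitInterval_curve (h : OpenArc S p q) :
    ∃ γ : C(I, X), γ 0 = p ∧ γ 1 = q ∧ InjOn γ (Ioo 0 1) ∧ γ '' Ioo 0 1 = S := by
  obtain ⟨Γ, hΓ, h0, h1, hinj, rfl⟩ := h
  refine ⟨⟨fun t => Γ t, by fun_prop⟩, by simpa using h0, by simpa using h1,
    fun s hs t ht hst => Subtype.ext (hinj hs ht hst), ?_⟩
  ext x
  constructor
  · rintro ⟨t, ht, rfl⟩
    exact ⟨t, ht, rfl⟩
  · rintro ⟨t, ht, rfl⟩
    exact ⟨⟨t, Ioo_subset_Icc_self ht⟩, ht, rfl⟩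

theorem OpenArc.symm (h : OpenArc S p q) : OpenArc S q p := by
  obtain ⟨Γ, hΓ, rfl, rfl, hinj, rfl⟩ := h
  have himage : (1 - ·) '' Ioo (0 : ℝ) 1 = Ioo 0 1 := by simp
  refine ⟨Γ ∘ (1 - ·), by fun_prop, by simp, by simp, ?_, by rw [image_comp, himage]⟩
  exact hinj.comp sub_right_injective.injOn (mapsTo_iff_image_subset.2 himage.subset)

theorem OpenArc.trans (h₁ : OpenArc S p q) (h₂ : OpenArc T q r) (hST : Disjoint S T)
    (hS : q ∉ S) (hT : q ∉ T) : OpenArc (S ∪ insert q T) p r := by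
  obtain ⟨Γ, hΓ, rfl, hq, hinj, rfl⟩ := h₁
  obtain ⟨Δ, hΔ, rfl, rfl, hinj', rfl⟩ := h₂
  let Λ : ℝ → X := fun t => if t ≤ 1 then Γ t else Δ (t - 1)
  have hΛ : Continuous Λ :=
    Continuous.if_le hΓ (by fun_prop) continuous_id continuous_const (by rintro t rfl; simpa)
  have hΛΓ : EqOn Λ Γ (Iic 1) := fun t ht => if_pos ht
  have hΛΓ' : EqOn Λ Γ (Ioo 0 1) := hΛΓ.mono fun t ht => ht.2.le
  have hΛΔ : EqOn Λ (Δ ∘ (· - 1)) (Ioi 1) := fun t ht => if_neg (not_le.2 ht)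
  have hΛΔ' : EqOn Λ (Δ ∘ (· - 1)) (Ioo 1 2) := hΛΔ.mono fun t ht => ht.1
  have hmid : Λ 1 = Δ 0 := (hΛΓ self_mem_Iic).trans hq
  have hend : Λ 2 = Δ 1 := (hΛΔ (by norm_num : (1 : ℝ) < 2)).trans (by norm_num)
  have hshift : (· - 1) '' Ioo (1 : ℝ) 2 = Ioo 0 1 := by norm_num
  have hleft : Λ '' Ioo 0 1 = Γ '' Ioo 0 1 := hΛΓ'.image_eq
  have hright : Λ '' Ioo 1 2 = Δ '' Ioo 0 1 := by rw [hΛΔ'.image_eq, image_comp, hshift]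
  have hinjΔ : InjOn (Δ ∘ (· - 1)) (Ioo 1 2) :=
    hinj'.comp sub_left_injective.injOn (mapsTo_iff_image_subset.2 hshift.subset)
  have harc := openArc_image hΛ zero_lt_two <| injOn_Ioo_of_disjoint zero_lt_one one_lt_two
    (hΛΓ'.injOn_iff.2 hinj) (hΛΔ'.injOn_iff.2 hinjΔ) (by rwa [hleft, hright])
    (by rwa [hleft, hmid]) (by rwa [hright, hmid])
  rwa [← Ioo_union_Ico_eq_Ioo zero_lt_one one_le_two, ← Ioo_insert_left one_lt_two, image_union,
    image_insert_eq, hleft, hright, hmid, hend, hΛΓ (zero_le_one : (0 : ℝ) ≤ 1)] at harc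

end OpenArc

/-! ### Cells -/

/-- The graph of `tent x y` over `[x, y]` is the chord by which a cell is cut: the union of the
segments from `(x, 0)` to the point at height `1 / 2` over the middle, and from there to
`(y, 0)`. -/
noncomputable def tent (x y z : ℝ) : ℝ := max 0 (min (z - x) (y - z)) / (y - x)

section Tent

variable {x y z : ℝ}

@[fun_prop]
theorem continuous_tent (x y : ℝ) : Continuous (tent x y) := by
  unfold tent; fun_prop

theorem tent_nonneg (h : x < y) (z : ℝ) : 0 ≤ tent x y z :=
  div_nonneg (le_max_left _ _) (sub_pos.2 h).le

theorem tent_lt_one (h : x < y) (z : ℝ) : tent x y z < 1 := by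
  rw [tent, div_lt_one (sub_pos.2 h), max_lt_iff, min_lt_iff]
  refine ⟨sub_pos.2 h, ?_⟩
  by_contra! hc
  linarith [hc.1, hc.2]

theorem tent_of_le_left (hz : z ≤ x) : tent x y z = 0 := by
  rw [tent, max_eq_left ((min_le_left _ _).trans (sub_nonpos.2 hz)), zero_div]

theorem tent_of_right_le (hz : y ≤ z) : tent x y z = 0 := by
  rw [tent, max_eq_left ((min_le_right _ _).trans (sub_nonpos.2 hz)), zero_div]

theorem lt_tent {u : ℝ} (h : x < y) (hx : u * (y - x) < z - x) (hy : u * (y - x) < y - z) :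
    u < tent x y z := by
  rw [tent, lt_div_iff₀ (sub_pos.2 h)]
  exact lt_max_of_lt_right (lt_min hx hy)

theorem tent_eq_of_le_half (h : x < y) {t : ℝ} (h0 : 0 ≤ t) (h1 : t ≤ 1 / 2) :
    tent x y (x + t * (y - x)) = t := by
  have hpos := sub_pos.2 h
  rw [tent, min_eq_left (by nlinarith), max_eq_right (by nlinarith)]
  field_simp
  ring

end Tent

/-- The point of the tent over `[x, y]` above the point that divides `[x, y]` in the ratio
`t : 1 - t`. -/
noncomputable def tentPoint (x y t : ℝ) : ℝ × ℝ :=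
  (x + t * (y - x), tent x y (x + t * (y - x)))

/-- The map from `(-1, 1) × (0, 1)` onto the triangle below the tent over `[x, y]`. In the affine
coordinates `u, v` with `(x, 0)` at the origin, `(y, 0)` at `(1, 0)` and the top of the tent at
`(0, 1)`, the boundary point `(s, 0)` goes to `(s, 0)` or `(0, -s)`, and increasing the second
coordinate moves it diagonally into the triangle. -/
noncomputable def belowMap (x y : ℝ) (z : ℝ × ℝ) : ℝ × ℝ :=
  let η := z.2 * ((1 - |z.1|) / 2)
  (x + (max z.1 0 + η + (max (-z.1) 0 + η) / 2) * (y - x), (max (-z.1) 0 + η) / 2)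

/-- The map which pushes a rectangle upwards onto the part of it above the tent over `[x, y]`. -/
noncomputable def aboveMap (x y : ℝ) (z : ℝ × ℝ) : ℝ × ℝ :=
  (z.1, tent x y z.1 + (1 - tent x y z.1) * z.2)

section Maps

variable {x y : ℝ}

@[fun_prop]
theorem continuous_tentPoint (x y : ℝ) : Continuous (tentPoint x y) := by
  unfold tentPoint; fun_prop

theorem tentPoint_injective (h : x < y) : Injective (tentPoint x y) := fun s t hst => by
  simpa [tentPoint, sub_ne_zero.2 h.ne'] using congrArg Prod.fst hst

@[simp]
theorem tentPoint_zero (x y : ℝ) : tentPoint x y 0 = (x, 0) := by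
  simp [tentPoint, tent_of_le_left]

@[simp]
theorem tentPoint_one (x y : ℝ) : tentPoint x y 1 = (y, 0) := by
  simp [tentPoint, tent_of_right_le]

theorem tentPoint_of_le_half (h : x < y) {t : ℝ} (h0 : 0 ≤ t) (h1 : t ≤ 1 / 2) :
    tentPoint x y t = (x + t * (y - x), t) := by
  rw [tentPoint, tent_eq_of_le_half h h0 h1]

theorem continuous_belowMap (x y : ℝ) : Continuous (belowMap x y) := by
  unfold belowMap; fun_prop

theorem belowMap_injOn (h : x < y) : InjOn (belowMap x y) (Ioo (-1) 1 ×ˢ Ioo 0 1) := by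
  rintro ⟨s, t⟩ ⟨hs, -⟩ ⟨s', t'⟩ - hst
  simp only [belowMap, Prod.mk.injEq] at hst
  obtain ⟨h1, h2⟩ := hst
  have hs' : s = s' := by
    have h1' := mul_right_cancel₀ (sub_ne_zero.2 h.ne') (add_left_cancel h1)
    rw [← max_zero_sub_max_neg_zero_eq_self s, ← max_zero_sub_max_neg_zero_eq_self s']
    linarith
  subst hs'
  have hpos : 0 < (1 - |s|) / 2 := half_pos (sub_pos.2 (abs_lt.2 hs))
  have ht : t = t' := mul_right_cancel₀ hpos.ne' (by linarith)
  rw [ht]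

theorem belowMap_mem (h : x < y) {z : ℝ × ℝ} (hz : z ∈ Ioo (-1) 1 ×ˢ Ioo (0 : ℝ) 1) :
    (belowMap x y z).1 ∈ Ioo x y ∧ 0 < (belowMap x y z).2 ∧
      (belowMap x y z).2 < tent x y (belowMap x y z).1 := by
  obtain ⟨hs, h3, h4⟩ := hz
  have hpos : 0 < (1 - |z.1|) / 2 := half_pos (sub_pos.2 (abs_lt.2 hs))
  simp only [belowMap]
  set η := z.2 * ((1 - |z.1|) / 2)
  set u := max z.1 0 + η
  set v := max (-z.1) 0 + η
  have hη : 0 < η := mul_pos h3 hpos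
  have hη' : η < (1 - |z.1|) / 2 := mul_lt_of_lt_one_left hpos h4
  have hu : 0 < u := add_pos_of_nonneg_of_pos (le_max_right _ _) hη
  have hv : 0 < v := add_pos_of_nonneg_of_pos (le_max_right _ _) hη
  have huv : u + v < 1 := by
    linarith [max_zero_add_max_neg_zero_eq_abs_self z.1]
  refine ⟨⟨?_, ?_⟩, half_pos hv, lt_tent h ?_ ?_⟩ <;> nlinarith [sub_pos.2 h]

theorem belowMap_of_nonneg {s : ℝ} (hs : 0 ≤ s) : belowMap x y (s, 0) = (x + s * (y - x), 0) := by
  simp [belowMap, hs]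

theorem belowMap_neg_two_mul (h : x < y) {t : ℝ} (h0 : 0 ≤ t) (h1 : t ≤ 1 / 2) :
    belowMap x y (-(2 * t), 0) = tentPoint x y t := by
  rw [tentPoint_of_le_half h h0 h1]
  simp [belowMap, h0]

theorem continuous_aboveMap (x y : ℝ) : Continuous (aboveMap x y) := by
  unfold aboveMap; fun_prop

theorem aboveMap_injective (h : x < y) : Injective (aboveMap x y) := by
  rintro ⟨s, t⟩ ⟨s', t'⟩ hst
  simp only [aboveMap, Prod.mk.injEq] at hst
  obtain ⟨rfl, h2⟩ := hst
  rw [mul_left_cancel₀ (sub_pos.2 (tent_lt_one h s)).ne' (add_left_cancel h2)]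

theorem aboveMap_mem (h : x < y) {z : ℝ × ℝ} (hz : z.2 ∈ Ioo (0 : ℝ) 1) :
    (aboveMap x y z).2 ∈ Ioo (tent x y z.1) 1 := by
  have hpos := sub_pos.2 (tent_lt_one h z.1)
  have h1 := mul_pos hpos hz.1
  have h2 := mul_lt_mul_of_pos_left hz.2 hpos
  constructor <;> simp only [aboveMap] <;> linarith

theorem aboveMap_apply_zero (x y s : ℝ) : aboveMap x y (s, 0) = (s, tent x y s) := by
  simp [aboveMap]

end Maps

section Cell

variable {X : Type*} [TopologicalSpace X] {U V : Set X} {φ : ℝ × ℝ → X} {a b : ℝ}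

/-- `φ` parametrizes a part of `U` by the open rectangle `(a, b) × (0, 1)`; it need not be
injective on the sides of the rectangle. -/
structure IsChart (φ : ℝ × ℝ → X) (a b : ℝ) (U : Set X) : Prop where
  continuous : Continuous φ
  injOn : InjOn φ (Ioo a b ×ˢ Ioo 0 1)
  mapsTo : MapsTo φ (Ioo a b ×ˢ Ioo 0 1) U

/-- `U` contains an open cell on whose boundary the points `pts` lie in this order: they are the
images of points on the lower side of a rectangle by which the cell is parametrized. -/
def IsCell (U : Set X) (pts : List X) : Prop :=
  ∃ (φ : ℝ × ℝ → X) (a b : ℝ) (xs : List ℝ), IsChart φ a b U ∧ xs.Pairwise (· < ·) ∧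
    (∀ x ∈ xs, x ∈ Icc a b) ∧ xs.map (fun x => φ (x, 0)) = pts

theorem IsCell.mono {pts : List X} (h : IsCell U pts) (hUV : U ⊆ V) : IsCell V pts := by
  obtain ⟨φ, a, b, xs, hφ, hxs⟩ := h
  exact ⟨φ, a, b, xs, ⟨hφ.continuous, hφ.injOn, hφ.mapsTo.mono_right hUV⟩, hxs⟩

theorem IsCell.reverse {pts : List X} (h : IsCell U pts) : IsCell U pts.reverse := by
  obtain ⟨φ, a, b, xs, hφ, hxs, hxs', rfl⟩ := h
  let ψ : ℝ × ℝ → ℝ × ℝ := fun z => (-z.1, z.2)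
  have hψ : MapsTo ψ (Ioo (-b) (-a) ×ˢ Ioo 0 1) (Ioo a b ×ˢ Ioo 0 1) := fun z hz =>
    ⟨⟨lt_neg_of_lt_neg hz.1.2, neg_lt_of_neg_lt hz.1.1⟩, hz.2⟩
  have hinj : Injective ψ := fun z w hzw =>
    Prod.ext (neg_injective (congrArg Prod.fst hzw)) (congrArg Prod.snd hzw :)
  refine ⟨φ ∘ ψ, -b, -a, (xs.map Neg.neg).reverse,
    ⟨hφ.continuous.comp (by fun_prop), hφ.injOn.comp hinj.injOn hψ, hφ.mapsTo.comp hψ⟩, ?_, ?_, ?_⟩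
  · simpa [List.pairwise_reverse, List.pairwise_map] using hxs
  · simp only [List.mem_reverse, List.mem_map]
    rintro _ ⟨x, hx, rfl⟩
    exact ⟨neg_le_neg (hxs' x hx).2, neg_le_neg (hxs' x hx).1⟩
  · simp [ψ, comp_def]

theorem IsChart.comp (h : IsChart φ a b U) {ψ : ℝ × ℝ → ℝ × ℝ} {a' b' : ℝ} {S : Set (ℝ × ℝ)}
    (hψ : Continuous ψ) (hinj : InjOn ψ (Ioo a' b' ×ˢ Ioo 0 1))
    (hmaps : MapsTo ψ (Ioo a' b' ×ˢ Ioo 0 1) S) (hS : S ⊆ Ioo a b ×ˢ Ioo 0 1) :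
    IsChart (φ ∘ ψ) a' b' (φ '' S) where
  continuous := h.continuous.comp hψ
  injOn := h.injOn.comp hinj (hmaps.mono_right hS)
  mapsTo := (mapsTo_image φ S).comp hmaps

theorem IsChart.disjoint_image (h : IsChart φ a b U) {A B : Set (ℝ × ℝ)}
    (hA : A ⊆ Ioo a b ×ˢ Ioo 0 1) (hB : B ⊆ Ioo a b ×ˢ Ioo 0 1) (hAB : Disjoint A B) :
    Disjoint (φ '' A) (φ '' B) := by
  rw [disjoint_iff_inter_eq_empty, ← h.injOn.image_inter hA hB, hAB.inter_eq, image_empty]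

/-- The part of the rectangle `(a, b) × (0, 1)` below the tent over `[x, y]`. -/
def belowTent (a b x y : ℝ) : Set (ℝ × ℝ) := {z ∈ Ioo a b ×ˢ Ioo 0 1 | z.2 < tent x y z.1}

/-- The part of the rectangle `(a, b) × (0, 1)` above the tent over `[x, y]`. -/
def aboveTent (a b x y : ℝ) : Set (ℝ × ℝ) := {z ∈ Ioo a b ×ˢ Ioo 0 1 | tent x y z.1 < z.2}

variable {x y : ℝ}

theorem tentPoint_mem (hax : a ≤ x) (hxy : x < y) (hyb : y ≤ b) {t : ℝ} (ht : t ∈ Ioo (0 : ℝ) 1) :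
    tentPoint x y t ∈ Ioo a b ×ˢ Ioo (0 : ℝ) 1 := by
  have hl := sub_pos.2 hxy
  have h0 : 0 < t * (y - x) := mul_pos ht.1 hl
  have h1 : t * (y - x) < y - x := mul_lt_of_lt_one_left hl ht.2
  refine ⟨?_, lt_tent hxy ?_ ?_, tent_lt_one hxy _⟩
  · constructor <;> simp only [tentPoint] <;> linarith
  all_goals linarith

theorem IsChart.isCell_belowTent (h : IsChart φ a b U) (hax : a ≤ x) (hxy : x < y) (hyb : y ≤ b)
    {us : List ℝ} (hus : us.Pairwise (· < ·)) (hus' : ∀ u ∈ us, u ∈ Ioo x y)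
    {ts : List ℝ} (hts : ts.Pairwise (· < ·)) (hts' : ∀ t ∈ ts, t ∈ Ioo (0 : ℝ) (1 / 2)) :
    IsCell (φ '' belowTent a b x y) ((ts.map (φ ∘ tentPoint x y)).reverse ++
      φ (x, 0) :: (us.map (fun u => φ (u, 0)) ++ [φ (y, 0)])) := by
  have hl := sub_pos.2 hxy
  have hu : ∀ u ∈ us, 0 < (u - x) / (y - x) ∧ (u - x) / (y - x) < 1 := fun u hu => by
    rw [div_lt_one hl]
    exact ⟨div_pos (sub_pos.2 (hus' u hu).1) hl, sub_lt_sub_right (hus' u hu).2 x⟩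
  have hmaps : MapsTo (belowMap x y) (Ioo (-1) 1 ×ˢ Ioo 0 1) (belowTent a b x y) := fun z hz => by
    obtain ⟨hz1, hz2, hz3⟩ := belowMap_mem hxy hz
    exact ⟨⟨⟨hax.trans_lt hz1.1, hz1.2.trans_le hyb⟩, hz2, hz3.trans (tent_lt_one hxy _)⟩, hz3⟩
  refine ⟨φ ∘ belowMap x y, -1, 1, (ts.map fun t => -(2 * t)).reverse ++
      0 :: (us.map (fun u => (u - x) / (y - x)) ++ [1]),
    h.comp (continuous_belowMap x y) (belowMap_injOn hxy) hmaps (sep_subset _ _), ?_, ?_, ?_⟩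
  · have hus_map : (us.map fun u => (u - x) / (y - x)).Pairwise (· < ·) :=
      List.pairwise_map.2 <| hus.imp fun h => by gcongr
    have hts_map : (ts.map fun t => -(2 * t)).reverse.Pairwise (· < ·) :=
      List.pairwise_reverse.2 <| List.pairwise_map.2 <| hts.imp fun h => by linarith
    simp only [List.pairwise_append, List.pairwise_cons, List.mem_append, List.mem_cons,
      List.mem_reverse, List.mem_map]
    grind
  · simp only [List.mem_append, List.mem_cons, List.mem_reverse, List.mem_map]
    grind
  · have hbottom : ∀ u ∈ us, belowMap x y ((u - x) / (y - x), 0) = (u, 0) := fun u hu' => by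
      rw [belowMap_of_nonneg (hu u hu').1.le, div_mul_cancel₀ _ hl.ne', add_sub_cancel]
    have htent : ∀ t ∈ ts, belowMap x y (-(2 * t), 0) = tentPoint x y t := fun t ht =>
      belowMap_neg_two_mul hxy (hts' t ht).1.le (hts' t ht).2.le
    simp only [List.map_append, List.map_reverse, List.map_cons, List.map_map, List.map_nil,
      comp_apply, belowMap_of_nonneg le_rfl, belowMap_of_nonneg zero_le_one, zero_mul, add_zero,
      one_mul, add_sub_cancel]
    congr 1
    · exact congrArg _ (List.map_congr_left fun t ht => congrArg φ (htent t ht))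
    · congr 2
      exact List.map_congr_left fun u hu => congrArg φ (hbottom u hu)

theorem IsChart.isCell_aboveTent (h : IsChart φ a b U) (hxy : x < y) {vs ws : List ℝ}
    (hvs : (vs ++ x :: y :: ws).Pairwise (· < ·)) (hmem : ∀ v ∈ vs ++ x :: y :: ws, v ∈ Icc a b)
    {ts : List ℝ} (hts : ts.Pairwise (· < ·)) (hts' : ∀ t ∈ ts, t ∈ Ioo (0 : ℝ) 1) :
    IsCell (φ '' aboveTent a b x y) (vs.map (fun v => φ (v, 0)) ++
      φ (x, 0) :: (ts.map (φ ∘ tentPoint x y) ++ φ (y, 0) :: ws.map fun w => φ (w, 0))) := by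
  have hl := sub_pos.2 hxy
  have hmaps : MapsTo (aboveMap x y) (Ioo a b ×ˢ Ioo 0 1) (aboveTent a b x y) := fun z hz =>
    have hz' := aboveMap_mem hxy hz.2
    ⟨⟨hz.1, (tent_nonneg hxy _).trans_lt hz'.1, hz'.2⟩, hz'.1⟩
  have hts_map : (ts.map fun t => x + t * (y - x)).Pairwise (· < ·) :=
    List.pairwise_map.2 <| hts.imp fun h => by gcongr
  have hts_mem : ∀ s ∈ ts.map (fun t => x + t * (y - x)), x < s ∧ s < y := by
    rintro _ hs
    obtain ⟨t, ht, rfl⟩ := List.mem_map.1 hs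
    have h0 := mul_pos (hts' t ht).1 hl
    have h1 := mul_lt_of_lt_one_left hl (hts' t ht).2
    constructor <;> linarith
  simp only [List.pairwise_append, List.pairwise_cons, List.mem_append, List.mem_cons] at hvs hmem
  refine ⟨φ ∘ aboveMap x y, a, b, vs ++ x :: (ts.map (fun t => x + t * (y - x)) ++ y :: ws),
    h.comp (continuous_aboveMap x y) (aboveMap_injective hxy).injOn hmaps (sep_subset _ _),
    ?_, ?_, ?_⟩
  · simp only [List.pairwise_append, List.pairwise_cons, List.mem_append, List.mem_cons]
    grind
  · simp only [List.mem_append, List.mem_cons]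
    grind
  · simp only [List.map_append, List.map_cons, List.map_map, comp_apply, aboveMap_apply_zero,
      tent_of_le_left le_rfl, tent_of_right_le le_rfl]
    congr 1
    · refine List.map_congr_left fun v hv => ?_
      rw [tent_of_le_left (hvs.2.2 v hv x (by simp)).le]
    · congr 3
      refine List.map_congr_left fun w hw => ?_
      rw [tent_of_right_le (hvs.2.1.2.1 w hw).le]

/-- The curve `Γ` on `[0, m + 1]` is a chord which cuts a cell in `U` into cells in `U₁` and
`U₂`. -/
structure IsCut (U : Set X) (m : ℕ) (Γ : ℝ → X) (U₁ U₂ : Set X) : Prop where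
  continuous : Continuous Γ
  injOn : InjOn Γ (Ioo 0 (m + 1 : ℕ))
  mapsTo : MapsTo Γ (Ioo 0 (m + 1 : ℕ)) U
  left_subset : U₁ ⊆ U
  right_subset : U₂ ⊆ U
  disjoint : Disjoint U₁ U₂
  disjoint_left : Disjoint (Γ '' Ioo 0 (m + 1 : ℕ)) U₁
  disjoint_right : Disjoint (Γ '' Ioo 0 (m + 1 : ℕ)) U₂

theorem IsChart.isCut (h : IsChart φ a b U) (hax : a ≤ x) (hxy : x < y) (hyb : y ≤ b) {m : ℕ}
    {ρ : ℝ → ℝ} (hρ : Continuous ρ) (hmono : StrictMono ρ) (hρ0 : ρ 0 = 0)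
    (hρ1 : ρ (m + 1 : ℕ) = 1) :
    IsCut U m (φ ∘ tentPoint x y ∘ ρ) (φ '' belowTent a b x y) (φ '' aboveTent a b x y) := by
  have hρmaps : MapsTo ρ (Ioo 0 (m + 1 : ℕ)) (Ioo 0 1) := fun t ht =>
    ⟨hρ0 ▸ hmono ht.1, hρ1 ▸ hmono ht.2⟩
  have hmaps : MapsTo (tentPoint x y ∘ ρ) (Ioo 0 (m + 1 : ℕ)) (Ioo a b ×ˢ Ioo 0 1) := fun t ht =>
    tentPoint_mem hax hxy hyb (hρmaps ht)
  have hbelow : belowTent a b x y ⊆ Ioo a b ×ˢ Ioo 0 1 := sep_subset _ _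
  have habove : aboveTent a b x y ⊆ Ioo a b ×ˢ Ioo 0 1 := sep_subset _ _
  have hdisj : ∀ {A : Set (ℝ × ℝ)}, A ⊆ Ioo a b ×ˢ Ioo 0 1 → (∀ z ∈ A, z.2 ≠ tent x y z.1) →
      Disjoint ((φ ∘ tentPoint x y ∘ ρ) '' Ioo 0 (m + 1 : ℕ)) (φ '' A) := fun hA hne => by
    rw [image_comp]
    refine h.disjoint_image (mapsTo_iff_image_subset.1 hmaps) hA (disjoint_left.2 ?_)
    rintro _ ⟨t, -, rfl⟩ hz
    exact hne _ hz rfl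
  exact {
    continuous := h.continuous.comp ((continuous_tentPoint x y).comp hρ)
    injOn := h.injOn.comp ((tentPoint_injective hxy).comp hmono.injective).injOn hmaps
    mapsTo := h.mapsTo.comp hmaps
    left_subset := mapsTo_iff_image_subset.1 (h.mapsTo.mono_left hbelow)
    right_subset := mapsTo_iff_image_subset.1 (h.mapsTo.mono_left habove)
    disjoint := h.disjoint_image hbelow habove <|
      disjoint_left.2 fun z hz hz' => lt_asymm hz.2 hz'.2
    disjoint_left := hdisj hbelow fun z hz => hz.2.ne
    disjoint_right := hdisj habove fun z hz => hz.2.ne' }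

theorem exists_strictMono_slow_start (m : ℕ) : ∃ ρ : ℝ → ℝ, Continuous ρ ∧ StrictMono ρ ∧
    ρ 0 = 0 ∧ ρ m < 1 / 2 ∧ ρ (m + 1 : ℕ) = 1 := by
  refine ⟨fun t => t / (2 * (m + 1)) + max 0 (t - m) / 2, by fun_prop, fun s t hst => ?_,
    by simp, ?_, ?_⟩
  · have h1 : s / (2 * (m + 1)) < t / (2 * (m + 1)) := by gcongr
    have h2 : max 0 (s - m) ≤ max 0 (t - m) := by gcongr
    change _ + _ < _ + _
    linarith
  · beta_reduce
    rw [sub_self, max_self, zero_div, add_zero, div_lt_iff₀ (by positivity)]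
    linarith
  · beta_reduce
    rw [Nat.cast_succ, add_sub_cancel_left, max_eq_right zero_le_one]
    field_simp
    norm_num

/-- The points of a curve at the parameters `1, …, m`. -/
def nodes (m : ℕ) (Γ : ℝ → X) : List X := (List.range m).map fun j => Γ (j + 1 : ℕ)

theorem IsCell.exists_isCut {l₁ l₂ l₃ : List X} {P Q : X}
    (h : IsCell U (l₁ ++ P :: (l₂ ++ Q :: l₃))) (m : ℕ) :
    ∃ (Γ : ℝ → X) (U₁ U₂ : Set X), IsCut U m Γ U₁ U₂ ∧ Γ 0 = P ∧ Γ (m + 1 : ℕ) = Q ∧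
      IsCell U₁ ((nodes m Γ).reverse ++ P :: (l₂ ++ [Q])) ∧
      IsCell U₂ (l₁ ++ P :: (nodes m Γ ++ Q :: l₃)) := by
  obtain ⟨φ, a, b, xs, hφ, hsort, hmem, hxs⟩ := h
  obtain ⟨vs, r₁, rfl, rfl, hr₁⟩ := List.map_eq_append_iff.1 hxs
  obtain ⟨x, r₂, rfl, rfl, hr₂⟩ := List.map_eq_cons_iff.1 hr₁
  obtain ⟨us, r₃, rfl, rfl, hr₃⟩ := List.map_eq_append_iff.1 hr₂
  obtain ⟨y, ws, rfl, rfl, rfl⟩ := List.map_eq_cons_iff.1 hr₃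
  have houter : (vs ++ x :: y :: ws).Pairwise (· < ·) := hsort.sublist <|
    (List.Sublist.refl vs).append ((List.sublist_append_right us (y :: ws)).cons_cons x)
  simp only [List.pairwise_append, List.pairwise_cons, List.mem_append, List.mem_cons] at hsort hmem
  have hxy : x < y := by grind
  have hax : a ≤ x := by grind
  have hyb : y ≤ b := by grind
  obtain ⟨ρ, hρ, hmono, hρ0, hρm, hρ1⟩ := exists_strictMono_slow_start m
  let ts : List ℝ := (List.range m).map fun j => ρ (j + 1 : ℕ)
  have hts : ts.Pairwise (· < ·) := List.pairwise_map.2 <| List.pairwise_lt_range.imp fun h =>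
    hmono (by exact_mod_cast Nat.succ_lt_succ h)
  have hts' : ∀ t ∈ ts, 0 < t ∧ t < 1 / 2 := by
    simp only [ts, List.mem_map, List.mem_range]
    rintro _ ⟨j, hj, rfl⟩
    exact ⟨hρ0 ▸ hmono (by positivity), (hmono.monotone (by exact_mod_cast hj)).trans_lt hρm⟩
  have hnodes : nodes m (φ ∘ tentPoint x y ∘ ρ) = ts.map (φ ∘ tentPoint x y) := by
    simp only [nodes, ts, List.map_map, comp_def]
  refine ⟨φ ∘ tentPoint x y ∘ ρ, φ '' belowTent a b x y, φ '' aboveTent a b x y,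
    hφ.isCut hax hxy hyb hρ hmono hρ0 hρ1, by simp [hρ0], by simp only [comp_apply, hρ1,
      tentPoint_one], ?_, ?_⟩
  · rw [hnodes]
    exact hφ.isCell_belowTent hax hxy hyb (by grind) (by grind) hts hts'
  · rw [hnodes]
    exact hφ.isCell_aboveTent hxy houter (by grind) hts (fun t ht => ⟨(hts' t ht).1,
      (hts' t ht).2.trans (by norm_num)⟩)

end Cell

/-! ### Skeletons -/

/-- The pairs of consecutive elements of a list. -/
def links (l : List ℕ) : List (Sym2 ℕ) := List.zipWith (fun a b => s(a, b)) l l.tail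

theorem mem_links {l : List ℕ} {z : Sym2 ℕ} :
    z ∈ links l ↔ ∃ (k : ℕ) (h : k + 1 < l.length), s(l[k], l[k + 1]) = z := by
  simp only [links, List.mem_iff_getElem, List.getElem_zipWith, List.length_zipWith,
    List.length_tail, List.getElem_tail]
  exact ⟨fun ⟨k, h, hz⟩ => ⟨k, by omega, hz⟩, fun ⟨k, h, hz⟩ => ⟨k, by omega, hz⟩⟩

/-- The path from `p` to `q` through the `m` vertices `n, n + 1, …`. -/
def path (n m p q : ℕ) : List ℕ := p :: (List.range' n m ++ [q])

/-- The vertex number `k` of `path n m p q`. -/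
def pathVertex (n m p q k : ℕ) : ℕ := if k = 0 then p else if k ≤ m then n + (k - 1) else q

theorem length_path (n m p q : ℕ) : (path n m p q).length = m + 2 := by simp [path]

section Path

variable {n m p q : ℕ}

theorem getElem_path {k : ℕ} (h : k < (path n m p q).length) :
    (path n m p q)[k] = pathVertex n m p q k := by
  rw [length_path] at h
  rcases k with _ | k
  · simp [path, pathVertex]
  · simp only [path, pathVertex, List.getElem_cons_succ]
    by_cases hk : k < m
    · rw [List.getElem_append_left (by simpa using hk)]
      simp [Nat.succ_le_of_lt hk]
    · obtain rfl : k = m := by omega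
      simp

theorem pathVertex_succ {k : ℕ} (hk : k < m) : pathVertex n m p q (k + 1) = n + k := by
  simp [pathVertex, Nat.succ_le_of_lt hk]

theorem pathVertex_injOn (hp : p < n) (hq : q < n) (hpq : p ≠ q) :
    InjOn (pathVertex n m p q) (Iic (m + 1)) := by
  simp only [InjOn, mem_Iic, pathVertex]
  grind

theorem pathVertex_lt (hp : p < n) (hq : q < n) (k : ℕ) : pathVertex n m p q k < n + m := by
  unfold pathVertex
  split_ifs <;> omega

theorem le_pathVertex {k : ℕ} (h : 0 < k) (hk : k ≤ m) : n ≤ pathVertex n m p q k := by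
  unfold pathVertex
  split_ifs <;> omega

theorem mem_links_path {z : Sym2 ℕ} : z ∈ links (path n m p q) ↔
    ∃ k ≤ m, s(pathVertex n m p q k, pathVertex n m p q (k + 1)) = z := by
  simp only [mem_links, getElem_path, length_path]
  exact ⟨fun ⟨k, h, hz⟩ => ⟨k, by omega, hz⟩, fun ⟨k, h, hz⟩ => ⟨k, by omega, hz⟩⟩

theorem exists_mem_ge_of_mem_links_path (hm : 0 < m) {z : Sym2 ℕ}
    (hz : z ∈ links (path n m p q)) : ∃ a ∈ z, n ≤ a := by
  obtain ⟨k, hk, rfl⟩ := mem_links_path.1 hz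
  obtain rfl | hk0 := Nat.eq_zero_or_pos k
  · exact ⟨_, Sym2.mem_mk_right _ _, le_pathVertex one_pos hm⟩
  · exact ⟨_, Sym2.mem_mk_left _ _, le_pathVertex hk0 hk⟩

theorem lt_of_mem_links_path (hp : p < n) (hq : q < n) {z : Sym2 ℕ}
    (hz : z ∈ links (path n m p q)) {a : ℕ} (ha : a ∈ z) : a < n + m := by
  obtain ⟨k, -, rfl⟩ := mem_links_path.1 hz
  obtain rfl | rfl := Sym2.mem_iff.1 ha <;> exact pathVertex_lt hp hq _

/-- The vertex `s(a, a)` or link `s(a, b)` of `path n m p q` in which the parameter `t` lies if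
the path is parametrized by `[0, m + 1]` with its vertices at the integers. -/
noncomputable def pathPiece (n m p q : ℕ) (t : ℝ) : Sym2 ℕ :=
  s(pathVertex n m p q ⌊t⌋₊, pathVertex n m p q ⌈t⌉₊)

theorem floor_ceil_bounds {t : ℝ} (ht : t ∈ Ioo (0 : ℝ) (m + 1 : ℕ)) :
    ⌊t⌋₊ ≤ m ∧ 0 < ⌈t⌉₊ ∧ ⌈t⌉₊ ≤ m + 1 ∧ ⌊t⌋₊ ≤ ⌈t⌉₊ ∧ ⌈t⌉₊ ≤ ⌊t⌋₊ + 1 :=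
  ⟨Nat.lt_succ_iff.1 ((Nat.floor_lt ht.1.le).2 ht.2), Nat.ceil_pos.2 ht.1, Nat.ceil_le.2 ht.2.le,
    Nat.floor_le_ceil t, Nat.ceil_le_floor_add_one t⟩

theorem lt_of_mem_pathPiece (hp : p < n) (hq : q < n) {t : ℝ} {a : ℕ}
    (ha : a ∈ pathPiece n m p q t) : a < n + m := by
  obtain rfl | rfl := Sym2.mem_iff.1 ha <;> exact pathVertex_lt hp hq _

theorem exists_mem_pathPiece_ge {t : ℝ} (hm : 0 < m) (ht : t ∈ Ioo (0 : ℝ) (m + 1 : ℕ)) :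
    ∃ a ∈ pathPiece n m p q t, n ≤ a := by
  have hb := floor_ceil_bounds ht
  obtain hf | hf := Nat.eq_zero_or_pos ⌊t⌋₊
  · exact ⟨_, Sym2.mem_mk_right _ _, le_pathVertex hb.2.1 (by omega)⟩
  · exact ⟨_, Sym2.mem_mk_left _ _, le_pathVertex hf hb.1⟩

theorem pathPiece_eq_vertex_iff (hp : p < n) (hq : q < n) (hpq : p ≠ q) {t : ℝ}
    (ht : t ∈ Ioo (0 : ℝ) (m + 1 : ℕ)) {k : ℕ} (hk : k < m) :
    pathPiece n m p q t = s(n + k, n + k) ↔ t = (k + 1 : ℕ) := by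
  have hb := floor_ceil_bounds ht
  rw [← pathVertex_succ (p := p) (q := q) hk]
  refine ⟨fun h => ?_, ?_⟩
  · have h' : pathVertex n m p q ⌊t⌋₊ = pathVertex n m p q (k + 1) ∧
        pathVertex n m p q ⌈t⌉₊ = pathVertex n m p q (k + 1) := by
      simpa only [or_self] using Sym2.eq_iff.1 h
    have hfloor : ⌊t⌋₊ = k + 1 := pathVertex_injOn hp hq hpq (mem_Iic.2 (by omega))
      (mem_Iic.2 (by omega)) h'.1
    have hceil : ⌈t⌉₊ = k + 1 := pathVertex_injOn hp hq hpq (mem_Iic.2 (by omega))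
      (mem_Iic.2 (by omega)) h'.2
    exact le_antisymm (hceil ▸ Nat.le_ceil t) (hfloor ▸ Nat.floor_le ht.1.le)
  · rintro rfl
    rw [pathPiece, Nat.floor_natCast, Nat.ceil_natCast]

theorem floor_and_ceil_eq_iff {t : ℝ} (ht : 0 < t) {k : ℕ} :
    ⌊t⌋₊ = k ∧ ⌈t⌉₊ = k + 1 ↔ t ∈ Ioo (k : ℝ) (k + 1 : ℕ) := by
  rw [Nat.floor_eq_iff ht.le, Nat.ceil_eq_iff (by omega), Nat.add_sub_cancel, mem_Ioo,
    Nat.cast_succ]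
  grind

theorem pathPiece_eq_link_iff (hp : p < n) (hq : q < n) (hpq : p ≠ q) {t : ℝ}
    (ht : t ∈ Ioo (0 : ℝ) (m + 1 : ℕ)) {k : ℕ} (hk : k ≤ m) :
    pathPiece n m p q t = s(pathVertex n m p q k, pathVertex n m p q (k + 1)) ↔
      t ∈ Ioo (k : ℝ) (k + 1 : ℕ) := by
  have hb := floor_ceil_bounds ht
  have hinj : ∀ {i j : ℕ}, i ≤ m + 1 → j ≤ m + 1 →
      (pathVertex n m p q i = pathVertex n m p q j ↔ i = j) := fun hi hj =>
    (pathVertex_injOn hp hq hpq).eq_iff hi hj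
  rw [← floor_and_ceil_eq_iff ht.1, pathPiece, Sym2.eq_iff, hinj (by omega) (by omega),
    hinj (by omega) (by omega), hinj (by omega) (by omega), hinj (by omega) (by omega)]
  omega

end Path

/-- The part of a drawing in which a point lies: a vertex or an arc, the interior of a cell, or
none of these. The vertex `a` is the piece `s(a, a)`, an arc from `a` to `b` is `s(a, b)`. -/
inductive Label
  | piece (z : Sym2 ℕ)
  | cell (k : ℕ)
  | free

section Curve

variable {X : Type*} {Γ : ℝ → X}

theorem exists_relabel_curve {lab : X → Label} {J : Set ℝ} (hΓ : InjOn Γ J)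
    (hfree : ∀ t ∈ J, lab (Γ t) = .free) (f : ℝ → Sym2 ℕ) :
    ∃ lab' : X → Label, (∀ x ∉ Γ '' J, lab' x = lab x) ∧
      (∀ x z, lab' x = .piece z ↔ lab x = .piece z ∨ ∃ t ∈ J, f t = z ∧ Γ t = x) ∧
      ∀ x k, lab' x = .cell k ↔ lab x = .cell k := by
  let lab' : X → Label := extend (J.domRestrict Γ) (fun t => .piece (f t)) lab
  have hin : ∀ t ∈ J, lab' (Γ t) = .piece (f t) := fun t ht =>
    (injOn_iff_injective.1 hΓ).extend_apply _ _ ⟨t, ht⟩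
  have hout : ∀ x ∉ Γ '' J, lab' x = lab x := fun x hx =>
    extend_apply' _ _ _ fun ⟨t, ht⟩ => hx ⟨t, t.2, ht⟩
  refine ⟨lab', hout, fun x z => ?_, fun x k => ?_⟩ <;> by_cases hx : x ∈ Γ '' J
  · obtain ⟨t, ht, rfl⟩ := hx
    rw [hin t ht, hfree t ht, Label.piece.injEq]
    refine ⟨fun hz => Or.inr ⟨t, ht, hz, rfl⟩, ?_⟩
    rintro (hz | ⟨s, hs, hz, hst⟩)
    · cases hz
    · rwa [← hΓ hs ht hst]
  · rw [hout x hx]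
    exact ⟨Or.inl, fun h => h.resolve_right fun ⟨t, ht, _, htx⟩ => hx ⟨t, ht, htx⟩⟩
  · obtain ⟨t, ht, rfl⟩ := hx
    simp only [hin t ht, hfree t ht, reduceCtorEq]
  · rw [hout x hx]

variable {n m p q : ℕ}

theorem exists_extend_vert {vert : ℕ → X} (hp : p < n) (hq : q < n) (h0 : Γ 0 = vert p)
    (h1 : Γ (m + 1 : ℕ) = vert q) : ∃ vert' : ℕ → X,
      (∀ a < n, vert' a = vert a) ∧ ∀ k ≤ m + 1, vert' (pathVertex n m p q k) = Γ k := by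
  refine ⟨fun a => if a < n then vert a else Γ (a - n + 1 : ℕ), fun a ha => if_pos ha,
    fun k hk => ?_⟩
  obtain rfl | hk0 := Nat.eq_zero_or_pos k
  · simpa [pathVertex, hp] using h0.symm
  obtain hkm | hkm := Nat.lt_or_ge m k
  · obtain rfl : k = m + 1 := by omega
    simpa [pathVertex, hq] using h1.symm
  · obtain ⟨j, rfl⟩ := Nat.exists_eq_succ_of_ne_zero hk0.ne'
    simp [pathVertex_succ hkm]

theorem exists_pathPiece_eq_vertex_iff (hp : p < n) (hq : q < n) (hpq : p ≠ q) {k : ℕ}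
    (hk : k < m) {x : X} :
    (∃ t ∈ Ioo (0 : ℝ) (m + 1 : ℕ), pathPiece n m p q t = s(n + k, n + k) ∧ Γ t = x) ↔
      x = Γ (k + 1 : ℕ) := by
  have hkm : ((k + 1 : ℕ) : ℝ) ∈ Ioo (0 : ℝ) (m + 1 : ℕ) :=
    ⟨by positivity, by exact_mod_cast Nat.succ_lt_succ hk⟩
  refine ⟨fun ⟨t, ht, hz, hx⟩ => ?_, fun hx => ⟨_, hkm, ?_, hx.symm⟩⟩
  · rw [← hx, (pathPiece_eq_vertex_iff hp hq hpq ht hk).1 hz]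
  · exact (pathPiece_eq_vertex_iff hp hq hpq hkm hk).2 rfl

theorem openArc_pathPiece_eq_link [TopologicalSpace X] (hp : p < n) (hq : q < n) (hpq : p ≠ q)
    (hΓ : Continuous Γ) (hinj : InjOn Γ (Ioo 0 (m + 1 : ℕ))) {k : ℕ} (hk : k ≤ m) :
    OpenArc {x | ∃ t ∈ Ioo (0 : ℝ) (m + 1 : ℕ),
      pathPiece n m p q t = s(pathVertex n m p q k, pathVertex n m p q (k + 1)) ∧ Γ t = x}
      (Γ k) (Γ (k + 1 : ℕ)) := by
  have hsub : Ioo (k : ℝ) (k + 1 : ℕ) ⊆ Ioo (0 : ℝ) (m + 1 : ℕ) :=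
    Ioo_subset_Ioo (Nat.cast_nonneg k) (by exact_mod_cast Nat.succ_le_succ hk)
  have hset : {x | ∃ t ∈ Ioo (0 : ℝ) (m + 1 : ℕ),
      pathPiece n m p q t = s(pathVertex n m p q k, pathVertex n m p q (k + 1)) ∧ Γ t = x} =
      Γ '' Ioo (k : ℝ) (k + 1 : ℕ) := by
    ext x
    exact ⟨fun ⟨t, ht, hz, hx⟩ => ⟨t, (pathPiece_eq_link_iff hp hq hpq ht hk).1 hz, hx⟩,
      fun ⟨t, ht, hx⟩ =>
        ⟨t, hsub ht, (pathPiece_eq_link_iff hp hq hpq (hsub ht) hk).2 ht, hx⟩⟩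
  rw [hset]
  exact openArc_image hΓ (by exact_mod_cast Nat.lt_succ_self k) (hinj.mono hsub)

end Curve

section Skeleton

variable {X : Type*} [TopologicalSpace X]

/-- The labelling `lab` of the points of `X` describes disjoint points `vert a` for `a < n` and
disjoint open arcs between them. -/
structure IsSkeleton (n : ℕ) (arcs : List (Sym2 ℕ)) (vert : ℕ → X) (lab : X → Label) : Prop where
  lab_lt : ∀ x z, lab x = .piece z → ∀ a ∈ z, a < n
  arcs_lt : ∀ z ∈ arcs, ∀ a ∈ z, a < n
  lab_eq_vertex : ∀ a < n, ∀ x, lab x = .piece s(a, a) ↔ x = vert a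
  openArc : ∀ a b, s(a, b) ∈ arcs → OpenArc {x | lab x = .piece s(a, b)} (vert a) (vert b)

variable {n : ℕ} {arcs : List (Sym2 ℕ)} {vert : ℕ → X} {lab : X → Label}

theorem IsSkeleton.congr {lab' : X → Label} (h : IsSkeleton n arcs vert lab)
    (hl : ∀ x z, lab' x = .piece z ↔ lab x = .piece z) : IsSkeleton n arcs vert lab' where
  lab_lt x z hx := h.lab_lt x z ((hl x z).1 hx)
  arcs_lt := h.arcs_lt
  lab_eq_vertex a ha x := (hl x _).trans (h.lab_eq_vertex a ha x)
  openArc a b hab := by simpa only [hl] using h.openArc a b hab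

theorem IsSkeleton.append {N : ℕ} {arcs' : List (Sym2 ℕ)} {vert' : ℕ → X} {lab' : X → Label}
    (h : IsSkeleton n arcs vert lab) (hnN : n ≤ N) (hvert : ∀ a < n, vert' a = vert a)
    (hold : ∀ z : Sym2 ℕ, (∀ a ∈ z, a < n) → ∀ x, lab' x = .piece z ↔ lab x = .piece z)
    (hlab : ∀ x z, lab' x = .piece z → ∀ a ∈ z, a < N) (harcs : ∀ z ∈ arcs', ∀ a ∈ z, a < N)
    (hvertex : ∀ a, n ≤ a → a < N → ∀ x, lab' x = .piece s(a, a) ↔ x = vert' a)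
    (hopen : ∀ a b, s(a, b) ∈ arcs' → OpenArc {x | lab' x = .piece s(a, b)} (vert' a) (vert' b)) :
    IsSkeleton N (arcs ++ arcs') vert' lab' where
  lab_lt := hlab
  arcs_lt z hz a ha := (List.mem_append.1 hz).elim
    (fun hz => (h.arcs_lt z hz a ha).trans_le hnN) fun hz => harcs z hz a ha
  lab_eq_vertex a ha x := by
    obtain han | han := Nat.lt_or_ge a n
    · rw [hold _ (by simpa using han), hvert a han, h.lab_eq_vertex a han x]
    · exact hvertex a han ha x
  openArc a b hab := by
    obtain hab | hab := List.mem_append.1 hab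
    · have hlt := h.arcs_lt _ hab
      simpa only [hold _ hlt, hvert a (hlt a (by simp)), hvert b (hlt b (by simp))] using
        h.openArc a b hab
    · exact hopen a b hab

theorem IsSkeleton.addPath (h : IsSkeleton n arcs vert lab) {p q m : ℕ} (hp : p < n) (hq : q < n)
    (hpq : p ≠ q) (hm : 0 < m) {Γ : ℝ → X} (hΓ : Continuous Γ) (h0 : Γ 0 = vert p)
    (h1 : Γ (m + 1 : ℕ) = vert q) (hinj : InjOn Γ (Ioo 0 (m + 1 : ℕ)))
    (hfree : ∀ t ∈ Ioo (0 : ℝ) (m + 1 : ℕ), lab (Γ t) = .free) :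
    ∃ (vert' : ℕ → X) (lab' : X → Label),
      IsSkeleton (n + m) (arcs ++ links (path n m p q)) vert' lab' ∧
      (∀ a < n, vert' a = vert a) ∧ (∀ k ≤ m + 1, vert' (pathVertex n m p q k) = Γ k) ∧
      (∀ x ∉ Γ '' Ioo (0 : ℝ) (m + 1 : ℕ), lab' x = lab x) ∧
      ∀ x k, lab' x = .cell k ↔ lab x = .cell k := by
  obtain ⟨vert', hvert, hvertΓ⟩ := exists_extend_vert hp hq h0 h1
  obtain ⟨lab', hout, hpiece, hcell⟩ := exists_relabel_curve hinj hfree (pathPiece n m p q)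
  have hold : ∀ z : Sym2 ℕ, (∀ a ∈ z, a < n) → ∀ x, lab' x = .piece z ↔ lab x = .piece z := by
    refine fun z hz x => (hpiece x z).trans (or_iff_left ?_)
    rintro ⟨t, ht, rfl, -⟩
    obtain ⟨a, ha, hna⟩ := exists_mem_pathPiece_ge hm ht
    exact (hz a ha).not_ge hna
  have hnew : ∀ z : Sym2 ℕ, (∃ a ∈ z, n ≤ a) → ∀ x, lab' x = .piece z ↔
      ∃ t ∈ Ioo (0 : ℝ) (m + 1 : ℕ), pathPiece n m p q t = z ∧ Γ t = x := fun z ⟨a, ha, hna⟩ x =>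
    (hpiece x z).trans (or_iff_right fun hz => (h.lab_lt x z hz a ha).not_ge hna)
  refine ⟨vert', lab', h.append (Nat.le_add_right n m) hvert hold (fun x z hz a ha => ?_)
    (fun z hz a ha => ?_) (fun a hna ha x => ?_) (fun a b hab => ?_), hvert, hvertΓ, hout, hcell⟩
  · obtain hz | ⟨t, -, rfl, -⟩ := (hpiece x z).1 hz
    · exact (h.lab_lt x z hz a ha).trans_le (Nat.le_add_right _ _)
    · exact lt_of_mem_pathPiece hp hq ha
  · exact lt_of_mem_links_path hp hq hz ha
  · obtain ⟨k, rfl⟩ := Nat.exists_eq_add_of_le hna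
    have hk : k < m := by omega
    rw [hnew _ ⟨n + k, by simp, hna⟩, exists_pathPiece_eq_vertex_iff hp hq hpq hk,
      ← hvertΓ _ (by omega), pathVertex_succ hk]
  · obtain ⟨k, hk, hz⟩ := mem_links_path.1 hab
    have harc := openArc_pathPiece_eq_link hp hq hpq hΓ hinj hk
    rw [hz, ← hvertΓ k (by omega), ← hvertΓ (k + 1) (by omega)] at harc
    simp only [hnew _ (exists_mem_ge_of_mem_links_path hm hab)]
    obtain ⟨ha, hb⟩ | ⟨hb, ha⟩ := Sym2.eq_iff.1 hz
    · rwa [ha, hb] at harc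
    · rw [ha, hb] at harc
      exact harc.symm

end Skeleton

/-! ### Meshes -/

/-- A combinatorial drawing: vertices `0, …, size - 1`, arcs between them, and cells, each given
by vertices in the order in which they occur on its boundary. -/
structure Mesh where
  size : ℕ
  arcs : List (Sym2 ℕ)
  cells : List (List ℕ)

/-- Draw a chord, with `m` new vertices on it, from `p` to `q` through the cell `k`, on whose
boundary the vertices `l₁, p, l₂, q, l₃` occur in this order. -/
def Mesh.chord (M : Mesh) (k m : ℕ) (l₁ : List ℕ) (p : ℕ) (l₂ : List ℕ) (q : ℕ) (l₃ : List ℕ) :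
    Mesh where
  size := M.size + m
  arcs := M.arcs ++ links (path M.size m p q)
  cells := M.cells.set k ((List.range' M.size m).reverse ++ p :: (l₂ ++ [q])) ++
    [l₁ ++ p :: (List.range' M.size m ++ q :: l₃)]

/-- Traverse the boundary of the cell `k` in the opposite direction. -/
def Mesh.reverseCell (M : Mesh) (k : ℕ) : Mesh :=
  { M with cells := M.cells.modify k List.reverse }

theorem map_range'_eq_nodes {X : Type*} {n m p q : ℕ} {vert : ℕ → X} {Γ : ℝ → X}
    (h : ∀ k ≤ m + 1, vert (pathVertex n m p q k) = Γ k) :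
    (List.range' n m).map vert = nodes m Γ := by
  rw [List.range'_eq_map_range, List.map_map, nodes]
  refine List.map_congr_left fun j hj => ?_
  have hj' := List.mem_range.1 hj
  rw [comp_apply, ← pathVertex_succ (p := p) (q := q) hj', h _ (by omega)]

section Realizable

variable {X : Type*} [TopologicalSpace X] {M : Mesh} {k m p q : ℕ} {l₁ l₂ l₃ : List ℕ}

/-- The points `vert` and the labelling `lab` of `X` are a drawing as described by `M`. -/
structure Mesh.IsRealization (M : Mesh) (vert : ℕ → X) (lab : X → Label) : Prop where
  skeleton : IsSkeleton M.size M.arcs vert lab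
  lt_size : ∀ c ∈ M.cells, ∀ a ∈ c, a < M.size
  isCell : ∀ k c, M.cells[k]? = some c → IsCell {x | lab x = .cell k} (c.map vert)

variable (X) in
/-- The combinatorial drawing `M` is a drawing in the space `X`. -/
def Mesh.Realizable (M : Mesh) : Prop :=
  ∃ (vert : ℕ → X) (lab : X → Label), M.IsRealization vert lab

theorem Mesh.Realizable.reverseCell (hM : M.Realizable X) (k : ℕ) :
    (M.reverseCell k).Realizable X := by
  obtain ⟨vert, lab, hM⟩ := hM
  have hcell {j : ℕ} {c : List ℕ} (hc : (M.reverseCell k).cells[j]? = some c) :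
      ∃ d, M.cells[j]? = some d ∧ (c = d ∨ c = d.reverse) := by
    simp only [Mesh.reverseCell, List.getElem?_modify, Option.map_eq_map, Option.map_eq_some_iff]
      at hc
    obtain ⟨d, hd, rfl⟩ := hc
    exact ⟨d, hd, by split_ifs <;> simp⟩
  refine ⟨vert, lab, hM.skeleton, fun c hc a ha => ?_, fun j c hc => ?_⟩
  · obtain ⟨j, hj⟩ := List.mem_iff_getElem?.1 hc
    obtain ⟨d, hd, rfl | rfl⟩ := hcell hj
    · exact hM.lt_size _ (List.mem_of_getElem? hd) a ha
    · exact hM.lt_size _ (List.mem_of_getElem? hd) a (List.mem_reverse.1 ha)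
  · obtain ⟨d, hd, rfl | rfl⟩ := hcell hc
    · exact hM.isCell j _ hd
    · rw [List.map_reverse]
      exact (hM.isCell j _ hd).reverse

theorem getElem?_cells_chord {c : List ℕ} {j : ℕ} (hk : k < M.cells.length)
    (h : (M.chord k m l₁ p l₂ q l₃).cells[j]? = some c) :
    (j = k ∧ c = (List.range' M.size m).reverse ++ p :: (l₂ ++ [q])) ∨
      (j = M.cells.length ∧ c = l₁ ++ p :: (List.range' M.size m ++ q :: l₃)) ∨
      (j ≠ k ∧ M.cells[j]? = some c) := by
  simp only [Mesh.chord, List.getElem?_append, List.length_set] at h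
  split_ifs at h <;> grind

theorem chord_cells_lt_size (hM : ∀ c ∈ M.cells, ∀ a ∈ c, a < M.size)
    (hc : M.cells[k]? = some (l₁ ++ p :: (l₂ ++ q :: l₃))) :
    ∀ c ∈ (M.chord k m l₁ p l₂ q l₃).cells, ∀ a ∈ c, a < (M.chord k m l₁ p l₂ q l₃).size := by
  intro c hcM a ha
  have hlt := hM _ (List.mem_of_getElem? hc)
  obtain ⟨j, hj⟩ := List.mem_iff_getElem?.1 hcM
  change a < M.size + m
  obtain ⟨-, rfl⟩ | ⟨-, rfl⟩ | ⟨-, hj⟩ := getElem?_cells_chord (by grind) hj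
  · grind
  · grind
  · exact (hM c (List.mem_of_getElem? hj) a ha).trans_le (Nat.le_add_right _ _)

theorem exists_relabel_cut {lab : X → Label} {k N : ℕ} {Γ : ℝ → X} {U₁ U₂ : Set X}
    (h : IsCut {x | lab x = .cell k} m Γ U₁ U₂) : ∃ lab' : X → Label,
      (∀ x z, lab' x = .piece z ↔ lab x = .piece z) ∧
      (∀ t ∈ Ioo (0 : ℝ) (m + 1 : ℕ), lab' (Γ t) = .free) ∧
      (∀ x ∈ U₁, lab' x = .cell k) ∧ (∀ x ∈ U₂, lab' x = .cell N) ∧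
      ∀ j ≠ k, ∀ x, lab x = .cell j → lab' x = .cell j := by
  classical
  let lab' : X → Label := fun x => if x ∈ U₁ then .cell k else if x ∈ U₂ then .cell N else
    if lab x = .cell k then .free else lab x
  have hk₁ : ∀ x ∈ U₁, lab x = .cell k := h.left_subset
  have hk₂ : ∀ x ∈ U₂, lab x = .cell k := h.right_subset
  refine ⟨lab', fun x z => ?_, fun t ht => ?_, fun x hx => if_pos hx, fun x hx => ?_,
    fun j hj x hx => ?_⟩ <;> simp only [lab']
  · grind
  · have hΓ : lab (Γ t) = .cell k := h.mapsTo ht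
    rw [if_neg (disjoint_left.1 h.disjoint_left (mem_image_of_mem Γ ht)),
      if_neg (disjoint_left.1 h.disjoint_right (mem_image_of_mem Γ ht)), if_pos hΓ]
  · rw [if_neg (disjoint_right.1 h.disjoint hx), if_pos hx]
  · grind

theorem Mesh.Realizable.chord (hM : M.Realizable X)
    (hc : M.cells[k]? = some (l₁ ++ p :: (l₂ ++ q :: l₃))) (hm : 0 < m) (hpq : p ≠ q) :
    (M.chord k m l₁ p l₂ q l₃).Realizable X := by
  obtain ⟨vert, lab, hM⟩ := hM
  have hlt := hM.lt_size _ (List.mem_of_getElem? hc)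
  have hp : p < M.size := hlt p (by simp)
  have hq : q < M.size := hlt q (by simp)
  have hcell := hM.isCell k _ hc
  simp only [List.map_append, List.map_cons] at hcell
  obtain ⟨Γ, U₁, U₂, hcut, hΓ0, hΓ1, hU₁, hU₂⟩ := hcell.exists_isCut m
  obtain ⟨lab₁, hpiece, hfree, hlab₁, hlab₂, hother⟩ :=
    exists_relabel_cut (N := M.cells.length) hcut
  obtain ⟨vert', lab', hskel, hvert, hvertΓ, -, hlab'⟩ := (hM.skeleton.congr hpiece).addPath hp hq
    hpq hm hcut.continuous hΓ0 hΓ1 hcut.injOn hfree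
  have hmap : ∀ l : List ℕ, (∀ a ∈ l, a < M.size) → l.map vert' = l.map vert := fun l hl =>
    List.map_congr_left fun a ha => hvert a (hl a ha)
  have hmap₁ := hmap l₁ fun a ha => hlt a (by simp [ha])
  have hmap₂ := hmap l₂ fun a ha => hlt a (by simp [ha])
  have hmap₃ := hmap l₃ fun a ha => hlt a (by simp [ha])
  have hnodes := map_range'_eq_nodes hvertΓ
  refine ⟨vert', lab', hskel, chord_cells_lt_size hM.lt_size hc, fun j c hj => ?_⟩
  simp only [hlab']
  obtain ⟨rfl, rfl⟩ | ⟨rfl, rfl⟩ | ⟨hjk, hj⟩ := getElem?_cells_chord (by grind) hj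
  · simp only [List.map_append, List.map_reverse, List.map_cons, List.map_nil, hnodes, hmap₂,
      hvert p hp, hvert q hq]
    exact hU₁.mono hlab₁
  · simp only [List.map_append, List.map_cons, hnodes, hmap₁, hmap₃, hvert p hp, hvert q hq]
    exact hU₂.mono hlab₂
  · rw [hmap c (hM.lt_size c (List.mem_of_getElem? hj))]
    exact (hM.isCell j c hj).mono (hother j hjk)

end Realizable

/-! ### Theta graphs on the torus -/

/-- The covering map of the torus by the plane under which the unit square is a fundamental
domain whose upper side is glued to the lower one with a shift by one half. -/
noncomputable def brick (z : ℝ × ℝ) : UnitAddCircle × UnitAddCircle :=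
  (((z.1 - z.2 / 2 : ℝ) : UnitAddCircle), ((z.2 : ℝ) : UnitAddCircle))

theorem continuous_brick : Continuous brick := by
  have : Continuous fun x : ℝ => (x : UnitAddCircle) := AddCircle.continuous_mk' 1
  unfold brick
  fun_prop

theorem injOn_coe_unitAddCircle : InjOn (fun x : ℝ => (x : UnitAddCircle)) (Ico 0 1) :=
  fun x hx y hy h => (AddCircle.coe_eq_coe_iff_of_mem_Ico (p := (1 : ℝ)) (a := 0)
    (by simpa using hx) (by simpa using hy)).1 h

theorem injOn_brick : InjOn brick (Ico 0 1 ×ˢ Ico 0 1) := by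
  rintro ⟨x, y⟩ ⟨hx, hy⟩ ⟨x', y'⟩ ⟨hx', hy'⟩ h
  simp only [brick, Prod.mk.injEq] at h
  obtain rfl : y = y' := injOn_coe_unitAddCircle hy hy' h.2
  have hxx' : (x : UnitAddCircle) = x' := by simpa using h.1
  exact Prod.ext (injOn_coe_unitAddCircle hx hx' hxx') rfl

theorem brick_top (x : ℝ) : brick (x + 1 / 2, 1) = brick (x, 0) := by
  simp [brick]

theorem brick_right (x y : ℝ) : brick (x + 1, y) = brick (x, y) := by
  simp only [brick, add_sub_right_comm, AddCircle.coe_add_period]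

/-- A point moving around the boundary of the unit square, at the times `0`, `2`, `3`, `5`, `6`
being at the corners. -/
noncomputable def perimeter (s : ℝ) : ℝ × ℝ :=
  (max 0 (min (s / 2) 1) - max 0 (min ((s - 3) / 2) 1),
    max 0 (min (s - 2) 1) - max 0 (min (s - 5) 1))

theorem continuous_perimeter : Continuous perimeter := by
  unfold perimeter
  fun_prop

section Perimeter

variable {s : ℝ}

theorem perimeter_bottom (h0 : 0 ≤ s) (h2 : s ≤ 2) : perimeter s = (s / 2, 0) := by
  ext <;> grind [perimeter]

theorem perimeter_right (h2 : 2 ≤ s) (h3 : s ≤ 3) : perimeter s = (1, s - 2) := by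
  ext <;> grind [perimeter]

theorem perimeter_top (h3 : 3 ≤ s) (h5 : s ≤ 5) : perimeter s = (1 - (s - 3) / 2, 1) := by
  ext <;> grind [perimeter]

theorem perimeter_left (h5 : 5 ≤ s) (h6 : s ≤ 6) : perimeter s = (0, 6 - s) := by
  ext <;> grind [perimeter]

theorem perimeter_cases (hs : s ∈ Ioo (0 : ℝ) 6) :
    (s ≤ 2 ∧ perimeter s = (s / 2, 0)) ∨ (s ∈ Ioc 2 3 ∧ perimeter s = (1, s - 2)) ∨
      (s ∈ Ioc 3 5 ∧ perimeter s = (1 - (s - 3) / 2, 1)) ∨ (5 < s ∧ perimeter s = (0, 6 - s)) := by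
  grind [perimeter_bottom, perimeter_right, perimeter_top, perimeter_left]

theorem injOn_perimeter : InjOn perimeter (Ioo 0 6) := by
  intro s hs t ht h
  have hs' := perimeter_cases hs
  have ht' := perimeter_cases ht
  grind

theorem max_abs_perimeter_sub (hs : s ∈ Ioo (0 : ℝ) 6) :
    max |(perimeter s).1 - 1 / 2| |(perimeter s).2 - 1 / 2| = 1 / 2 := by
  have hs' := perimeter_cases hs
  grind

end Perimeter

/-- A collar of the boundary of the unit square, cut open at the corner `(0, 0)`. -/
noncomputable def collar (z : ℝ × ℝ) : ℝ × ℝ :=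
  (1 / 2 + (1 - z.2 / 2) * ((perimeter z.1).1 - 1 / 2),
    1 / 2 + (1 - z.2 / 2) * ((perimeter z.1).2 - 1 / 2))

theorem continuous_collar : Continuous collar := by
  have := continuous_perimeter
  unfold collar
  fun_prop

theorem collar_zero (s : ℝ) : collar (s, 0) = perimeter s := by
  simp [collar]

theorem mapsTo_collar : MapsTo collar (Ioo 0 6 ×ˢ Ioo 0 1) (Ioo 0 1 ×ˢ Ioo 0 1) := by
  intro z hz
  have hmax := max_abs_perimeter_sub hz.1
  have h1 := abs_le.1 ((le_max_left _ _).trans hmax.le)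
  have h2 := abs_le.1 ((le_max_right _ _).trans hmax.le)
  obtain ⟨hz0, hz1⟩ := hz.2
  refine ⟨⟨?_, ?_⟩, ?_, ?_⟩ <;> simp only [collar] <;> nlinarith

theorem max_abs_collar_sub {z : ℝ × ℝ} (hz : z ∈ Ioo (0 : ℝ) 6 ×ˢ Ioo (0 : ℝ) 1) :
    max |(collar z).1 - 1 / 2| |(collar z).2 - 1 / 2| = (1 - z.2 / 2) / 2 := by
  have hpos : 0 < 1 - z.2 / 2 := by linarith [hz.2.2]
  simp only [collar, add_sub_cancel_left, abs_mul, abs_of_pos hpos]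
  rw [← mul_max_of_nonneg _ _ hpos.le, max_abs_perimeter_sub hz.1, mul_one_div]

theorem injOn_collar : InjOn collar (Ioo 0 6 ×ˢ Ioo 0 1) := by
  rintro ⟨s, r⟩ hz ⟨s', r'⟩ hz' h
  have hmax := (max_abs_collar_sub hz).symm.trans (h ▸ max_abs_collar_sub hz')
  obtain rfl : r = r' := by linarith
  have hpos : 1 - r / 2 ≠ 0 := by linarith [hz.2.2]
  simp only [collar, Prod.mk.injEq, add_right_inj, mul_right_inj' hpos, sub_left_inj] at h
  exact Prod.ext (injOn_perimeter hz.1 hz'.1 (Prod.ext h.1 h.2)) rfl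

theorem isChart_collar :
    IsChart (fun z => brick (collar z)) 0 6 (brick '' (Ioo 0 1 ×ˢ Ioo 0 1)) where
  continuous := continuous_brick.comp continuous_collar
  injOn := injOn_brick.comp injOn_collar fun _ hz =>
    prod_mono Ioo_subset_Ico_self Ioo_subset_Ico_self (mapsTo_collar hz)
  mapsTo _ hz := mem_image_of_mem _ (mapsTo_collar hz)

/-- The boundary walk of the unit square as the boundary of a hexagonal cell of the torus, whose
corners are at the integers. -/
noncomputable def hexagon (s : ℝ) : UnitAddCircle × UnitAddCircle := brick (perimeter s)

theorem continuous_hexagon : Continuous hexagon := continuous_brick.comp continuous_perimeter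

section Hexagon

variable {s : ℝ}

theorem hexagon_bottom (h0 : 0 ≤ s) (h2 : s ≤ 2) : hexagon s = brick (s / 2, 0) := by
  rw [hexagon, perimeter_bottom h0 h2]

theorem hexagon_right (h2 : 2 ≤ s) (h3 : s ≤ 3) : hexagon s = brick (0, s - 2) := by
  rw [hexagon, perimeter_right h2 h3, ← brick_right 0, zero_add]

theorem hexagon_top (h3 : 3 ≤ s) (h5 : s ≤ 5) : hexagon s = brick (1 / 2 - (s - 3) / 2, 0) := by
  rw [hexagon, perimeter_top h3 h5, ← brick_top]
  ring_nf

theorem hexagon_left (h5 : 5 ≤ s) (h6 : s ≤ 6) : hexagon s = brick (0, 6 - s) := by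
  rw [hexagon, perimeter_left h5 h6]

theorem hexagon_two : hexagon 2 = hexagon 0 := by
  rw [hexagon_bottom le_rfl zero_le_two, hexagon_right le_rfl (by norm_num), sub_self, zero_div]

theorem hexagon_three : hexagon 3 = hexagon 1 := by
  rw [hexagon_bottom zero_le_one one_le_two, hexagon_top le_rfl (by norm_num), sub_self, zero_div,
    sub_zero]

theorem hexagon_add_three {j : ℕ} (hj : j < 3) (hs : s ∈ Icc (0 : ℝ) 1) :
    hexagon ((j + 3 : ℕ) + s) = hexagon (j + 1 - s) := by
  obtain ⟨h0, h1⟩ := hs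
  interval_cases j
  · rw [hexagon_top, hexagon_bottom]
    · congr 2
      push_cast
      ring
    all_goals push_cast; linarith
  · rw [hexagon_top, ← brick_right, hexagon_bottom]
    · congr 2
      push_cast
      ring
    all_goals push_cast; linarith
  · rw [hexagon_left, hexagon_right]
    · congr 2
      push_cast
      ring
    all_goals push_cast; linarith

theorem exists_hexagon_eq_brick (hs : s ∈ Ioo (0 : ℝ) 3) :
    ∃ z ∈ Ico (0 : ℝ) 1 ×ˢ Ico (0 : ℝ) 1, hexagon s = brick z ∧
      (s < 2 ∧ z = (s / 2, 0) ∨ 2 ≤ s ∧ z = (0, s - 2)) := by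
  obtain h2 | h2 := lt_or_ge s 2
  · exact ⟨(s / 2, 0), ⟨⟨by linarith [hs.1], by linarith⟩, by simp⟩, hexagon_bottom hs.1.le h2.le,
      Or.inl ⟨h2, rfl⟩⟩
  · exact ⟨(0, s - 2), ⟨by simp, ⟨by linarith, by linarith [hs.2]⟩⟩, hexagon_right h2 hs.2.le,
      Or.inr ⟨h2, rfl⟩⟩

theorem injOn_hexagon : InjOn hexagon (Ioo 0 3) := by
  intro s hs t ht h
  obtain ⟨z, hz, hsz, hz'⟩ := exists_hexagon_eq_brick hs
  obtain ⟨w, hw, htw, hw'⟩ := exists_hexagon_eq_brick ht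
  obtain rfl : z = w := injOn_brick hz hw (hsz.symm.trans (h.trans htw))
  grind

theorem hexagon_notMem_image_brick (hs : s ∈ Ioo (0 : ℝ) 3) :
    hexagon s ∉ brick '' (Ioo 0 1 ×ˢ Ioo 0 1) := by
  rintro ⟨w, hw, h⟩
  obtain ⟨z, hz, hsz, hz'⟩ := exists_hexagon_eq_brick hs
  obtain rfl : w = z := injOn_brick (prod_mono Ioo_subset_Ico_self Ioo_subset_Ico_self hw) hz
    (h.trans hsz)
  obtain ⟨-, rfl⟩ | ⟨-, rfl⟩ := hz'
  · exact lt_irrefl _ hw.2.1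
  · exact lt_irrefl _ hw.1.1

end Hexagon

open Classical in
/-- The labelling of the torus by the two corners `hexagon 0` and `hexagon 1` of the hexagonal cell,
which are the vertices `0` and `1`, and by the interior of the cell. -/
noncomputable def cornerLabel (x : UnitAddCircle × UnitAddCircle) : Label :=
  if x = hexagon 0 then .piece s(0, 0) else if x = hexagon 1 then .piece s(1, 1) else
    if x ∈ brick '' (Ioo 0 1 ×ˢ Ioo 0 1) then .cell 0 else .free

theorem hexagon_one_ne_zero : hexagon 1 ≠ hexagon 0 := by
  rw [← hexagon_two]
  exact injOn_hexagon.ne (by norm_num) (by norm_num) (by norm_num)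

theorem isSkeleton_corner : IsSkeleton 2 [] (fun i : ℕ => hexagon i) cornerLabel where
  lab_lt x z hz i hi := by
    unfold cornerLabel at hz
    split_ifs at hz <;> cases hz <;> simp only [Sym2.mem_iff, or_self] at hi <;> omega
  arcs_lt := by simp
  lab_eq_vertex i hi x := by
    have h10 := hexagon_one_ne_zero
    unfold cornerLabel
    interval_cases i
    · simp only [Nat.cast_zero]
      split_ifs <;> simp_all
    · simp only [Nat.cast_one]
      split_ifs <;> simp_all [eq_comm]
  openArc := by simp

theorem cornerLabel_side {j : ℕ} (hj : j < 3) {s : ℝ} (hs : s ∈ Ioo (j : ℝ) (j + 1)) :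
    cornerLabel (hexagon s) = .free := by
  have hs3 : s ∈ Ioo (0 : ℝ) 3 := by
    have hj' : (j : ℝ) + 1 ≤ 3 := by exact_mod_cast hj
    exact ⟨j.cast_nonneg.trans_lt hs.1, hs.2.trans_le hj'⟩
  have hne : ∀ i : ℕ, s ≠ i := by
    rintro i rfl
    have hlt : j < i ∧ i < j + 1 := by exact_mod_cast mem_Ioo.1 hs
    omega
  have h0 : hexagon s ≠ hexagon 0 := by
    rw [← hexagon_two]
    exact injOn_hexagon.ne hs3 (by norm_num) (by exact_mod_cast hne 2)
  have h1 : hexagon s ≠ hexagon 1 :=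
    injOn_hexagon.ne hs3 (by norm_num) (by exact_mod_cast hne 1)
  rw [cornerLabel, if_neg h0, if_neg h1, if_neg (hexagon_notMem_image_brick hs3)]

theorem cornerLabel_of_mem_image_brick {x : UnitAddCircle × UnitAddCircle}
    (hx : x ∈ brick '' (Ioo 0 1 ×ˢ Ioo 0 1)) : cornerLabel x = .cell 0 := by
  have hne : ∀ s ∈ Ioo (0 : ℝ) 3, x ≠ hexagon s := fun s hs h =>
    hexagon_notMem_image_brick hs (h ▸ hx)
  rw [cornerLabel, ← hexagon_two, if_neg (hne 2 (by norm_num)), if_neg (hne 1 (by norm_num)),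
    if_pos hx]

/-- The side of the hexagonal cell from its corner `j` to the next one, divided into `m + 1` equal
parts by the integers. -/
noncomputable def side (j m : ℕ) (t : ℝ) : UnitAddCircle × UnitAddCircle :=
  hexagon (j + t / (m + 1 : ℕ))

section Side

variable {j m : ℕ}

theorem continuous_side : Continuous (side j m) :=
  continuous_hexagon.comp (by fun_prop)

theorem side_zero : side j m 0 = hexagon j := by
  rw [side, zero_div, add_zero]

theorem side_last : side j m (m + 1 : ℕ) = hexagon (j + 1 : ℕ) := by
  rw [side, div_self (by positivity), Nat.cast_succ j]

theorem mapsTo_side_param :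
    MapsTo (fun t : ℝ => j + t / (m + 1 : ℕ)) (Ioo 0 (m + 1 : ℕ)) (Ioo (j : ℝ) (j + 1)) := by
  intro t ht
  have hm : (0 : ℝ) < (m + 1 : ℕ) := by positivity
  exact ⟨by linarith [div_pos ht.1 hm], by linarith [(div_lt_one hm).2 ht.2]⟩

theorem injOn_side (hj : j < 3) : InjOn (side j m) (Ioo 0 (m + 1 : ℕ)) := by
  have hm : ((m + 1 : ℕ) : ℝ) ≠ 0 := by positivity
  have hj' : (j : ℝ) + 1 ≤ 3 := by exact_mod_cast hj
  refine (injOn_hexagon.mono (Ioo_subset_Ioo j.cast_nonneg hj')).comp ?_ mapsTo_side_param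
  exact fun s _ t _ h => (div_left_inj' hm).1 (add_left_cancel h)

theorem hexagon_notMem_image_side (hj : j < 3) {i : ℕ} (hi : i < 3) (hij : i ≠ j) {s : ℝ}
    (hs : s ∈ Ioo (i : ℝ) (i + 1)) : hexagon s ∉ side j m '' Ioo 0 (m + 1 : ℕ) := by
  have hsub : ∀ {k : ℕ}, k < 3 → Ioo (k : ℝ) (k + 1) ⊆ Ioo 0 3 := fun {k} hk =>
    Ioo_subset_Ioo k.cast_nonneg (by exact_mod_cast hk)
  rintro ⟨t, ht, h⟩
  have ht' := mapsTo_side_param (j := j) ht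
  rw [← injOn_hexagon (hsub hj ht') (hsub hi hs) h] at hs
  have h1 : (i : ℝ) < j + 1 := hs.1.trans ht'.2
  have h2 : (j : ℝ) < i + 1 := ht'.1.trans hs.2
  norm_cast at h1 h2
  omega

theorem IsSkeleton.addSide {n : ℕ} {arcs : List (Sym2 ℕ)} {vert : ℕ → UnitAddCircle × UnitAddCircle}
    {lab : UnitAddCircle × UnitAddCircle → Label} (h : IsSkeleton n arcs vert lab) {p q : ℕ}
    (hp : p < n) (hq : q < n) (hpq : p ≠ q) (hm : 0 < m) (hj : j < 3)
    (hvp : vert p = hexagon j) (hvq : vert q = hexagon (j + 1 : ℕ))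
    (hfree : ∀ i < 3, j ≤ i → ∀ s ∈ Ioo (i : ℝ) (i + 1), lab (hexagon s) = .free) :
    ∃ (vert' : ℕ → UnitAddCircle × UnitAddCircle) (lab' : UnitAddCircle × UnitAddCircle → Label),
      IsSkeleton (n + m) (arcs ++ links (path n m p q)) vert' lab' ∧
      (∀ a < n, vert' a = vert a) ∧ (∀ k ≤ m + 1, vert' (pathVertex n m p q k) = side j m k) ∧
      (∀ i < 3, j + 1 ≤ i → ∀ s ∈ Ioo (i : ℝ) (i + 1), lab' (hexagon s) = .free) ∧
      ∀ x k, lab' x = .cell k ↔ lab x = .cell k := by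
  obtain ⟨vert', lab', hskel, hvert, hside, hlab, hcell⟩ :=
    h.addPath hp hq hpq hm continuous_side (side_zero.trans hvp.symm) (side_last.trans hvq.symm)
      (injOn_side hj) fun t ht => hfree j hj le_rfl _ (mapsTo_side_param ht)
  refine ⟨vert', lab', hskel, hvert, hside, fun i hi hji s hs => ?_, hcell⟩
  rw [hlab _ (hexagon_notMem_image_side hj hi (by omega) hs), hfree i hi (by omega) s hs]

end Side

/-- The theta graph with vertices `0` and `1` and three paths, with `a`, `b` and `c` inner
vertices, whose complement in the torus is one hexagonal cell. -/
def theta (a b c : ℕ) : Mesh where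
  size := 2 + a + b + c
  arcs := ([] ++ links (path 2 a 0 1)) ++ links (path (2 + a) b 1 0) ++
    links (path (2 + a + b) c 0 1)
  cells := [(path 2 a 0 1).dropLast ++ (path (2 + a) b 1 0).dropLast ++
    (path (2 + a + b) c 0 1).dropLast ++ (path 2 a 0 1).reverse.dropLast ++
    (path (2 + a) b 1 0).reverse.dropLast ++ (path (2 + a + b) c 0 1).reverse.dropLast]

theorem exists_isSkeleton_theta {a b c : ℕ} (ha : 0 < a) (hb : 0 < b) (hc : 0 < c) :
    ∃ (vert : ℕ → UnitAddCircle × UnitAddCircle) (lab : UnitAddCircle × UnitAddCircle → Label),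
      IsSkeleton (theta a b c).size (theta a b c).arcs vert lab ∧
      (∀ k ≤ a + 1, vert (pathVertex 2 a 0 1 k) = side 0 a k) ∧
      (∀ k ≤ b + 1, vert (pathVertex (2 + a) b 1 0 k) = side 1 b k) ∧
      (∀ k ≤ c + 1, vert (pathVertex (2 + a + b) c 0 1 k) = side 2 c k) ∧
      ∀ x, lab x = .cell 0 ↔ cornerLabel x = .cell 0 := by
  have h02 : hexagon (2 : ℕ) = hexagon (0 : ℕ) := by exact_mod_cast hexagon_two
  have h13 : hexagon (3 : ℕ) = hexagon (1 : ℕ) := by exact_mod_cast hexagon_three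
  obtain ⟨vert₁, lab₁, h₁, hv₁, hside₁, hfree₁, hcell₁⟩ := isSkeleton_corner.addSide (j := 0)
    (p := 0) (q := 1) two_pos one_lt_two zero_ne_one ha (by omega) rfl rfl
    fun i hi _ s hs => cornerLabel_side hi hs
  have hv₁₀ : vert₁ 0 = hexagon (0 : ℕ) := hv₁ 0 two_pos
  have hv₁₁ : vert₁ 1 = hexagon (1 : ℕ) := hv₁ 1 one_lt_two
  obtain ⟨vert₂, lab₂, h₂, hv₂, hside₂, hfree₂, hcell₂⟩ := h₁.addSide (j := 1)
    (p := 1) (q := 0) (by omega) (by omega) one_ne_zero hb (by omega) hv₁₁ (hv₁₀.trans h02.symm)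
    hfree₁
  have hv₂₀ : vert₂ 0 = hexagon (0 : ℕ) := (hv₂ 0 (by omega)).trans hv₁₀
  have hv₂₁ : vert₂ 1 = hexagon (1 : ℕ) := (hv₂ 1 (by omega)).trans hv₁₁
  obtain ⟨vert₃, lab₃, h₃, hv₃, hside₃, -, hcell₃⟩ := h₂.addSide (j := 2)
    (p := 0) (q := 1) (by omega) (by omega) zero_ne_one hc (by omega) (hv₂₀.trans h02.symm)
    (hv₂₁.trans h13.symm) hfree₂
  refine ⟨vert₃, lab₃, h₃, fun k hk => ?_, fun k hk => ?_, hside₃, fun x =>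
    (hcell₃ x 0).trans ((hcell₂ x 0).trans (hcell₁ x 0))⟩
  · have hlt : pathVertex 2 a 0 1 k < 2 + a := pathVertex_lt two_pos one_lt_two k
    rw [hv₃ _ (by omega), hv₂ _ hlt, hside₁ k hk]
  · rw [hv₃ _ (pathVertex_lt (by omega) (by omega) k), hside₂ k hk]

/-- The points dividing the interval from `j` to `j + 1` into `m + 1` equal parts, without
`j + 1`. -/
noncomputable def ticks (j m : ℕ) : List ℝ :=
  (List.range (m + 1)).map fun k : ℕ => j + (k : ℝ) / (m + 1 : ℕ)

/-- The points dividing the consecutive intervals of length `1` from `j` on into `m + 1` equal parts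
for the `m` in the given list. -/
noncomputable def ticksFrom (j : ℕ) : List ℕ → List ℝ
  | [] => []
  | m :: ms => ticks j m ++ ticksFrom (j + 1) ms

theorem mem_Ico_of_mem_ticks {j m : ℕ} {x : ℝ} (h : x ∈ ticks j m) : x ∈ Ico (j : ℝ) (j + 1) := by
  simp only [ticks, List.mem_map, List.mem_range] at h
  obtain ⟨k, hk, rfl⟩ := h
  have hdiv : (k : ℝ) / (m + 1 : ℕ) < 1 := (div_lt_one (by positivity)).2 (by exact_mod_cast hk)
  exact ⟨le_add_of_nonneg_right (by positivity), by linarith⟩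

theorem pairwise_ticks (j m : ℕ) : (ticks j m).Pairwise (· < ·) := by
  simp only [ticks, List.pairwise_map]
  refine List.pairwise_lt_range.imp fun {s t} hst => ?_
  gcongr

theorem mem_Ico_of_mem_ticksFrom {x : ℝ} : ∀ {ms : List ℕ} {j : ℕ}, x ∈ ticksFrom j ms →
    x ∈ Ico (j : ℝ) (j + ms.length : ℕ)
  | m :: ms, j, h => by
    have : (0 : ℝ) ≤ ms.length := Nat.cast_nonneg _
    push_cast [List.length_cons, mem_Ico]
    obtain hx | hx := List.mem_append.1 h
    · have hx' := mem_Ico_of_mem_ticks hx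
      constructor <;> linarith [hx'.1, hx'.2]
    · have hx' := mem_Ico_of_mem_ticksFrom hx
      push_cast [mem_Ico] at hx'
      constructor <;> linarith [hx'.1, hx'.2]

theorem pairwise_ticksFrom : ∀ (ms : List ℕ) (j : ℕ), (ticksFrom j ms).Pairwise (· < ·)
  | [], _ => List.Pairwise.nil
  | m :: ms, j => List.pairwise_append.2 ⟨pairwise_ticks j m, pairwise_ticksFrom ms (j + 1),
      fun _ hx _ hy => (mem_Ico_of_mem_ticks hx).2.trans_le
        (by exact_mod_cast (mem_Ico_of_mem_ticksFrom hy).1)⟩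

section ThetaCell

variable {n m p q j : ℕ} {vert : ℕ → UnitAddCircle × UnitAddCircle}

theorem map_dropLast_path (h : ∀ k ≤ m + 1, vert (pathVertex n m p q k) = side j m k) :
    (path n m p q).dropLast.map vert = (ticks j m).map hexagon := by
  refine List.ext_getElem (by simp [length_path, ticks]) fun k _ hk => ?_
  simp only [ticks, List.length_map, List.length_range] at hk
  simp only [ticks, List.getElem_map, List.getElem_dropLast, getElem_path, List.getElem_range]
  exact h k hk.le

theorem map_dropLast_reverse_path (hj : j < 3)
    (h : ∀ k ≤ m + 1, vert (pathVertex n m p q k) = side j m k) :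
    (path n m p q).reverse.dropLast.map vert = (ticks (j + 3) m).map hexagon := by
  refine List.ext_getElem (by simp [length_path, ticks]) fun k _ hk => ?_
  simp only [ticks, List.length_map, List.length_range] at hk
  have hm : (0 : ℝ) < (m + 1 : ℕ) := by positivity
  have hdiv : (k : ℝ) / (m + 1 : ℕ) ≤ 1 := (div_le_one hm).2 (by exact_mod_cast hk.le)
  simp only [ticks, List.getElem_map, List.getElem_dropLast, List.getElem_reverse, getElem_path,
    length_path, List.getElem_range]
  rw [hexagon_add_three hj ⟨by positivity, hdiv⟩, h _ (by omega), side,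
    show m + 2 - 1 - k = m + 1 - k by omega, Nat.cast_sub hk.le, sub_div, div_self hm.ne',
    add_sub_assoc]

end ThetaCell

theorem theta_cells_lt_size (a b c : ℕ) :
    ∀ l ∈ (theta a b c).cells, ∀ i ∈ l, i < (theta a b c).size := by
  have hlt {n m p q i N : ℕ} (hp : p < N) (hq : q < N) (hn : n + m ≤ N)
      (hi : i ∈ path n m p q) : i < N := by
    simp only [path, List.mem_cons, List.mem_append, List.mem_range'_1, List.not_mem_nil,
      or_false] at hi
    omega
  simp only [theta, List.mem_singleton, forall_eq, List.mem_append]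
  rintro i (((((hi | hi) | hi) | hi) | hi) | hi)
  iterate 3 exact hlt (by omega) (by omega) (by omega) (List.mem_of_mem_dropLast hi)
  iterate 3
    exact hlt (by omega) (by omega) (by omega)
      (List.mem_reverse.1 (List.mem_of_mem_dropLast hi))

theorem theta_realizable {a b c : ℕ} (ha : 0 < a) (hb : 0 < b) (hc : 0 < c) :
    (theta a b c).Realizable (UnitAddCircle × UnitAddCircle) := by
  obtain ⟨vert, lab, hskel, ha', hb', hc', hcell⟩ := exists_isSkeleton_theta ha hb hc
  refine ⟨vert, lab, hskel, theta_cells_lt_size a b c, fun k l hl => ?_⟩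
  obtain ⟨rfl, rfl⟩ : k = 0 ∧ _ = l := by
    simpa only [theta, List.getElem?_singleton, Option.ite_none_right_eq_some,
      Option.some.injEq] using hl
  have hsub : brick '' (Ioo 0 1 ×ˢ Ioo 0 1) ⊆ {x | lab x = .cell 0} := fun x hx =>
    (hcell x).2 (cornerLabel_of_mem_image_brick hx)
  refine IsCell.mono ⟨_, 0, 6, ticksFrom 0 [a, b, c, a, b, c], isChart_collar,
    pairwise_ticksFrom _ _, fun s hs => ?_, ?_⟩ hsub
  · have hs' := mem_Ico_of_mem_ticksFrom hs
    norm_num at hs'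
    exact ⟨hs'.1, hs'.2.le⟩
  · simp only [List.map_append, map_dropLast_path ha', map_dropLast_path hb', map_dropLast_path hc',
      map_dropLast_reverse_path (by omega) ha', map_dropLast_reverse_path (by omega) hb',
      map_dropLast_reverse_path (by omega) hc', collar_zero, ticksFrom, List.append_assoc,
      List.append_nil]
    rfl

/-! ### Drawings of graphs in meshes -/

/-- The arcs and the inner vertices of a path, given by its vertices. -/
def pieces : List ℕ → List (Sym2 ℕ)
  | a :: b :: c :: t => s(a, b) :: s(b, b) :: pieces (b :: c :: t)
  | [a, b] => [s(a, b)]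
  | _ => []

theorem pieces_append {l r : List ℕ} {p : ℕ} (hl : l ≠ []) (hr : r ≠ []) :
    pieces (l ++ p :: r) = pieces (l ++ [p]) ++ s(p, p) :: pieces (p :: r) := by
  obtain ⟨c, t, rfl⟩ := List.exists_cons_of_ne_nil hr
  induction l with
  | nil => exact absurd rfl hl
  | cons a l ih =>
    match l with
    | [] => simp [pieces]
    | [b] => simp [pieces]
    | b :: d :: l => simpa [pieces] using ih

theorem mem_of_mem_pieces : ∀ {l : List ℕ} {z : Sym2 ℕ}, z ∈ pieces l → ∀ a ∈ z, a ∈ l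
  | a :: b :: c :: t, z, hz, d, hd => by
    simp only [pieces, List.mem_cons] at hz
    rcases hz with rfl | rfl | hz
    · rcases Sym2.mem_iff.1 hd with rfl | rfl <;> simp
    · rcases Sym2.mem_iff.1 hd with rfl | rfl <;> simp
    · exact List.mem_cons_of_mem _ (mem_of_mem_pieces hz d hd)
  | [a, b], z, hz, d, hd => by
    obtain rfl := List.mem_singleton.1 hz
    simpa using hd

theorem mem_links_or_mem_of_mem_pieces : ∀ {l : List ℕ} {z : Sym2 ℕ}, z ∈ pieces l →
    z ∈ links l ∨ ∃ a ∈ l, z = s(a, a)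
  | a :: b :: c :: t, z, hz => by
    simp only [pieces, List.mem_cons] at hz
    rcases hz with rfl | rfl | hz
    · exact Or.inl (List.mem_cons_self ..)
    · exact Or.inr ⟨b, by simp, rfl⟩
    · exact (mem_links_or_mem_of_mem_pieces hz).imp (List.mem_cons_of_mem _)
        fun ⟨d, hd, h⟩ => ⟨d, List.mem_cons_of_mem _ hd, h⟩
  | [a, b], z, hz => Or.inl hz

theorem nodup_pieces : ∀ {l : List ℕ}, l.Nodup → (pieces l).Nodup
  | a :: b :: c :: t, h => by
    obtain ⟨ha, hbt⟩ := List.nodup_cons.1 h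
    have hb := (List.nodup_cons.1 hbt).1
    have hab : a ≠ b := fun e => ha (by simp [e])
    have hbc : b ≠ c := fun e => hb (by simp [e])
    simp only [pieces, List.nodup_cons, List.mem_cons, not_or]
    refine ⟨⟨by simpa using hab, fun hz => ha (mem_of_mem_pieces hz a (by simp))⟩, fun hz => ?_,
      nodup_pieces hbt⟩
    match t with
    | [] => simp [pieces, hbc] at hz
    | d :: t =>
      simp only [pieces, List.mem_cons] at hz
      rcases hz with hz | hz | hz
      · simp [hbc] at hz
      · simp [hbc] at hz
      · exact hb (mem_of_mem_pieces hz b (by simp))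
  | [_, _], _ => by simp [pieces]
  | [_], _ => by simp [pieces]
  | [], _ => by simp [pieces]

theorem exists_inner_mem_of_mem_pieces {l : List ℕ} (hl : l ≠ []) {p q : ℕ} {z : Sym2 ℕ}
    (hz : z ∈ pieces (p :: (l ++ [q]))) : ∃ a ∈ z, a ∈ l := by
  induction l generalizing p with
  | nil => exact absurd rfl hl
  | cons b l ih =>
    match l with
    | [] =>
      simp only [List.cons_append, List.nil_append, pieces, List.mem_cons, List.not_mem_nil,
        or_false] at hz
      refine ⟨b, ?_, by simp⟩
      rcases hz with rfl | rfl | rfl <;> simp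
    | c :: l =>
      simp only [List.cons_append, pieces, List.mem_cons] at hz
      rcases hz with rfl | rfl | hz
      · exact ⟨b, by simp, by simp⟩
      · exact ⟨b, by simp, by simp⟩
      · obtain ⟨a, ha, ha'⟩ := ih (by simp) hz
        exact ⟨a, ha, List.mem_cons_of_mem _ ha'⟩

/-- The piece `z` is an arc or a vertex of `M`. -/
def Mesh.HasPiece (M : Mesh) (z : Sym2 ℕ) : Prop := z ∈ M.arcs ∨ ∃ a < M.size, z = s(a, a)

/-- The points which a labelling assigns to the arcs and the inner vertices of a path. -/
def pathPoints {X : Type*} (lab : X → Label) (l : List ℕ) : Set X :=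
  {x | ∃ z ∈ pieces l, lab x = .piece z}

/-- The list of all pieces used by the vertices `V` and the paths `D`. -/
def allPieces (V : List ℕ) (D : List (List ℕ)) : List (Sym2 ℕ) :=
  V.map (fun a => s(a, a)) ++ D.flatMap pieces

/-- The vertices `V` and the paths `D` form a drawing of a graph inside the mesh `M`. -/
structure Drawn (M : Mesh) (V : List ℕ) (D : List (List ℕ)) : Prop where
  nodup : (allPieces V D).Nodup
  hasPiece : ∀ z ∈ allPieces V D, M.HasPiece z
  two_le : ∀ l ∈ D, 2 ≤ l.length

/-- The two ends of a path. -/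
def ends (l : List ℕ) : ℕ × ℕ := (l.headD 0, l.getLastD 0)

section Skeleton

variable {X : Type*} {M : Mesh} {V : List ℕ} {D : List (List ℕ)} {vert : ℕ → X} {lab : X → Label}

theorem pathPoints_cons_cons {a b : ℕ} {l : List ℕ} (hl : l ≠ [])
    (hb : ∀ x, lab x = .piece s(b, b) ↔ x = vert b) :
    pathPoints lab (a :: b :: l) =
      {x | lab x = .piece s(a, b)} ∪ insert (vert b) (pathPoints lab (b :: l)) := by
  obtain ⟨c, t, rfl⟩ := List.exists_cons_of_ne_nil hl
  ext x
  simp [pathPoints, pieces, hb, or_left_comm]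

variable [TopologicalSpace X]

theorem Mesh.HasPiece.lt_size (h : IsSkeleton M.size M.arcs vert lab) {z : Sym2 ℕ}
    (hz : M.HasPiece z) {a : ℕ} (ha : a ∈ z) : a < M.size := by
  rcases hz with hz | ⟨d, hd, rfl⟩
  · exact h.arcs_lt z hz a ha
  · obtain rfl : a = d := by simpa using ha
    exact hd

theorem IsSkeleton.openArc_of_hasPiece (h : IsSkeleton M.size M.arcs vert lab) {a b : ℕ}
    (hz : M.HasPiece s(a, b)) (hab : a ≠ b) :
    OpenArc {x | lab x = .piece s(a, b)} (vert a) (vert b) := by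
  rcases hz with hz | ⟨d, -, hd⟩
  · exact h.openArc a b hz
  · rcases Sym2.eq_iff.1 hd with ⟨rfl, rfl⟩ | ⟨rfl, rfl⟩ <;> exact absurd rfl hab

theorem IsSkeleton.vert_mem_pathPoints (h : IsSkeleton M.size M.arcs vert lab) {a : ℕ}
    (ha : a < M.size) {l : List ℕ} : vert a ∈ pathPoints lab l ↔ s(a, a) ∈ pieces l := by
  simp [pathPoints, (h.lab_eq_vertex a ha _).2 rfl]

theorem IsSkeleton.openArc_pathPoints (h : IsSkeleton M.size M.arcs vert lab) :
    ∀ {l : List ℕ} {a : ℕ}, l ≠ [] → (s(a, a) :: pieces (a :: l)).Nodup →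
      (∀ z ∈ pieces (a :: l), M.HasPiece z) →
      OpenArc (pathPoints lab (a :: l)) (vert a) (vert (l.getLastD 0))
  | [b], a, _, hn, hz => by
    simpa [pathPoints, pieces] using
      h.openArc_of_hasPiece (hz s(a, b) (by simp [pieces])) (by rintro rfl; simp [pieces] at hn)
  | b :: c :: l, a, _, hn, hz => by
    obtain ⟨ha, hab, hn'⟩ : s(a, a) ∉ pieces (a :: b :: c :: l) ∧
        s(a, b) ∉ s(b, b) :: pieces (b :: c :: l) ∧ (s(b, b) :: pieces (b :: c :: l)).Nodup := by
      simpa only [pieces, List.nodup_cons] using hn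
    have hb : b < M.size :=
      Mesh.HasPiece.lt_size h (hz s(b, b) (by simp [pieces])) (Sym2.mem_mk_left b b)
    have hfirst := h.openArc_of_hasPiece (hz s(a, b) (by simp [pieces]))
      (by rintro rfl; simp [pieces] at ha)
    have hrest := h.openArc_pathPoints (l := c :: l) (a := b) (by simp) hn'
      fun z hz' => hz z (by simp [pieces, hz'])
    rw [pathPoints_cons_cons (by simp) (h.lab_eq_vertex b hb)]
    refine hfirst.trans hrest ?_ ?_ ?_
    · rw [Set.disjoint_left]
      rintro x hx ⟨z, hz', hx'⟩
      obtain rfl := Label.piece.inj (hx.symm.trans hx')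
      exact hab (List.mem_cons_of_mem _ hz')
    · intro hvert
      have heq := Label.piece.inj (((h.lab_eq_vertex b hb _).2 rfl).symm.trans hvert)
      exact hab (heq ▸ List.mem_cons_self ..)
    · rw [h.vert_mem_pathPoints hb]
      exact (List.nodup_cons.1 hn').1

theorem IsSkeleton.injOn_vert (h : IsSkeleton M.size M.arcs vert lab) :
    InjOn vert (Iio M.size) := by
  intro a ha b hb hab
  have hlab := ((h.lab_eq_vertex a ha _).2 rfl).symm.trans ((h.lab_eq_vertex b hb _).2 hab)
  simpa using Label.piece.inj hlab

theorem Drawn.lt_size (h : IsSkeleton M.size M.arcs vert lab) (hD : Drawn M V D)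
    {a : ℕ} (ha : a ∈ V) : a < M.size :=
  Mesh.HasPiece.lt_size h (hD.hasPiece s(a, a) (List.mem_append_left _ (List.mem_map_of_mem ha)))
    (Sym2.mem_mk_left a a)

theorem Drawn.vert_notMem_pathPoints (h : IsSkeleton M.size M.arcs vert lab)
    (hD : Drawn M V D) {a : ℕ} (ha : a ∈ V) {l : List ℕ} (hl : l ∈ D) :
    vert a ∉ pathPoints lab l := by
  rw [h.vert_mem_pathPoints (hD.lt_size h ha)]
  exact fun hz => (List.nodup_append.1 hD.nodup).2.2 _ (List.mem_map_of_mem ha) _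
    (List.mem_flatMap.2 ⟨l, hl, hz⟩) rfl

theorem Drawn.openArc (h : IsSkeleton M.size M.arcs vert lab) (hD : Drawn M V D)
    {l : List ℕ} (hl : l ∈ D) (hV : (ends l).1 ∈ V) :
    OpenArc (pathPoints lab l) (vert (ends l).1) (vert (ends l).2) := by
  have hnodup := List.nodup_append.1 hD.nodup
  have hpieces : ∀ z ∈ pieces l, z ∈ D.flatMap pieces := fun z hz => List.mem_flatMap.2 ⟨l, hl, hz⟩
  match l, hD.two_le l hl with
  | a :: b :: l, _ =>
    exact h.openArc_pathPoints (l := b :: l) (by simp)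
      (List.nodup_cons.2 ⟨fun hz => hnodup.2.2 _ (List.mem_map_of_mem hV) _ (hpieces _ hz) rfl,
        (List.nodup_flatMap.1 hnodup.2.1).1 _ hl⟩)
      fun z hz => hD.hasPiece z (List.mem_append_right _ (hpieces z hz))

end Skeleton

theorem Drawn.pairwise_disjoint_pathPoints {X : Type*} {M : Mesh} {V : List ℕ}
    {D : List (List ℕ)} {lab : X → Label} (hD : Drawn M V D) :
    D.Pairwise fun l l' => Disjoint (pathPoints lab l) (pathPoints lab l') := by
  refine (List.nodup_flatMap.1 (List.nodup_append.1 hD.nodup).2.1).2.imp fun {l l'} hll' => ?_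
  rw [Set.disjoint_left]
  rintro x ⟨z, hz, hx⟩ ⟨z', hz', hx'⟩
  obtain rfl := Label.piece.inj (hx.symm.trans hx')
  exact hll' hz hz'

/-- The graph `K` has the vertices `v a`, for `a` in `V`, and the edges `es`, whose ends are
listed in `L`. -/
structure Presents {α β : Type*} (K : Graph α β) (v : ℕ → α) (es : List β) (V : List ℕ)
    (L : List (ℕ × ℕ)) : Prop where
  injOn : InjOn v {a | a ∈ V}
  vertexSet : V(K) = v '' {a | a ∈ V}
  nodup : es.Nodup
  edgeSet : E(K) = {e | e ∈ es}
  isLink : List.Forall₂ (fun e z => K.IsLink e (v z.1) (v z.2)) es L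
  mem : ∀ z ∈ L, z.1 ∈ V ∧ z.2 ∈ V

section Presents

variable {α β : Type*} {K : Graph α β} {v : ℕ → α} {es : List β} {V : List ℕ}
  {L : List (ℕ × ℕ)}

theorem Presents.exists_injective_index (hK : Presents K v es V L) :
    ∃ idx : E(K) → Fin L.length, Injective idx ∧
      ∀ e : E(K), K.IsLink e (v L[idx e].1) (v L[idx e].2) := by
  have hlength := hK.isLink.length_eq
  have hex : ∀ e : E(K), ∃ (i : ℕ) (hi : i < es.length), es[i] = e := fun e =>
    List.mem_iff_getElem.1 (hK.edgeSet ▸ e.2 : e.1 ∈ {e | e ∈ es})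
  choose idx hidx hes using hex
  refine ⟨fun e => ⟨idx e, hlength ▸ hidx e⟩, fun e f hef => Subtype.ext ?_, fun e => ?_⟩
  · rw [← hes e, ← hes f]
    simp only [Fin.mk.injEq] at hef
    simp [hef]
  · simpa [hes] using (List.forall₂_iff_get.1 hK.isLink).2 (idx e) (hidx e) (hlength ▸ hidx e)

theorem Presents.exists_num (hK : Presents K v es V L) :
    ∃ num : V(K) → ℕ, ∀ x, num x ∈ V ∧ v (num x) = x := by
  have hex : ∀ x : V(K), ∃ a, a ∈ V ∧ v a = x := fun x =>
    (hK.vertexSet ▸ x.2 : x.1 ∈ v '' {a | a ∈ V})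
  choose num hnum using hex
  exact ⟨num, hnum⟩

theorem Presents.nonempty_embedding {X : Type*} [TopologicalSpace X] (hK : Presents K v es V L)
    {vert : ℕ → X} (hvert : InjOn vert {a | a ∈ V}) {S : Fin L.length → Set X}
    (hS : ∀ i, OpenArc (S i) (vert L[i].1) (vert L[i].2)) (hVS : ∀ i, ∀ a ∈ V, vert a ∉ S i)
    (hSS : Pairwise (Disjoint on S)) : Nonempty (Embedding K X) := by
  obtain ⟨idx, hidx, hlink⟩ := hK.exists_injective_index
  obtain ⟨num, hnum⟩ := hK.exists_num
  have num_eq {x : V(K)} {a : ℕ} (ha : a ∈ V) (hx : x = v a) : num x = a :=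
    hK.injOn (hnum x).1 ha ((hnum x).2.trans hx)
  choose γ hγ0 hγ1 hγinj hγS using fun e => (hS (idx e)).exists_unitInterval_curve
  have hγmem : ∀ e, ∀ t ∈ Ioo (0 : I) 1, γ e t ∈ S (idx e) := fun e t ht =>
    hγS e ▸ mem_image_of_mem _ ht
  refine ⟨⟨fun x => vert (num x), γ, ?_, ?_, hγinj, ?_, ?_⟩⟩
  · intro x y hxy
    have hxy := hvert (hnum x).1 (hnum y).1 hxy
    exact Subtype.ext ((hnum x).2.symm.trans (hxy ▸ (hnum y).2))
  · intro e x y hxy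
    obtain ⟨hmem₁, hmem₂⟩ := hK.mem _ (List.getElem_mem (idx e).2)
    rw [hγ0, hγ1]
    rcases hxy.eq_and_eq_or_eq_and_eq (hlink e) with ⟨hx, hy⟩ | ⟨hx, hy⟩
    · rw [num_eq hmem₁ hx, num_eq hmem₂ hy]; rfl
    · rw [num_eq hmem₂ hx, num_eq hmem₁ hy, Sym2.eq_swap]; rfl
  · intro e t ht x hx
    exact hVS (idx e) (num x) (hnum x).1 (hx ▸ hγmem e t ht)
  · intro e f hef s hs t ht hst
    exact Set.disjoint_left.1 (hSS (hidx.ne hef)) (hγmem e s hs) (hst ▸ hγmem f t ht)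

theorem Drawn.nonempty_embedding {X : Type*} [TopologicalSpace X] {M : Mesh}
    {D : List (List ℕ)} (hM : M.Realizable X) (hD : Drawn M V D)
    (hK : Presents K v es V (D.map ends)) : Nonempty (Embedding K X) := by
  obtain ⟨vert, lab, hs, -, -⟩ := hM
  refine hK.nonempty_embedding (vert := vert)
    (S := fun i => pathPoints lab (D[i.1]'(by simpa using i.2)))
    (hs.injOn_vert.mono fun a ha => hD.lt_size hs ha) (fun i => ?_)
    (fun i a ha => hD.vert_notMem_pathPoints hs ha (List.getElem_mem _)) fun i j hij => ?_
  · have hmem := (hK.mem _ (List.getElem_mem i.2)).1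
    simp only [List.getElem_map, Fin.getElem_fin] at hmem ⊢
    exact hD.openArc hs (List.getElem_mem _) hmem
  · have hpairwise := List.pairwise_iff_getElem.1 (hD.pairwise_disjoint_pathPoints (lab := lab))
    rcases lt_or_gt_of_ne (Fin.val_ne_of_ne hij) with hlt | hlt
    · exact hpairwise _ _ _ _ hlt
    · exact (hpairwise _ _ _ _ hlt).symm

end Presents

/-! ### Adding edges to presentations -/

/-- Subdivide the edge number `i` by the new vertex `p`. -/
def subdivide (L : List (ℕ × ℕ)) (i p : ℕ) : List (ℕ × ℕ) :=
  L.set i ((L.getD i (0, 0)).1, p) ++ [(p, (L.getD i (0, 0)).2)]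

/-- Subdivide the edges number `i` and `j` by `p` and `q`, and join these vertices. Subdividing the
edge `i` leaves its first half at `i` and puts its second half at the end of the list. -/
def addChord (L : List (ℕ × ℕ)) (i j p q : ℕ) : List (ℕ × ℕ) :=
  subdivide (subdivide L i p) j q ++ [(p, q)]

/-- Subdivide the edge number `i` by `p`, and attach to `p` an edge ending in a loop at `q`. -/
def addLoop (L : List (ℕ × ℕ)) (i p q : ℕ) : List (ℕ × ℕ) :=
  subdivide L i p ++ [(p, q)] ++ [(q, q)]

theorem subdivide_append (A B : List (ℕ × ℕ)) (x y p : ℕ) :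
    subdivide (A ++ (x, y) :: B) A.length p = A ++ (x, p) :: B ++ [(p, y)] := by
  simp [subdivide]

theorem length_subdivide (L : List (ℕ × ℕ)) (i p : ℕ) :
    (subdivide L i p).length = L.length + 1 := by
  simp [subdivide]

section Graph

variable {α β : Type*} {G K : Graph α β} {e f : β} {u w x y : α}

theorem IsSubdivision.edge_mem (h : IsSubdivision G K e u) : e ∈ E(G) := by
  obtain ⟨x, y, e', hxy, -⟩ := h
  exact hxy.edge_mem

theorem IsSubdivision.notMem (h : IsSubdivision G K e u) : u ∉ V(G) := by
  obtain ⟨x, y, e', -, hu, -⟩ := h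
  exact hu

theorem IsSubdivision.vertexSet_eq (h : IsSubdivision G K e u) : V(K) = insert u V(G) := by
  obtain ⟨x, y, e', -, -, -, hV, -⟩ := h
  exact hV

theorem IsSubdivision.isLink_of_ne (h : IsSubdivision G K e u) (hf : f ≠ e) (hxy : G.IsLink f x y) :
    K.IsLink f x y := by
  obtain ⟨a, b, e', -, -, -, -, hK⟩ := h
  exact (hK f x y).2 (Or.inl ⟨hf, hxy⟩)

theorem IsSubdivision.exists_halves (h : IsSubdivision G K e u) (hxy : G.IsLink e x y) :
    ∃ e' ∉ E(G), E(K) = insert e' E(G) ∧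
      ∃ e₁ e₂, [e₁, e₂].Perm [e, e'] ∧ K.IsLink e₁ x u ∧ K.IsLink e₂ u y := by
  obtain ⟨a, b, e', hab, -, he', -, hK⟩ := h
  have hau : K.IsLink e a u := (hK _ _ _).2 (Or.inr (Or.inl ⟨rfl, rfl⟩))
  have hub : K.IsLink e' u b := (hK _ _ _).2 (Or.inr (Or.inr ⟨rfl, rfl⟩))
  refine ⟨e', he', ?_, ?_⟩
  · ext f
    simp only [mem_insert_iff, Graph.edge_mem_iff_exists_isLink]
    constructor
    · rintro ⟨c, d, hcd⟩
      rcases (hK f c d).1 hcd with ⟨-, hcd⟩ | ⟨rfl, -⟩ | ⟨rfl, -⟩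
      · exact Or.inr ⟨c, d, hcd⟩
      · exact Or.inr ⟨_, _, hab⟩
      · exact Or.inl rfl
    · rintro (rfl | ⟨c, d, hcd⟩)
      · exact ⟨u, b, hub⟩
      · by_cases hfe : f = e
        · exact ⟨a, u, hfe ▸ hau⟩
        · exact ⟨c, d, (hK _ _ _).2 (Or.inl ⟨hfe, hcd⟩)⟩
  · rcases hab.eq_and_eq_or_eq_and_eq hxy with ⟨rfl, rfl⟩ | ⟨rfl, rfl⟩
    · exact ⟨e, e', .refl _, hau, hub⟩
    · exact ⟨e', e, .swap _ _ _, hub.symm, hau.symm⟩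

theorem IsJoin.edgeSet_eq (h : IsJoin G K e u w) : E(K) = insert e E(G) := by
  obtain ⟨-, -, hK⟩ := h
  ext f
  simp only [mem_insert_iff, Graph.edge_mem_iff_exists_isLink, hK]
  constructor
  · rintro ⟨x, y, hxy | ⟨rfl, -⟩⟩
    · exact Or.inr ⟨x, y, hxy⟩
    · exact Or.inl rfl
  · rintro (rfl | ⟨x, y, hxy⟩)
    · exact ⟨_, _, Or.inr ⟨rfl, rfl⟩⟩
    · exact ⟨x, y, Or.inl hxy⟩

end Graph

section Presents

variable {α β : Type*} {G K : Graph α β} {v v' : ℕ → α} {es : List β} {V : List ℕ}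
  {L : List (ℕ × ℕ)} {e : β} {u : α} {a b p q : ℕ}

theorem mem_vertices_append_singleton : {a | a ∈ V ++ [p]} = insert p {a | a ∈ V} := by
  ext a
  simp [or_comm]

theorem eqOn_update_vertices (hp : p ∉ V) : EqOn (update v p u) v {a | a ∈ V} := fun _ ha =>
  update_of_ne (ne_of_mem_of_not_mem ha hp) _ _

theorem Presents.image_update (h : Presents G v es V L) (hp : p ∉ V) :
    update v p u '' {a | a ∈ V ++ [p]} = insert u V(G) := by
  rw [mem_vertices_append_singleton, image_insert_eq, update_self,
    image_congr (eqOn_update_vertices hp), h.vertexSet]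

theorem Presents.injOn_update (h : Presents G v es V L) (hp : p ∉ V) (hu : u ∉ V(G)) :
    InjOn (update v p u) {a | a ∈ V ++ [p]} := by
  rw [mem_vertices_append_singleton, injOn_insert (a := p) hp, update_self,
    image_congr (eqOn_update_vertices hp), ← h.vertexSet]
  exact ⟨h.injOn.congr (eqOn_update_vertices hp).symm, hu⟩

theorem forall₂_isLink_congr (hv : EqOn v' v {a | a ∈ V}) (hL : ∀ z ∈ L, z.1 ∈ V ∧ z.2 ∈ V)
    (hK : ∀ e ∈ es, ∀ x y, G.IsLink e x y → K.IsLink e x y)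
    (h : List.Forall₂ (fun e z => G.IsLink e (v z.1) (v z.2)) es L) :
    List.Forall₂ (fun e z => K.IsLink e (v' z.1) (v' z.2)) es L := by
  rw [List.forall₂_iff_get] at h ⊢
  refine ⟨h.1, fun i hi hi' => ?_⟩
  have hz := hL _ (List.get_mem L ⟨i, hi'⟩)
  rw [hv hz.1, hv hz.2]
  exact hK _ (List.get_mem _ _) _ _ (h.2 i hi hi')

theorem Presents.exists_eq_append (h : Presents G v es V L) (he : e ∈ E(G)) :
    ∃ A B L₁ x y L₂, es = A ++ e :: B ∧ L = L₁ ++ (x, y) :: L₂ ∧ e ∉ A ∧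
      List.Forall₂ (fun e z => G.IsLink e (v z.1) (v z.2)) A L₁ ∧ G.IsLink e (v x) (v y) ∧
      List.Forall₂ (fun e z => G.IsLink e (v z.1) (v z.2)) B L₂ := by
  obtain ⟨A, B, rfl, hA⟩ := List.eq_append_cons_of_mem (h.edgeSet ▸ he : e ∈ {e | e ∈ es})
  have htake := List.forall₂_take A.length h.isLink
  have hdrop := List.forall₂_drop A.length h.isLink
  rw [List.take_left] at htake
  rw [List.drop_left] at hdrop
  obtain ⟨⟨x, y⟩, L₂, hlink, hB, hL₂⟩ := List.forall₂_cons_left_iff.1 hdrop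
  exact ⟨A, B, _, x, y, L₂, rfl, by rw [← hL₂, List.take_append_drop], hA, htake, hlink, hB⟩

theorem Presents.subdivide_append {A B : List β} {L₁ L₂ : List (ℕ × ℕ)} {x y : ℕ}
    (h : Presents G v (A ++ e :: B) V (L₁ ++ (x, y) :: L₂))
    (hA : List.Forall₂ (fun e z => G.IsLink e (v z.1) (v z.2)) A L₁) (hxy : G.IsLink e (v x) (v y))
    (hB : List.Forall₂ (fun e z => G.IsLink e (v z.1) (v z.2)) B L₂) (hS : IsSubdivision G K e u) :
    ∃ es', ∀ p ∉ V,
      Presents K (update v p u) es' (V ++ [p]) (L₁ ++ (x, p) :: L₂ ++ [(p, y)]) := by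
  obtain ⟨e', he', hE, e₁, e₂, hperm, hxu, huy⟩ := hS.exists_halves hxy
  have hperm : (A ++ e₁ :: B ++ [e₂]).Perm (e' :: (A ++ e :: B)) := by
    calc A ++ e₁ :: B ++ [e₂] |>.Perm (e₂ :: e₁ :: (A ++ B)) :=
          (List.perm_append_singleton _ _).trans (.cons _ List.perm_middle)
      _ |>.Perm (e₁ :: e₂ :: (A ++ B)) := .swap _ _ _
      _ |>.Perm (e :: e' :: (A ++ B)) := hperm.append_right _
      _ |>.Perm (e' :: e :: (A ++ B)) := .swap _ _ _
      _ |>.Perm (e' :: (A ++ e :: B)) := .cons _ List.perm_middle.symm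
  have hold : ∀ f ∈ A ++ B, ∀ x y, G.IsLink f x y → K.IsLink f x y := fun f hf x y =>
    hS.isLink_of_ne <| by
      rintro rfl
      exact (List.nodup_cons.1 (List.nodup_middle.1 h.nodup)).1 hf
  have hmem : ∀ z ∈ L₁ ++ L₂, z.1 ∈ V ∧ z.2 ∈ V := fun z hz => h.mem z (by
    simp only [List.mem_append, List.mem_cons] at hz ⊢
    tauto)
  obtain ⟨hx, hy⟩ := h.mem (x, y) (by simp)
  refine ⟨A ++ e₁ :: B ++ [e₂], fun p hp => ?_⟩
  have hv := eqOn_update_vertices (v := v) (u := u) hp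
  refine ⟨h.injOn_update hp hS.notMem, by rw [hS.vertexSet_eq, h.image_update hp], ?_, ?_,
    List.rel_append (List.rel_append (forall₂_isLink_congr hv (fun z hz => hmem z (by simp [hz]))
      (fun f hf => hold f (by simp [hf])) hA) (.cons (by simpa [hv hx] using hxu) ?_))
      (.cons (by simpa [hv hy] using huy) .nil), fun z hz => ?_⟩
  · exact hperm.nodup_iff.2 (List.nodup_cons.2 ⟨fun he => he' (h.edgeSet ▸ he), h.nodup⟩)
  · rw [hE, h.edgeSet]
    ext f
    exact (List.mem_cons.symm.trans hperm.mem_iff.symm :)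
  · exact forall₂_isLink_congr hv (fun z hz => hmem z (by simp [hz]))
      (fun f hf => hold f (by simp [hf])) hB
  · have hz' := hmem z
    simp only [List.mem_append, List.mem_cons, List.not_mem_nil, or_false] at hz hz' ⊢
    rcases hz with (hz | rfl | hz) | rfl <;> tauto

theorem Presents.subdivide [DecidableEq β] (h : Presents G v es V L)
    (hS : IsSubdivision G K e u) :
    es.idxOf e < L.length ∧ ∃ es', ∀ p ∉ V,
      Presents K (update v p u) es' (V ++ [p]) (CubicTorus.subdivide L (es.idxOf e) p) := by
  obtain ⟨A, B, L₁, x, y, L₂, rfl, rfl, he, hA, hxy, hB⟩ := h.exists_eq_append hS.edge_mem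
  have hidx : (A ++ e :: B).idxOf e = L₁.length := by
    rw [List.idxOf_append_of_notMem he, List.idxOf_cons_self, hA.length_eq, add_zero]
  simp only [hidx, CubicTorus.subdivide_append]
  exact ⟨by simp, h.subdivide_append hA hxy hB hS⟩

theorem Presents.join_of_eqOn (h : Presents G v es V L) {V' : List ℕ}
    (hv : EqOn v' v {a | a ∈ V}) (hV : V ⊆ V') (hinj : InjOn v' {a | a ∈ V'})
    (hK : V(K) = v' '' {a | a ∈ V'}) (ha : a ∈ V') (hb : b ∈ V')
    (hJ : IsJoin G K e (v' a) (v' b)) : Presents K v' (es ++ [e]) V' (L ++ [(a, b)]) where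
  injOn := hinj
  vertexSet := hK
  nodup := by
    have he : e ∉ es := fun he => hJ.1 (h.edgeSet ▸ he)
    exact List.nodup_append_comm.1 (List.nodup_cons.2 ⟨he, h.nodup⟩)
  edgeSet := by
    rw [hJ.edgeSet_eq, h.edgeSet]
    ext f
    simp [or_comm]
  isLink := List.rel_append
    (forall₂_isLink_congr hv h.mem (fun _ _ _ _ hxy => (hJ.2.2 _ _ _).2 (Or.inl hxy)) h.isLink)
    (.cons ((hJ.2.2 _ _ _).2 (Or.inr ⟨rfl, rfl⟩)) .nil)
  mem z hz := by
    simp only [List.mem_append, List.mem_singleton] at hz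
    rcases hz with hz | rfl
    · exact (h.mem z hz).imp (hV ·) (hV ·)
    · exact ⟨ha, hb⟩

theorem Presents.join (h : Presents G v es V L) (ha : a ∈ V) (hb : b ∈ V)
    (hJ : IsJoin G K e (v a) (v b)) : Presents K v (es ++ [e]) V (L ++ [(a, b)]) := by
  have hmem : ∀ a ∈ V, v a ∈ V(G) := fun a ha => h.vertexSet ▸ mem_image_of_mem v ha
  refine h.join_of_eqOn (eqOn_refl _ _) (List.Subset.refl _) h.injOn ?_ ha hb hJ
  rw [hJ.2.1, insert_eq_of_mem (hmem b hb), insert_eq_of_mem (hmem a ha), h.vertexSet]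

theorem Presents.joinNew (h : Presents G v es V L) (ha : a ∈ V) (hp : p ∉ V) (hu : u ∉ V(G))
    (hJ : IsJoin G K e (v a) u) :
    Presents K (update v p u) (es ++ [e]) (V ++ [p]) (L ++ [(a, p)]) := by
  have hv := eqOn_update_vertices (v := v) (u := u) hp
  have hva : v a ∈ insert u V(G) := h.vertexSet ▸ Or.inr (mem_image_of_mem v ha)
  refine h.join_of_eqOn hv (List.subset_append_left _ _) (h.injOn_update hp hu) ?_
    (by simp [ha]) (by simp) (by rwa [hv ha, update_self])
  rw [hJ.2.1, h.image_update hp, insert_eq_of_mem hva]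

theorem Presents.addChord {e₁ e₂ f : β} {w : α} {S T : Graph α β} (h : Presents G v es V L)
    (hS : IsSubdivision G S e₁ u) (hT : IsSubdivision S T e₂ w) (hJ : IsJoin T K f u w) :
    ∃ i < L.length, ∃ j < L.length + 1, ∀ p ∉ V, ∀ q ∉ V, p ≠ q →
      ∃ v' es', Presents K v' es' (V ++ [p] ++ [q]) (CubicTorus.addChord L i j p q) := by
  classical
  obtain ⟨hi, es₁, hS'⟩ := h.subdivide hS
  obtain ⟨p₀, hp₀⟩ : ∃ p, p ∉ V := Infinite.exists_notMem_finset V.toFinset |>.imp (by simp)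
  have hj := ((hS' p₀ hp₀).subdivide hT).1
  rw [length_subdivide] at hj
  refine ⟨_, hi, _, hj, fun p hp q hq hpq => ?_⟩
  obtain ⟨-, es₂, hT'⟩ := (hS' p hp).subdivide hT
  refine ⟨_, _, (hT' q (by simp [hq, hpq.symm])).join (e := f) (a := p) (b := q) (by simp)
    (by simp) ?_⟩
  simpa [update_of_ne hpq] using hJ

theorem Presents.addLoop {e₁ f l : β} {w : α} {S T : Graph α β} (h : Presents G v es V L)
    (hS : IsSubdivision G S e₁ u) (hw : w ∉ V(S)) (hT : IsJoin S T f u w) (hK : IsJoin T K l w w) :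
    ∃ i < L.length, ∀ p ∉ V, ∀ q ∉ V, p ≠ q →
      ∃ v' es', Presents K v' es' (V ++ [p] ++ [q]) (CubicTorus.addLoop L i p q) := by
  classical
  obtain ⟨hi, es₁, hS'⟩ := h.subdivide hS
  refine ⟨_, hi, fun p hp q hq hpq => ?_⟩
  have hT' := (hS' p hp).joinNew (a := p) (p := q) (by simp) (by simp [hq, hpq.symm]) hw
    (by simpa using hT)
  exact ⟨_, _, hT'.join (a := q) (b := q) (by simp) (by simp) (by simpa using hK)⟩

theorem Presents.addEdge (h : Presents G v es V L) (hK : IsAddEdge G K) :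
    (∃ i < L.length, ∃ j < L.length + 1, ∀ p ∉ V, ∀ q ∉ V, p ≠ q →
      ∃ v' es', Presents K v' es' (V ++ [p] ++ [q]) (CubicTorus.addChord L i j p q)) ∨
    ∃ i < L.length, ∀ p ∉ V, ∀ q ∉ V, p ≠ q →
      ∃ v' es', Presents K v' es' (V ++ [p] ++ [q]) (CubicTorus.addLoop L i p q) := by
  cases hK with
  | pendantLoop e₁ f l u w S T hS hw hT hK => exact Or.inr (h.addLoop hS hw hT hK)
  | sameEdge e₁ f u w S T hS hT hK => exact Or.inl (h.addChord hS hT hK)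
  | twoEdges e₁ e₂ f u w S T _ _ _ hS hT hK => exact Or.inl (h.addChord hS hT hK)

end Presents

/-! ### Relabelling presentations -/

section Relabel

variable {α β : Type*} {K : Graph α β} {v : ℕ → α} {es : List β} {V V' : List ℕ}
  {L L' : List (ℕ × ℕ)}

/-- An edge without its orientation. -/
def unoriented (z : ℕ × ℕ) : Sym2 ℕ := s(z.1, z.2)

/-- A number that determines an unordered pair. Comparing two pairs by computation is much slower
than comparing these numbers. -/
def pairCode (z : Sym2 ℕ) : ℕ := Nat.pair z.inf z.sup

theorem pairCode_injective : Injective pairCode := fun _ _ h =>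
  Sym2.inf_eq_inf_and_sup_eq_sup.1 (Nat.pair_eq_pair.1 h)

theorem Presents.map (h : Presents K v es V L) {f : ℕ → ℕ} (hf : InjOn f {a | a ∈ V}) :
    Presents K (v ∘ invFunOn f {a | a ∈ V}) es (V.map f) (L.map (Prod.map f f)) := by
  have hinv : ∀ a ∈ V, invFunOn f {a | a ∈ V} (f a) = a := hf.leftInvOn_invFunOn
  have himage : {a | a ∈ V.map f} = f '' {a | a ∈ V} := by
    ext a
    exact List.mem_map
  refine ⟨?_, ?_, h.nodup, h.edgeSet, ?_, ?_⟩
  · rw [himage]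
    rintro _ ⟨a, ha, rfl⟩ _ ⟨b, hb, rfl⟩ hab
    rw [comp_apply, comp_apply, hinv a ha, hinv b hb] at hab
    rw [h.injOn ha hb hab]
  · rw [himage, image_image, h.vertexSet]
    exact image_congr fun a ha => by rw [comp_apply, hinv a ha]
  · rw [List.forall₂_map_right_iff]
    rw [List.forall₂_iff_get]
    refine ⟨h.isLink.length_eq, fun i hi hi' => ?_⟩
    obtain ⟨h₁, h₂⟩ := h.mem _ (List.get_mem L ⟨i, hi'⟩)
    rw [comp_apply, comp_apply, Prod.map_fst, Prod.map_snd, hinv _ h₁, hinv _ h₂]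
    exact h.isLink.get hi hi'
  · rintro _ hz'
    obtain ⟨z, hz, rfl⟩ := List.mem_map.1 hz'
    exact (h.mem z hz).imp (List.mem_map_of_mem (f := f)) (List.mem_map_of_mem (f := f))

theorem Presents.perm_vertices (h : Presents K v es V L) (hV : V'.Perm V) :
    Presents K v es V' L := by
  have hset : {a | a ∈ V'} = {a | a ∈ V} := Set.ext fun _ => hV.mem_iff
  exact ⟨hset ▸ h.injOn, hset ▸ h.vertexSet, h.nodup, h.edgeSet, h.isLink,
    fun z hz => (h.mem z hz).imp hV.mem_iff.2 hV.mem_iff.2⟩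

theorem isLink_iff_unoriented {e : β} {z : ℕ × ℕ} :
    K.IsLink e (v z.1) (v z.2) ↔ ∀ a b, unoriented z = s(a, b) → K.IsLink e (v a) (v b) := by
  refine ⟨fun h a b hz => ?_, fun h => h _ _ rfl⟩
  obtain ⟨rfl, rfl⟩ | ⟨rfl, rfl⟩ := Sym2.eq_iff.1 hz
  exacts [h, h.symm]

theorem mem_iff_unoriented {z : ℕ × ℕ} :
    z.1 ∈ V ∧ z.2 ∈ V ↔ ∀ a ∈ unoriented z, a ∈ V := by
  simp [unoriented]

theorem Presents.perm_edges (h : Presents K v es V L)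
    (hL : (L'.map unoriented).Perm (L.map unoriented)) : ∃ es', Presents K v es' V L' := by
  have hlink := h.isLink.flip
  simp only [isLink_iff_unoriented] at hlink
  obtain ⟨es', hlink', hes⟩ := List.perm_comp_forall₂ hL
    (List.forall₂_map_left_iff (R := fun z e => ∀ a b, z = s(a, b) → K.IsLink e (v a) (v b)).2
      hlink)
  rw [List.forall₂_map_left_iff] at hlink'
  refine ⟨es', h.injOn, h.vertexSet, hes.nodup_iff.2 h.nodup, ?_, ?_, fun z hz => ?_⟩
  · rw [h.edgeSet]
    exact Set.ext fun _ => hes.mem_iff.symm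
  · simpa only [flip, isLink_iff_unoriented] using hlink'.flip
  · obtain ⟨w, hw, hwz⟩ := List.mem_map.1 (hL.mem_iff.1 (List.mem_map_of_mem hz))
    rw [mem_iff_unoriented, ← hwz, ← mem_iff_unoriented]
    exact h.mem w hw

/-- The image of a pair of vertices under the map of `{0, …, n - 1}` with the values `τ`. -/
def imagePair (τ : List ℕ) (z : ℕ × ℕ) : ℕ × ℕ := (τ.getD z.1 0, τ.getD z.2 0)

/-- The permutation of `{0, …, n - 1}` with the values `τ` takes the edges `L` to the edges `L'`, up
to their order and orientation. -/
def Relabels (n : ℕ) (τ : List ℕ) (L L' : List (ℕ × ℕ)) : Prop :=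
  τ.Perm (List.range n) ∧ (L'.map unoriented).Perm ((L.map (imagePair τ)).map unoriented)

instance (n : ℕ) (τ : List ℕ) (L L' : List (ℕ × ℕ)) : Decidable (Relabels n τ L L') :=
  decidable_of_iff (τ.Perm (List.range n) ∧ ((L'.map unoriented).map pairCode).Perm
      (((L.map (imagePair τ)).map unoriented).map pairCode)) <| by
    rw [List.map_perm_map_iff pairCode_injective, Relabels]

theorem map_getD_range {α : Type*} (l : List α) (d : α) :
    (List.range l.length).map (l.getD · d) = l := by
  refine List.ext_getElem (by simp) fun i _ hi => ?_
  simp [List.getElem?_eq_getElem hi]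

theorem Presents.relabel {n : ℕ} {τ : List ℕ} (h : Presents K v es (List.range n) L)
    (hτ : Relabels n τ L L') : ∃ v' es', Presents K v' es' (List.range n) L' := by
  obtain ⟨hperm, hL⟩ := hτ
  have hmap : (List.range n).map (τ.getD · 0) = τ := by
    rw [← List.length_range (n := n), ← hperm.length_eq, map_getD_range]
  have hinj : InjOn (τ.getD · 0) {a | a ∈ List.range n} :=
    List.inj_on_of_nodup_map (hmap.symm ▸ hperm.nodup_iff.2 List.nodup_range)
  have hτ := h.map hinj
  rw [hmap] at hτ
  exact ⟨_, (hτ.perm_vertices hperm.symm).perm_edges hL⟩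

end Relabel

section Isomorphic

variable {α β : Type*} {K : Graph α β} {v : ℕ → α} {es : List β} {L : List (ℕ × ℕ)} {n m : ℕ}
  {e : Fin m → Sym2 (Fin n)}

theorem edgeSet_ofEnds : E(ofEnds e) = univ := by
  refine eq_univ_of_forall fun i => ?_
  obtain ⟨a, b, hab⟩ := Sym2.exists.1 ⟨e i, rfl⟩
  exact (Graph.edge_mem_iff_exists_isLink _ _).2 ⟨a, b, hab⟩

theorem isomorphic_ofEnds_iff : Isomorphic K (ofEnds e) ↔ ∃ (x : Fin n ≃ V(K)) (y : Fin m ≃ E(K)),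
    ∀ i a b, K.IsLink (y i) (x a) (x b) ↔ e i = s(a, b) := by
  let φ₀ : Fin n ≃ V(ofEnds e) := (Equiv.Set.univ _).symm
  let ψ₀ : Fin m ≃ E(ofEnds e) := (Equiv.Set.univ _).symm.trans (Equiv.setCongr edgeSet_ofEnds.symm)
  constructor
  · rintro ⟨φ, ψ, h⟩
    refine ⟨φ₀.trans φ.symm, ψ₀.trans ψ.symm, fun i a b => (h _ _ _).trans ?_⟩
    simp only [Equiv.trans_apply, Equiv.apply_symm_apply]
    rfl
  · rintro ⟨x, y, h⟩
    refine ⟨x.symm.trans φ₀, y.symm.trans ψ₀, fun f a b => ?_⟩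
    obtain ⟨i, rfl⟩ := y.surjective f
    obtain ⟨a, rfl⟩ := x.surjective a
    obtain ⟨b, rfl⟩ := x.surjective b
    simp only [Equiv.trans_apply, Equiv.symm_apply_apply]
    exact h i a b

theorem Presents.isLink_iff {V : List ℕ} (h : Presents K v es V L) {i : ℕ} (hi : i < es.length)
    (hi' : i < L.length) {a b : ℕ} (ha : a ∈ V) (hb : b ∈ V) :
    K.IsLink es[i] (v a) (v b) ↔ unoriented L[i] = s(a, b) := by
  have hlink : K.IsLink es[i] (v L[i].1) (v L[i].2) := h.isLink.get hi hi'
  refine ⟨fun hab => Sym2.eq_iff.2 ?_, isLink_iff_unoriented.1 hlink a b⟩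
  obtain ⟨h₁, h₂⟩ := h.mem _ (List.getElem_mem hi')
  exact (hlink.eq_and_eq_or_eq_and_eq hab).imp
    (And.imp (h.injOn h₁ ha) (h.injOn h₂ hb)) (And.imp (h.injOn h₁ hb) (h.injOn h₂ ha))

theorem unoriented_getElem (hL : L.map unoriented = (List.ofFn e).map (Sym2.map Fin.val))
    {i : ℕ} (hi : i < m) (hi' : i < L.length) : unoriented L[i] = (e ⟨i, hi⟩).map Fin.val := by
  have := List.getElem_of_eq hL (i := i) (by simpa using hi')
  simpa using this

theorem Presents.isomorphic (h : Presents K v es (List.range n) L)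
    (hL : L.map unoriented = (List.ofFn e).map (Sym2.map Fin.val)) : Isomorphic K (ofEnds e) := by
  classical
  have hlen : L.length = m := by simpa using congrArg List.length hL
  have hlen' : es.length = m := h.isLink.length_eq.trans hlen
  let x : Fin n ≃ V(K) :=
    (Fin.equivSubtype.trans (Equiv.subtypeEquivRight fun _ => List.mem_range.symm)).trans
      (h.injOn.bijOn_image.equiv.trans (Equiv.setCongr h.vertexSet.symm))
  let y : Fin m ≃ E(K) := (finCongr hlen'.symm).trans
    ((List.Nodup.getEquiv es h.nodup).trans (Equiv.setCongr h.edgeSet.symm))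
  refine isomorphic_ofEnds_iff.2 ⟨x, y, fun i a b => ?_⟩
  refine (h.isLink_iff (i := i) (by omega) (by omega) (by simp) (by simp)).trans ?_
  rw [unoriented_getElem hL i.isLt]
  exact (Sym2.map.injective Fin.val_injective).eq_iff (b := s(a, b))

theorem exists_presents_of_isomorphic [NeZero n] (h : Isomorphic K (ofEnds e))
    (hL : L.map unoriented = (List.ofFn e).map (Sym2.map Fin.val)) :
    ∃ v es, Presents K v es (List.range n) L := by
  obtain ⟨x, y, h⟩ := isomorphic_ofEnds_iff.1 h
  have hlen : L.length = m := by simpa using congrArg List.length hL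
  have hmem : ∀ z ∈ L, z.1 < n ∧ z.2 < n := fun z hz => by
    obtain ⟨i, hi, rfl⟩ := List.mem_iff_getElem.1 hz
    have hz : L[i].1 ∈ List.range n ∧ L[i].2 ∈ List.range n := by
      rw [mem_iff_unoriented, unoriented_getElem hL (by omega)]
      simp
    simpa using hz
  have hval : ∀ a < n, (Fin.ofNat n a : ℕ) = a := fun a ha => Nat.mod_eq_of_lt ha
  refine ⟨fun a => x (Fin.ofNat n a), List.ofFn fun i => (y i : β), ?_, ?_, ?_, ?_, ?_, ?_⟩
  · intro a ha b hb hab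
    have hab := congrArg Fin.val (x.injective (Subtype.ext hab))
    rwa [hval a (List.mem_range.1 ha), hval b (List.mem_range.1 hb)] at hab
  · ext u
    refine ⟨fun hu => ⟨x.symm ⟨u, hu⟩, by simp, by simp⟩, ?_⟩
    rintro ⟨a, -, rfl⟩
    exact (x _).2
  · exact List.nodup_ofFn.2 (Subtype.val_injective.comp y.injective)
  · ext f
    rw [mem_ofPred_eq, List.mem_ofFn]
    refine ⟨fun hf => ⟨y.symm ⟨f, hf⟩, by simp⟩, ?_⟩
    rintro ⟨i, rfl⟩
    exact (y i).2
  · refine List.forall₂_iff_get.2 ⟨by simp [hlen], fun i hi hi' => ?_⟩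
    rw [List.get_ofFn]
    refine (h _ _ _).2 (Sym2.map.injective Fin.val_injective ?_)
    obtain ⟨h₁, h₂⟩ := hmem _ (List.getElem_mem hi')
    rw [Sym2.map_mk, List.get_eq_getElem, hval _ h₁, hval _ h₂]
    exact (unoriented_getElem hL (by omega) hi').symm
  · simpa using hmem

end Isomorphic

/-! ### Extending drawings -/

/-- The vertex `p` occurs on the path `d`, first at a position which is not the first or last. -/
def Inner (p : ℕ) (d : List ℕ) : Prop := 0 < d.idxOf p ∧ d.idxOf p + 1 < d.length

instance (p : ℕ) (d : List ℕ) : Decidable (Inner p d) := inferInstanceAs (Decidable (_ ∧ _))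

section Inner

variable {p q : ℕ} {d : List ℕ}

theorem Inner.mem (h : Inner p d) : p ∈ d :=
  List.idxOf_lt_length_iff.1 (by have := h.2; omega)

theorem Inner.exists_append (h : Inner p d) :
    ∃ l r, d = l ++ p :: r ∧ l ≠ [] ∧ r ≠ [] ∧ d.take (d.idxOf p + 1) = l ++ [p] ∧
      d.drop (d.idxOf p) = p :: r := by
  obtain ⟨l, r, rfl, hl⟩ := List.eq_append_cons_of_mem h.mem
  have hidx : (l ++ p :: r).idxOf p = l.length := by
    rw [List.idxOf_append_of_notMem hl, List.idxOf_cons_self, add_zero]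
  obtain ⟨hpos, hlt⟩ := h
  rw [hidx] at hpos hlt
  refine ⟨l, r, rfl, List.length_pos_iff.1 hpos, ?_, ?_, ?_⟩
  · rintro rfl
    simp at hlt
  · rw [hidx, List.take_append]
    simp
  · rw [hidx, List.drop_left]

theorem Inner.take (hq : Inner q d) (hp : Inner p d) (h : d.idxOf q < d.idxOf p) :
    Inner q (d.take (d.idxOf p + 1)) := by
  have hmem : q ∈ d.take (d.idxOf p + 1) := by
    rw [List.mem_take_iff_idxOf_lt hq.mem]
    omega
  have hidx : d.idxOf q = (d.take (d.idxOf p + 1)).idxOf q := by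
    nth_rewrite 1 [← List.take_append_drop (d.idxOf p + 1) d]
    exact List.idxOf_append_of_mem hmem
  refine ⟨hidx ▸ hq.1, ?_⟩
  rw [← hidx, List.length_take]
  have := hp.2
  omega

theorem Inner.drop (hq : Inner q d) (h : d.idxOf p < d.idxOf q) :
    Inner q (d.drop (d.idxOf p)) := by
  have hmem : q ∉ d.take (d.idxOf p) := by
    rw [List.mem_take_iff_idxOf_lt hq.mem]
    omega
  have hidx : d.idxOf q = min (d.idxOf p) d.length + (d.drop (d.idxOf p)).idxOf q := by
    nth_rewrite 1 [← List.take_append_drop (d.idxOf p) d]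
    rw [List.idxOf_append_of_notMem hmem, List.length_take]
  have := hq.2
  rw [min_eq_left (by omega)] at hidx
  refine ⟨by omega, ?_⟩
  rw [List.length_drop]
  omega

end Inner

/-- Cut the path number `i` of `D` at its vertex `p`. -/
def splitPath (D : List (List ℕ)) (i p : ℕ) : List (List ℕ) :=
  D.set i ((D.getD i []).take ((D.getD i []).idxOf p + 1)) ++
    [(D.getD i []).drop ((D.getD i []).idxOf p)]

section SplitPath

variable {M : Mesh} {V : List ℕ} {D : List (List ℕ)} {i j p : ℕ}

theorem length_splitPath : (splitPath D i p).length = D.length + 1 := by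
  simp [splitPath]

theorem getD_splitPath_of_ne (hij : i ≠ j) (hj : j < D.length) :
    (splitPath D i p).getD j [] = D.getD j [] := by
  rw [splitPath, List.getD_append _ _ _ _ (by simpa using hj)]
  simp [hj, hij]

theorem getD_splitPath_self (hi : i < D.length) :
    (splitPath D i p).getD i [] = (D.getD i []).take ((D.getD i []).idxOf p + 1) := by
  rw [splitPath, List.getD_append _ _ _ _ (by simpa using hi)]
  simp [hi]

theorem getD_splitPath_length :
    (splitPath D i p).getD D.length [] = (D.getD i []).drop ((D.getD i []).idxOf p) := by
  rw [splitPath, List.getD_append_right _ _ _ _ (by simp)]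
  simp

theorem lt_length_of_inner (hp : Inner p (D.getD i [])) : i < D.length := by
  by_contra hi
  rw [List.getD_eq_default _ _ (not_lt.1 hi)] at hp
  simpa using hp.mem

theorem allPieces_splitPath (V : List ℕ) (hp : Inner p (D.getD i [])) :
    (allPieces (V ++ [p]) (splitPath D i p)).Perm (allPieces V D) := by
  have hi := lt_length_of_inner hp
  obtain ⟨l, r, hd, hl, hr, htake, hdrop⟩ := hp.exists_append
  rw [splitPath, htake, hdrop]
  rw [List.getD_eq_getElem _ _ hi] at hd
  have hD : D = D.take i ++ (l ++ p :: r) :: D.drop (i + 1) := by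
    rw [← hd, List.getElem_cons_drop, List.take_append_drop]
  rw [List.set_eq_take_append_cons_drop, if_pos hi]
  nth_rewrite 3 [hD]
  rw [List.perm_iff_count]
  intro z
  simp only [allPieces, List.map_append, List.flatMap_append, List.flatMap_cons,
    List.flatMap_nil, pieces_append hl hr, List.count_append, List.count_cons, List.map_cons,
    List.map_nil, List.count_nil]
  omega

theorem Drawn.splitPath (h : Drawn M V D) (hp : Inner p (D.getD i [])) :
    Drawn M (V ++ [p]) (splitPath D i p) := by
  have hperm := allPieces_splitPath V hp
  refine ⟨hperm.nodup_iff.2 h.nodup, fun z hz => h.hasPiece z (hperm.mem_iff.1 hz), ?_⟩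
  intro d hd
  obtain ⟨hpos, hlt⟩ := hp
  rcases List.mem_append.1 hd with hd | hd
  · rcases List.mem_or_eq_of_mem_set hd with hd | rfl
    · exact h.two_le d hd
    · rw [List.length_take]
      omega
  · obtain rfl := List.mem_singleton.1 hd
    rw [List.length_drop]
    omega

theorem map_ends_splitPath (hp : Inner p (D.getD i [])) :
    (splitPath D i p).map ends = subdivide (D.map ends) i p := by
  have hi := lt_length_of_inner hp
  obtain ⟨l, r, hd, hl, hr, htake, hdrop⟩ := hp.exists_append
  have hends : (D.map ends).getD i (0, 0) = ends (l ++ p :: r) := by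
    rw [← hd]
    simp [hi]
  rw [splitPath, htake, hdrop, subdivide, hends]
  obtain ⟨a, l, rfl⟩ := List.exists_cons_of_ne_nil hl
  obtain ⟨c, r, rfl⟩ := List.exists_cons_of_ne_nil hr
  rw [List.map_append, List.map_set]
  simp [ends, List.getLast?_cons, List.getLast?_append]

end SplitPath

section Drawn

variable {X : Type*} [TopologicalSpace X] {M M' : Mesh} {V V' : List ℕ} {D D' : List (List ℕ)}

theorem Mesh.HasPiece.chord {z : Sym2 ℕ} (h : M.HasPiece z) (k m : ℕ) (l₁ : List ℕ) (p : ℕ)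
    (l₂ : List ℕ) (q : ℕ) (l₃ : List ℕ) : (M.chord k m l₁ p l₂ q l₃).HasPiece z := by
  rcases h with h | ⟨a, ha, rfl⟩
  · exact Or.inl (List.mem_append_left _ h)
  · exact Or.inr ⟨a, ha.trans_le (Nat.le_add_right _ _), rfl⟩

theorem Mesh.Realizable.lt_size (hM : M.Realizable X) {z : Sym2 ℕ} (hz : M.HasPiece z) {a : ℕ}
    (ha : a ∈ z) : a < M.size := by
  obtain ⟨vert, lab, hs, -⟩ := hM
  exact Mesh.HasPiece.lt_size hs hz ha

theorem Drawn.nodup_vertices (h : Drawn M V D) : V.Nodup :=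
  List.Nodup.of_map _ (List.nodup_append.1 h.nodup).1

theorem Drawn.hasPiece_of_inner (h : Drawn M V D) {i p : ℕ} (hp : Inner p (D.getD i [])) :
    M.HasPiece s(p, p) :=
  (h.splitPath hp).hasPiece s(p, p) (by simp [allPieces])

theorem Drawn.append (h : Drawn M V D) (hM : M.Realizable X)
    (hpieces : ∀ z, M.HasPiece z → M'.HasPiece z) (hnodup : (allPieces V' D').Nodup)
    (hnew : ∀ z ∈ allPieces V' D', M'.HasPiece z ∧ ∃ a ∈ z, M.size ≤ a)
    (hlength : ∀ l ∈ D', 2 ≤ l.length) : Drawn M' (V ++ V') (D ++ D') := by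
  have hperm : (allPieces (V ++ V') (D ++ D')).Perm (allPieces V D ++ allPieces V' D') := by
    rw [List.perm_iff_count]
    intro z
    simp only [allPieces, List.map_append, List.flatMap_append, List.count_append]
    omega
  refine ⟨hperm.nodup_iff.2 (List.nodup_append.2 ⟨h.nodup, hnodup, ?_⟩), fun z hz => ?_,
    fun l hl => (List.mem_append.1 hl).elim (h.two_le l) (hlength l)⟩
  · rintro z hz _ hz' rfl
    obtain ⟨a, ha, hle⟩ := (hnew z hz').2
    exact (hM.lt_size (h.hasPiece z hz) ha).not_ge hle
  · rcases List.mem_append.1 (hperm.mem_iff.1 hz) with hz | hz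
    · exact hpieces z (h.hasPiece z hz)
    · exact (hnew z hz).1

theorem Drawn.append_path (h : Drawn M V D) (hM : M.Realizable X) {k m p q : ℕ}
    {l₁ l₂ l₃ : List ℕ} (hm : 0 < m) (hp : p < M.size) (hq : q < M.size) (hpq : p ≠ q) :
    Drawn (M.chord k m l₁ p l₂ q l₃) V (D ++ [path M.size m p q]) := by
  have hnodup : (path M.size m p q).Nodup := by
    have hinner : (List.range' M.size m ++ [q]).Nodup :=
      List.Nodup.append List.nodup_range' (List.nodup_singleton q) (by simp; omega)
    exact List.nodup_cons.2 ⟨by simp; omega, hinner⟩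
  rw [← List.append_nil V]
  refine h.append hM (fun z hz => hz.chord ..) ?_ (fun z hz => ⟨?_, ?_⟩) (by simp [length_path])
  · simpa [allPieces] using nodup_pieces hnodup
  all_goals
    replace hz : z ∈ pieces (path M.size m p q) := by simpa [allPieces] using hz
  · rcases mem_links_or_mem_of_mem_pieces hz with hz | ⟨a, ha, rfl⟩
    · exact Or.inl (List.mem_append_right _ hz)
    · refine Or.inr ⟨a, ?_, rfl⟩
      simp only [path, List.mem_cons, List.mem_append, List.mem_range'_1, List.not_mem_nil,
        or_false] at ha
      simp only [Mesh.chord]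
      omega
  · obtain ⟨a, haz, ha⟩ := exists_inner_mem_of_mem_pieces (by simp; omega) hz
    exact ⟨a, haz, (List.mem_range'_1.1 ha).1⟩

theorem pieces_reverse (l : List ℕ) : (pieces l.reverse).Perm (pieces l) := by
  induction l with
  | nil => rfl
  | cons a l ih =>
    match l with
    | [] => rfl
    | [b] => simp [pieces, Sym2.eq_swap]
    | b :: c :: t =>
      rw [List.reverse_cons, List.reverse_cons, List.append_assoc, List.singleton_append,
        pieces_append (by simp) (by simp), ← List.reverse_cons]
      simp only [pieces]
      refine List.perm_append_comm.trans ?_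
      rw [Sym2.eq_swap (a := b) (b := a)]
      simp only [List.cons_append, List.nil_append]
      exact (List.Perm.swap _ _ _).trans ((ih.cons _).cons _)

/-- List paths of `D`: those with the given indices, reversed where the flag is set. -/
def selectPaths (D : List (List ℕ)) (js : List (ℕ × Bool)) : List (List ℕ) :=
  js.map fun z => if z.2 then (D.getD z.1 []).reverse else D.getD z.1 []

theorem flatMap_pieces_selectPaths {js : List (ℕ × Bool)}
    (hjs : (js.map Prod.fst).Perm (List.range D.length)) :
    ((selectPaths D js).flatMap pieces).Perm (D.flatMap pieces) := by
  have hflags : ((selectPaths D js).flatMap pieces).Perm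
      (((js.map Prod.fst).map (D.getD · [])).flatMap pieces) := by
    rw [selectPaths, List.flatMap_map, List.map_map, List.flatMap_map]
    refine List.Perm.flatMap_left _ fun z _ => ?_
    dsimp only [comp_apply]
    split_ifs
    · exact pieces_reverse _
    · rfl
  nth_rewrite 2 [← map_getD_range D []]
  exact hflags.trans ((hjs.map _).flatMap_right _)

theorem Drawn.selectPaths (h : Drawn M V D) {js : List (ℕ × Bool)} (hV : V'.Perm V)
    (hjs : (js.map Prod.fst).Perm (List.range D.length)) :
    Drawn M V' (selectPaths D js) := by
  have hperm : (allPieces V' (CubicTorus.selectPaths D js)).Perm (allPieces V D) :=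
    (hV.map _).append (flatMap_pieces_selectPaths hjs)
  refine ⟨hperm.nodup_iff.2 h.nodup, fun z hz => h.hasPiece z (hperm.mem_iff.1 hz), ?_⟩
  intro l hl
  obtain ⟨z, hz, rfl⟩ := List.mem_map.1 hl
  have hlt : z.1 < D.length := List.mem_range.1 (hjs.mem_iff.1 (List.mem_map_of_mem hz))
  have hle := h.two_le _ (List.getElem_mem hlt)
  rw [List.getD_eq_getElem _ _ hlt]
  split_ifs <;> simpa

end Drawn

/-! ### Torus drawings of edge lists -/

section AddEdges

variable {L : List (ℕ × ℕ)} {i j p q n : ℕ}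

theorem map_subdivide (f : ℕ → ℕ) (hi : i < L.length) :
    (subdivide L i p).map (Prod.map f f) = subdivide (L.map (Prod.map f f)) i (f p) := by
  simp [subdivide, List.map_set, hi]

theorem map_addChord (f : ℕ → ℕ) (hi : i < L.length) (hj : j < L.length + 1) :
    (addChord L i j p q).map (Prod.map f f) =
      addChord (L.map (Prod.map f f)) i j (f p) (f q) := by
  rw [addChord, addChord, List.map_append, map_subdivide f (by rwa [length_subdivide]),
    map_subdivide f hi]
  rfl

theorem map_addLoop (f : ℕ → ℕ) (hi : i < L.length) :
    (addLoop L i p q).map (Prod.map f f) = addLoop (L.map (Prod.map f f)) i (f p) (f q) := by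
  simp [addLoop, map_subdivide f hi]

theorem lt_of_mem_subdivide (hi : i < L.length) (hp : p < n) (hL : ∀ z ∈ L, z.1 < n ∧ z.2 < n) :
    ∀ z ∈ subdivide L i p, z.1 < n ∧ z.2 < n := by
  intro z hz
  have hmem := hL _ (List.getElem_mem hi)
  simp only [subdivide, List.getD_eq_getElem _ _ hi, List.mem_append, List.mem_singleton] at hz
  rcases hz with hz | rfl
  · rcases List.mem_or_eq_of_mem_set hz with hz | rfl
    · exact hL z hz
    · exact ⟨hmem.1, hp⟩
  · exact ⟨hp, hmem.2⟩

theorem lt_of_mem_addChord (hi : i < L.length) (hj : j < L.length + 1)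
    (hL : ∀ z ∈ L, z.1 < n ∧ z.2 < n) :
    ∀ z ∈ addChord L i j n (n + 1), z.1 < n + 2 ∧ z.2 < n + 2 := by
  have hL' : ∀ z ∈ L, z.1 < n + 2 ∧ z.2 < n + 2 := fun z hz => by have := hL z hz; omega
  intro z hz
  rcases List.mem_append.1 hz with hz | hz
  · exact lt_of_mem_subdivide (by rwa [length_subdivide]) (by omega)
      (lt_of_mem_subdivide hi (by omega) hL') z hz
  · obtain rfl := List.mem_singleton.1 hz
    exact ⟨by simp, by simp⟩

theorem lt_of_mem_addLoop (hi : i < L.length) (hL : ∀ z ∈ L, z.1 < n ∧ z.2 < n) :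
    ∀ z ∈ addLoop L i n (n + 1), z.1 < n + 2 ∧ z.2 < n + 2 := by
  have hL' : ∀ z ∈ L, z.1 < n + 2 ∧ z.2 < n + 2 := fun z hz => by have := hL z hz; omega
  intro z hz
  simp only [addLoop, List.mem_append, List.mem_singleton] at hz
  rcases hz with (hz | rfl) | rfl
  · exact lt_of_mem_subdivide hi (by omega) hL' z hz
  all_goals exact ⟨by simp, by simp⟩

end AddEdges

/-- The vertices `vs` and the paths `D` of `M` form a drawing on the torus of the graph with the
edge list `L`, in which the vertex `a` is drawn at the vertex number `a` of `vs`. -/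
structure Draws (M : Mesh) (vs : List ℕ) (D : List (List ℕ)) (L : List (ℕ × ℕ)) : Prop where
  realizable : M.Realizable (UnitAddCircle × UnitAddCircle)
  drawn : Drawn M vs D
  ends_eq : D.map ends = L.map (Prod.map (vs.getD · 0) (vs.getD · 0))
  lt_length : ∀ z ∈ L, z.1 < vs.length ∧ z.2 < vs.length

section Draws

variable {M M' : Mesh} {vs : List ℕ} {D D' : List (List ℕ)} {L : List (ℕ × ℕ)} {n i j p q : ℕ}

theorem Draws.length_eq (h : Draws M vs D L) : D.length = L.length := by
  simpa using congrArg List.length h.ends_eq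

theorem Draws.toroidal {α β : Type*} {K : Graph α β} {v : ℕ → α} {es : List β}
    (h : Draws M vs D L) (hK : Presents K v es (List.range vs.length) L) : Toroidal K := by
  have hvs : (List.range vs.length).map (vs.getD · 0) = vs := map_getD_range vs 0
  have hinj : InjOn (vs.getD · 0) {a | a ∈ List.range vs.length} :=
    List.inj_on_of_nodup_map (hvs.symm ▸ h.drawn.nodup_vertices)
  have hpresents := hK.map hinj
  rw [hvs, ← h.ends_eq] at hpresents
  exact h.drawn.nonempty_embedding h.realizable hpresents

theorem Draws.map_map_getD_append (h : Draws M vs D L) :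
    L.map (Prod.map ((vs ++ [p] ++ [q]).getD · 0) ((vs ++ [p] ++ [q]).getD · 0)) = D.map ends := by
  rw [h.ends_eq]
  have hgetD : ∀ a < vs.length, (vs ++ [p] ++ [q]).getD a 0 = vs.getD a 0 := fun a ha => by
    rw [List.append_assoc, List.getD_append _ _ _ _ ha]
  refine List.map_congr_left fun z hz => ?_
  simp only [Prod.map, hgetD _ (h.lt_length z hz).1, hgetD _ (h.lt_length z hz).2]

theorem Draws.addChord_of_ends_eq (h : Draws M vs D L) (hn : vs.length = n) (hi : i < L.length)
    (hj : j < L.length + 1) (hM' : M'.Realizable (UnitAddCircle × UnitAddCircle))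
    (hD' : Drawn M' (vs ++ [p] ++ [q]) D')
    (hends : D'.map ends = addChord (D.map ends) i j p q) :
    Draws M' (vs ++ [p] ++ [q]) D' (addChord L i j n (n + 1)) := by
  subst hn
  refine ⟨hM', hD', ?_, by simpa using lt_of_mem_addChord hi hj h.lt_length⟩
  rw [hends, map_addChord _ hi hj, h.map_map_getD_append]
  simp

theorem Draws.addLoop_of_ends_eq (h : Draws M vs D L) (hn : vs.length = n) (hi : i < L.length)
    (hM' : M'.Realizable (UnitAddCircle × UnitAddCircle))
    (hD' : Drawn M' (vs ++ [p] ++ [q]) D') (hends : D'.map ends = addLoop (D.map ends) i p q) :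
    Draws M' (vs ++ [p] ++ [q]) D' (addLoop L i n (n + 1)) := by
  subst hn
  refine ⟨hM', hD', ?_, by simpa using lt_of_mem_addLoop hi h.lt_length⟩
  rw [hends, map_addLoop _ hi, h.map_map_getD_append]
  simp

end Draws

/-- Draw a chord, with `m` new vertices on it, through the cell `k`, from its vertex number `a` to
its vertex number `b`. -/
def Mesh.chordAt (M : Mesh) (k a b m : ℕ) : Mesh :=
  M.chord k m ((M.cells.getD k []).take a) ((M.cells.getD k []).getD a 0)
    (((M.cells.getD k []).drop (a + 1)).take (b - (a + 1))) ((M.cells.getD k []).getD b 0)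
    ((M.cells.getD k []).drop (b + 1))

/-- Draw a loop, joined by a path to the vertex number `a` of the cell `k`: a chord from this vertex
to the vertex number `b`, and a second path between two inner vertices of the chord. -/
def Mesh.lollipop (M : Mesh) (k a b : ℕ) : Mesh :=
  (M.chordAt k a b 7).chord M.cells.length 2
    ((M.cells.getD k []).take a ++ [(M.cells.getD k []).getD a 0, M.size, M.size + 1])
    (M.size + 2) [M.size + 3, M.size + 4] (M.size + 5)
    ((M.size + 6) :: (M.cells.getD k []).getD b 0 :: (M.cells.getD k []).drop (b + 1))

section Chord

variable {M : Mesh} {vs : List ℕ} {D : List (List ℕ)} {L : List (ℕ × ℕ)} {n i j k a b m p q : ℕ}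

theorem eq_take_append_getD_cons {c : List ℕ} (hab : a < b) (hb : b < c.length) :
    c = c.take a ++ c.getD a 0 :: ((c.drop (a + 1)).take (b - (a + 1)) ++
      c.getD b 0 :: c.drop (b + 1)) := by
  have hdrop : c.drop (b + 1) = (c.drop (a + 1)).drop (b - (a + 1) + 1) := by
    rw [List.drop_drop]
    congr 1
    omega
  have hget : c.getD b 0 = (c.drop (a + 1))[b - (a + 1)]'(by simp; omega) := by
    rw [List.getD_eq_getElem _ _ hb, List.getElem_drop]
    congr 1
    omega
  rw [hdrop, hget, List.getElem_cons_drop, List.take_append_drop,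
    List.getD_eq_getElem _ _ (hab.trans hb), List.getElem_cons_drop, List.take_append_drop]

theorem getElem?_cells_eq (hab : a < b) (hb : b < (M.cells.getD k []).length) :
    M.cells[k]? = some ((M.cells.getD k []).take a ++ (M.cells.getD k []).getD a 0 ::
      (((M.cells.getD k []).drop (a + 1)).take (b - (a + 1)) ++
        (M.cells.getD k []).getD b 0 :: (M.cells.getD k []).drop (b + 1))) := by
  have hk : k < M.cells.length := by
    by_contra hk
    rw [List.getD_eq_default _ _ (not_lt.1 hk)] at hb
    exact absurd hb (Nat.not_lt_zero b)
  rw [← eq_take_append_getD_cons hab hb, List.getElem?_eq_getElem hk, List.getD_eq_getElem _ _ hk]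

theorem Mesh.Realizable.chordAt {X : Type*} [TopologicalSpace X] (h : M.Realizable X)
    (hab : a < b) (hb : b < (M.cells.getD k []).length) (hm : 0 < m)
    (hne : (M.cells.getD k []).getD a 0 ≠ (M.cells.getD k []).getD b 0) :
    (M.chordAt k a b m).Realizable X :=
  h.chord (getElem?_cells_eq hab hb) hm hne

theorem Mesh.Realizable.lollipop {X : Type*} [TopologicalSpace X] (h : M.Realizable X)
    (hab : a < b) (hb : b < (M.cells.getD k []).length)
    (hne : (M.cells.getD k []).getD a 0 ≠ (M.cells.getD k []).getD b 0) :
    (M.lollipop k a b).Realizable X :=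
  (h.chordAt hab hb (by omega) hne).chord
    (by simp [Mesh.chordAt, Mesh.chord, List.range']) (by omega) (by omega)

theorem Draws.chordAt (h : Draws M vs D L) (hn : vs.length = n) (hab : a < b)
    (hb : b < (M.cells.getD k []).length) (hm : 0 < m) (hp : (M.cells.getD k []).getD a 0 = p)
    (hq : (M.cells.getD k []).getD b 0 = q) (hpq : p ≠ q) (hpi : Inner p (D.getD i []))
    (hqj : Inner q ((splitPath D i p).getD j [])) :
    Draws (M.chordAt k a b m) (vs ++ [p] ++ [q])
      (splitPath (splitPath D i p) j q ++ [path M.size m p q]) (addChord L i j n (n + 1)) := by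
  have hi : i < L.length := h.length_eq ▸ lt_length_of_inner hpi
  have hj : j < L.length + 1 := by
    simpa only [length_splitPath, h.length_eq] using lt_length_of_inner hqj
  have hsplit := h.drawn.splitPath hpi
  have hpM := h.realizable.lt_size (h.drawn.hasPiece_of_inner hpi) (Sym2.mem_mk_left p p)
  have hqM := h.realizable.lt_size (hsplit.hasPiece_of_inner hqj) (Sym2.mem_mk_left q q)
  refine h.addChord_of_ends_eq hn hi hj (h.realizable.chordAt hab hb hm (by rwa [hp, hq])) ?_ ?_
  · rw [Mesh.chordAt, hp, hq]
    exact (hsplit.splitPath hqj).append_path h.realizable hm hpM hqM hpq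
  · rw [List.map_append, map_ends_splitPath hqj, map_ends_splitPath hpi, addChord]
    simp [ends, path, List.getLast?_cons]

theorem Drawn.lollipop {X : Type*} [TopologicalSpace X] (h : Drawn M vs D) (hM : M.Realizable X)
    (hp : (M.cells.getD k []).getD a 0 = p) (hpM : p < M.size) :
    Drawn (M.lollipop k a b) (vs ++ [M.size + 2])
      (D ++ [[p, M.size, M.size + 1, M.size + 2],
        [M.size + 2, M.size + 7, M.size + 8, M.size + 5, M.size + 4, M.size + 3, M.size + 2]]) := by
  refine h.append hM (fun z hz => (hz.chord ..).chord ..) ?_ ?_ (by simp)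
  · have hne : ∀ k, p ≠ M.size + k := fun k => by omega
    simp [allPieces, pieces, hne, hpM.ne]
  · subst hp
    simp [allPieces, pieces, Mesh.HasPiece, Mesh.lollipop, Mesh.chordAt, Mesh.chord, links, path,
      List.range', Nat.add_assoc]

theorem Draws.lollipop (h : Draws M vs D L) (hn : vs.length = n) (hab : a < b)
    (hb : b < (M.cells.getD k []).length) (hp : (M.cells.getD k []).getD a 0 = p)
    (hpb : p ≠ (M.cells.getD k []).getD b 0) (hpi : Inner p (D.getD i [])) :
    Draws (M.lollipop k a b) (vs ++ [p] ++ [M.size + 2])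
      (splitPath D i p ++ [[p, M.size, M.size + 1, M.size + 2],
        [M.size + 2, M.size + 7, M.size + 8, M.size + 5, M.size + 4, M.size + 3, M.size + 2]])
      (addLoop L i n (n + 1)) := by
  have hi : i < L.length := h.length_eq ▸ lt_length_of_inner hpi
  have hpM := h.realizable.lt_size (h.drawn.hasPiece_of_inner hpi) (Sym2.mem_mk_left p p)
  refine h.addLoop_of_ends_eq hn hi (h.realizable.lollipop hab hb (by rwa [hp]))
    ((h.drawn.splitPath hpi).lollipop h.realizable hp hpM) ?_
  rw [List.map_append, map_ends_splitPath hpi, addLoop]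
  simp [ends]

end Chord

/-- Some cell of `M` contains an inner vertex of `d` and a different inner vertex of `d'`. -/
def Mesh.Cofacial (M : Mesh) (d d' : List ℕ) : Prop :=
  ∃ c ∈ M.cells, ∃ p ∈ c, ∃ q ∈ c, p ≠ q ∧ Inner p d ∧ Inner q d'

section Cofacial

variable {M : Mesh} {vs d d' : List ℕ} {D : List (List ℕ)} {L : List (ℕ × ℕ)} {n i j : ℕ}

theorem Mesh.Cofacial.symm (h : M.Cofacial d d') : M.Cofacial d' d := by
  obtain ⟨c, hc, p, hp, q, hq, hpq, hpd, hqd'⟩ := h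
  exact ⟨c, hc, q, hq, p, hp, hpq.symm, hqd', hpd⟩

theorem Draws.exists_getD_cell (h : Draws M vs D L) {c : List ℕ} (hc : c ∈ M.cells) {p q : ℕ}
    (hp : p ∈ c) (hq : q ∈ c) (hpq : p ≠ q) :
    ∃ M' k a b, Draws M' vs D L ∧ a < b ∧ b < (M'.cells.getD k []).length ∧
      (M'.cells.getD k []).getD a 0 = p ∧ (M'.cells.getD k []).getD b 0 = q := by
  obtain ⟨k, hk⟩ := List.mem_iff_getElem?.1 hc
  obtain ⟨a, ha, rfl⟩ := List.mem_iff_getElem.1 hp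
  obtain ⟨b, hb, rfl⟩ := List.mem_iff_getElem.1 hq
  rcases lt_or_gt_of_ne (show a ≠ b by rintro rfl; exact hpq rfl) with hab | hba
  · exact ⟨M, k, a, b, h, hab, by simp [hk, hb], by simp [hk, ha], by simp [hk, hb]⟩
  · have hcell : (M.reverseCell k).cells[k]? = some c.reverse := by
      simp [Mesh.reverseCell, hk]
    refine ⟨M.reverseCell k, k, c.length - 1 - a, c.length - 1 - b,
      ⟨h.realizable.reverseCell k, ⟨h.drawn.nodup, h.drawn.hasPiece, h.drawn.two_le⟩, h.ends_eq,
        h.lt_length⟩, by omega, ?_, ?_, ?_⟩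
    · simp only [List.getD_eq_getElem?_getD, hcell, Option.getD_some, List.length_reverse]
      omega
    all_goals
      rw [List.getD_eq_getElem?_getD (l := (M.reverseCell k).cells), hcell, Option.getD_some,
        List.getD_eq_getElem _ _ (by rw [List.length_reverse]; omega), List.getElem_reverse]
      congr 1
      omega

theorem Mesh.Cofacial.exists_inner_splitPath (hi : i < D.length) (hj : j < D.length + 1)
    (h : M.Cofacial (D.getD i []) (D.getD (if j = D.length then i else j) [])) :
    ∃ c ∈ M.cells, ∃ p ∈ c, ∃ q ∈ c, p ≠ q ∧ Inner p (D.getD i []) ∧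
      Inner q ((splitPath D i p).getD j []) := by
  obtain ⟨c, hc, p, hp, q, hq, hpq, hpi, hqj⟩ := h
  have hidx : (D.getD i []).idxOf p ≠ (D.getD i []).idxOf q := fun h =>
    hpq ((List.idxOf_inj hpi.mem).1 h)
  rcases eq_or_ne j D.length with rfl | hjD
  · rw [if_pos rfl] at hqj
    rcases lt_or_gt_of_ne hidx with hlt | hlt
    · exact ⟨c, hc, p, hp, q, hq, hpq, hpi, getD_splitPath_length ▸ hqj.drop hlt⟩
    · exact ⟨c, hc, q, hq, p, hp, hpq.symm, hqj, getD_splitPath_length ▸ hpi.drop hlt⟩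
  have hjlt : j < D.length := lt_of_le_of_ne (Nat.lt_succ_iff.1 hj) hjD
  rw [if_neg hjD] at hqj
  rcases eq_or_ne i j with rfl | hij
  · rcases lt_or_gt_of_ne hidx with hlt | hlt
    · exact ⟨c, hc, q, hq, p, hp, hpq.symm, hqj, getD_splitPath_self hi ▸ hpi.take hqj hlt⟩
    · exact ⟨c, hc, p, hp, q, hq, hpq, hpi, getD_splitPath_self hi ▸ hqj.take hpi hlt⟩
  · exact ⟨c, hc, p, hp, q, hq, hpq, hpi, (getD_splitPath_of_ne hij hjlt).symm ▸ hqj⟩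

variable {α β : Type*} {K : Graph α β} {v : ℕ → α} {es : List β}

theorem Draws.toroidal_addChord (h : Draws M vs D L) (hn : vs.length = n) (hi : i < L.length)
    (hj : j < L.length + 1)
    (hK : Presents K v es (List.range (n + 2)) (addChord L i j n (n + 1)))
    (hc : M.Cofacial (D.getD i []) (D.getD (if j = L.length then i else j) [])) :
    Toroidal K := by
  rw [← h.length_eq] at hi hj hc
  obtain ⟨c, hc, p, hp, q, hq, hpq, hpi, hqj⟩ := hc.exists_inner_splitPath hi hj
  obtain ⟨M', k, a, b, h', hab, hb, hpa, hqb⟩ := h.exists_getD_cell hc hp hq hpq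
  exact (h'.chordAt hn hab hb one_pos hpa hqb hpq hpi hqj).toroidal (by simpa [hn] using hK)

theorem Draws.toroidal_addLoop (h : Draws M vs D L) (hn : vs.length = n)
    (hK : Presents K v es (List.range (n + 2)) (addLoop L i n (n + 1)))
    (hc : M.Cofacial (D.getD i []) (D.getD i [])) : Toroidal K := by
  obtain ⟨c, hc, p, hp, q, hq, hpq, hpi, -⟩ := hc
  obtain ⟨M', k, a, b, h', hab, hb, hpa, hqb⟩ := h.exists_getD_cell hc hp hq hpq
  exact (h'.lollipop hn hab hb hpa (hqb ▸ hpq) hpi).toroidal (by simpa [hn] using hK)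

end Cofacial

/-! ### Torus drawings of `G₁` -/

/-- A mesh with chosen vertices and paths, by which a graph is to be drawn. -/
structure Picture where
  /-- The mesh in which the graph is drawn. -/
  mesh : Mesh
  /-- The vertices of the mesh at which the vertices of the graph are drawn. -/
  vertices : List ℕ
  /-- The paths of the mesh along which the edges of the graph are drawn. -/
  paths : List (List ℕ)

/-- The picture is a drawing on the torus of the graph with the edge list `L`. -/
def Picture.IsDrawing (P : Picture) (L : List (ℕ × ℕ)) : Prop :=
  Draws P.mesh P.vertices P.paths L

/-- The edge list of `G₁`. -/
def edgesG1 : List (ℕ × ℕ) :=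
  [(0, 3), (1, 4), (2, 5), (0, 6), (0, 7), (1, 6), (1, 7), (2, 6), (2, 7),
    (3, 8), (3, 9), (4, 8), (4, 9), (5, 8), (5, 9)]

/-- A mesh on the torus that contains `G₁`, with eight additional vertices on every edge: a theta
graph with four chords. -/
def meshG1 : Mesh :=
  ((((theta 8 44 44).chordAt 0 36 63 8).chordAt 1 54 99 8).chordAt 2 27 108 8).chordAt 3 18 45 8

/-- The vertices of `meshG1` that represent the vertices of `G₁`. -/
def verticesG1 : List ℕ := [0, 36, 71, 1, 27, 80, 62, 45, 89, 18]

/-- The paths of `meshG1` that represent the edges of `G₁`. -/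
def pathsG1 : List (List ℕ) :=
  [path 2 8 0 1, (path 28 8 27 36).reverse, path 72 8 71 80,
    path 54 8 0 62, (path 46 8 45 0).reverse, path 98 8 36 62, path 37 8 36 45,
    (path 63 8 62 71).reverse, path 106 8 71 45,
    (path 90 8 89 1).reverse, path 10 8 1 18, path 114 8 27 89, (path 19 8 18 27).reverse,
    path 81 8 80 89, (path 122 8 18 80).reverse]

theorem realizable_meshG1 : meshG1.Realizable (UnitAddCircle × UnitAddCircle) := by
  refine ((((theta_realizable (by norm_num) (by norm_num) (by norm_num)).chordAt ?_ ?_ ?_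
    ?_).chordAt ?_ ?_ ?_ ?_).chordAt ?_ ?_ ?_ ?_).chordAt ?_ ?_ ?_ ?_ <;> decide +kernel

theorem drawn_meshG1 : Drawn meshG1 verticesG1 pathsG1 := by
  have hnodup : ((allPieces verticesG1 pathsG1).map pairCode).Nodup := by decide +kernel
  have hvertices : ∀ a ∈ verticesG1, a < meshG1.size := by decide +kernel
  have hpaths : ∀ d ∈ pathsG1, ∀ a ∈ d, a < meshG1.size := by decide +kernel
  have hlinks : ∀ d ∈ pathsG1, ∀ z ∈ links d, z ∈ meshG1.arcs := by decide +kernel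
  refine ⟨hnodup.of_map, fun z hz => ?_, by decide⟩
  rcases List.mem_append.1 hz with hz | hz
  · obtain ⟨a, ha, rfl⟩ := List.mem_map.1 hz
    exact Or.inr ⟨a, hvertices a ha, rfl⟩
  · obtain ⟨d, hd, hz⟩ := List.mem_flatMap.1 hz
    rcases mem_links_or_mem_of_mem_pieces hz with hz | ⟨a, ha, rfl⟩
    · exact Or.inl (hlinks d hd z hz)
    · exact Or.inr ⟨a, hpaths d hd a ha, rfl⟩

/-- The automorphisms of `G₁`, as lists of values. -/
def symmetriesG1 : List (List ℕ) :=
  [[0, 1, 2], [0, 2, 1], [1, 0, 2], [1, 2, 0], [2, 0, 1], [2, 1, 0]].flatMap fun w =>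
    [[6, 7], [7, 6]].flatMap fun s => [[8, 9], [9, 8]].flatMap fun t =>
      [w ++ w.map (· + 3) ++ s ++ t, w.map (· + 3) ++ w ++ t ++ s]

/-- The index of the image under `τ` of an edge of `G₁`. -/
def imageIndex (τ : List ℕ) (z : ℕ × ℕ) : ℕ :=
  edgesG1.findIdx fun w => w = imagePair τ z ∨ w.swap = imagePair τ z

/-- The drawing of `G₁` relabelled by the automorphism `τ`. A path is reversed if `τ` takes the
edge drawn along it to an edge that is listed with the opposite orientation. -/
def pictureG1 (τ : List ℕ) : Picture where
  mesh := meshG1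
  vertices := τ.map (verticesG1.getD · 0)
  paths := selectPaths pathsG1 (edgesG1.map fun z =>
    (imageIndex τ z, decide ((imagePair τ z).2 < (imagePair τ z).1)))

theorem perm_of_mem_symmetriesG1 : ∀ τ ∈ symmetriesG1, τ.Perm (List.range 10) := by
  decide +kernel

theorem length_vertices_pictureG1 {τ : List ℕ} (hτ : τ ∈ symmetriesG1) :
    (pictureG1 τ).vertices.length = 10 := by
  simpa [pictureG1] using (perm_of_mem_symmetriesG1 τ hτ).length_eq

theorem pictureG1_isDrawing {τ : List ℕ} (hτ : τ ∈ symmetriesG1) :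
    (pictureG1 τ).IsDrawing edgesG1 := by
  have hindices : ∀ τ ∈ symmetriesG1,
      (edgesG1.map (imageIndex τ)).Perm (List.range pathsG1.length) := by decide +kernel
  have hends : ∀ τ ∈ symmetriesG1, (pictureG1 τ).paths.map ends = edgesG1.map
      (Prod.map ((pictureG1 τ).vertices.getD · 0) ((pictureG1 τ).vertices.getD · 0)) := by
    decide +kernel
  have hlt : ∀ z ∈ edgesG1, z.1 < 10 ∧ z.2 < 10 := by decide
  refine ⟨realizable_meshG1, drawn_meshG1.selectPaths ?_ ?_, hends τ hτ,
    by rwa [length_vertices_pictureG1 hτ]⟩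
  · exact (perm_of_mem_symmetriesG1 τ hτ).map _
  · rw [List.map_map]
    exact hindices τ hτ

/-! ### Adding an edge to a picture -/

section Picture

variable {P : Picture} {L : List (ℕ × ℕ)} {n i j k a b : ℕ}

/-- Draw a new edge through the cell `k`, from its vertex number `a`, which lies on the path `i`,
to its vertex number `b`, which lies on the path `j`. -/
def Picture.addChord (P : Picture) (i j k a b : ℕ) : Picture :=
  let p := (P.mesh.cells.getD k []).getD a 0
  let q := (P.mesh.cells.getD k []).getD b 0
  { mesh := P.mesh.chordAt k a b 2
    vertices := P.vertices ++ [p] ++ [q]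
    paths := splitPath (splitPath P.paths i p) j q ++ [path P.mesh.size 2 p q] }

/-- The conditions under which `Picture.addChord` is a drawing. -/
def Picture.CanAddChord (P : Picture) (i j k a b : ℕ) : Prop :=
  let p := (P.mesh.cells.getD k []).getD a 0
  let q := (P.mesh.cells.getD k []).getD b 0
  a < b ∧ b < (P.mesh.cells.getD k []).length ∧ p ≠ q ∧ Inner p (P.paths.getD i []) ∧
    Inner q ((splitPath P.paths i p).getD j [])

instance (P : Picture) (i j k a b : ℕ) : Decidable (P.CanAddChord i j k a b) :=
  inferInstanceAs (Decidable (_ ∧ _))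

theorem Picture.length_vertices_addChord :
    (P.addChord i j k a b).vertices.length = P.vertices.length + 2 := by
  simp [Picture.addChord]

theorem Picture.IsDrawing.addChord (h : P.IsDrawing L) (hn : P.vertices.length = n)
    (hP : P.CanAddChord i j k a b) :
    (P.addChord i j k a b).IsDrawing (CubicTorus.addChord L i j n (n + 1)) := by
  obtain ⟨hab, hb, hpq, hpi, hqj⟩ := hP
  exact Draws.chordAt h hn hab hb two_pos rfl rfl hpq hpi hqj

/-- Draw a new loop in the cell `k`, joined by a new edge to the vertex number `a` of the cell,
which lies on the path `i`. -/
def Picture.addLoop (P : Picture) (i k a : ℕ) : Picture :=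
  let p := (P.mesh.cells.getD k []).getD a 0
  let s := P.mesh.size
  { mesh := P.mesh.lollipop k a (a + 1)
    vertices := P.vertices ++ [p] ++ [s + 2]
    paths := splitPath P.paths i p ++
      [[p, s, s + 1, s + 2], [s + 2, s + 7, s + 8, s + 5, s + 4, s + 3, s + 2]] }

/-- The conditions under which `Picture.addLoop` is a drawing. -/
def Picture.CanAddLoop (P : Picture) (i k a : ℕ) : Prop :=
  let p := (P.mesh.cells.getD k []).getD a 0
  a + 1 < (P.mesh.cells.getD k []).length ∧ p ≠ (P.mesh.cells.getD k []).getD (a + 1) 0 ∧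
    Inner p (P.paths.getD i [])

instance (P : Picture) (i k a : ℕ) : Decidable (P.CanAddLoop i k a) :=
  inferInstanceAs (Decidable (_ ∧ _))

theorem Picture.length_vertices_addLoop :
    (P.addLoop i k a).vertices.length = P.vertices.length + 2 := by
  simp [Picture.addLoop]

theorem Picture.IsDrawing.addLoop (h : P.IsDrawing L) (hn : P.vertices.length = n)
    (hP : P.CanAddLoop i k a) :
    (P.addLoop i k a).IsDrawing (CubicTorus.addLoop L i n (n + 1)) := by
  obtain ⟨ha, hne, hpi⟩ := hP
  exact Draws.lollipop h hn a.lt_succ_self ha rfl hne hpi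

/-- The first inner vertex of the path `i` and the second inner vertex of the path `j` are different
vertices of a common cell. -/
def Picture.Meets (P : Picture) (i j : ℕ) : Prop :=
  let p := (P.paths.getD i []).getD 1 0
  let q := (P.paths.getD j []).getD 2 0
  p ≠ q ∧ Inner p (P.paths.getD i []) ∧ Inner q (P.paths.getD j []) ∧
    ∃ c ∈ P.mesh.cells, p ∈ c ∧ q ∈ c

instance (P : Picture) (i j : ℕ) : Decidable (P.Meets i j) := inferInstanceAs (Decidable (_ ∧ _))

theorem Picture.Meets.cofacial (h : P.Meets i j) :
    P.mesh.Cofacial (P.paths.getD i []) (P.paths.getD j []) := by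
  obtain ⟨hpq, hp, hq, c, hc, hpc, hqc⟩ := h
  exact ⟨c, hc, _, hpc, _, hqc, hpq, hp, hq⟩

end Picture

/-! ### Adding an edge to a graph with an atlas -/

theorem addChord_eq {L : List (ℕ × ℕ)} {i j : ℕ} (hij : i ≠ j) (hi : i < L.length)
    (hj : j < L.length) (p q : ℕ) :
    addChord L i j p q = (L.set i ((L.getD i (0, 0)).1, p)).set j ((L.getD j (0, 0)).1, q) ++
      [(p, (L.getD i (0, 0)).2), (q, (L.getD j (0, 0)).2), (p, q)] := by
  simp [addChord, subdivide, List.getElem?_append_left, List.set_append_left, hi, hj, hij]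

theorem addChord_perm_symm {L : List (ℕ × ℕ)} {i j : ℕ} (hij : i ≠ j) (hi : i < L.length)
    (hj : j < L.length) (p q : ℕ) :
    ((addChord L i j p q).map unoriented).Perm ((addChord L j i q p).map unoriented) := by
  have hpq : unoriented (p, q) = unoriented (q, p) := Sym2.eq_swap
  rw [addChord_eq hij hi hj, addChord_eq hij.symm hj hi, List.set_comm _ _ hij]
  simp only [List.map_append, List.map_cons, List.map_nil, hpq]
  exact (List.Perm.swap _ _ _).append_left _

/-- The edge lists of the graphs `H₄, …, H₉`. -/
def edgesH : List (List (ℕ × ℕ)) :=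
  [addChord (addChord edgesG1 0 1 10 11) 0 2 12 13,
    addChord (addChord edgesG1 0 1 10 11) 3 6 12 13,
    addChord (addChord edgesG1 3 6 10 11) 3 6 12 13,
    addChord (addChord edgesG1 3 6 10 11) 3 5 12 13,
    addChord (addChord edgesG1 3 6 10 11) 4 5 12 13,
    addChord (addChord edgesG1 0 1 10 11) 17 2 12 13]

/-- The graph is isomorphic to one of `H₄, …, H₉`. -/
def IsomorphicToH {α β : Type*} (K : Graph α β) : Prop :=
  Isomorphic K H4 ∨ Isomorphic K H5 ∨ Isomorphic K H6 ∨ Isomorphic K H7 ∨ Isomorphic K H8 ∨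
    Isomorphic K H9

/-- Two edges to be joined, the number in `edgesH` of the graph that arises, and an isomorphism. -/
structure Obstruction where
  /-- The first of the two edges. -/
  fst : ℕ
  /-- The second of the two edges. -/
  snd : ℕ
  /-- The number in `edgesH` of the graph that arises when the two edges are joined. -/
  target : ℕ
  /-- The values of an isomorphism onto this graph. -/
  perm : List ℕ

/-- The obstruction is correct for the graph with the edge list `L`. -/
def Obstruction.Correct (o : Obstruction) (L : List (ℕ × ℕ)) : Prop :=
  o.fst < o.snd ∧ o.snd < L.length ∧ o.target < edgesH.length ∧
    Relabels 14 o.perm (addChord L o.fst o.snd 12 13) (edgesH.getD o.target [])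

instance (o : Obstruction) (L : List (ℕ × ℕ)) : Decidable (o.Correct L) :=
  inferInstanceAs (Decidable (_ ∧ _))

/-- A graph with twelve vertices, some pictures of it, and some obstructions. -/
structure Atlas where
  /-- The edge list of the graph. -/
  edges : List (ℕ × ℕ)
  /-- Drawings of the graph on the torus. -/
  pictures : List Picture
  /-- Pairs of edges that give one of the graphs `H₄, …, H₉` when they are joined. -/
  obstructions : List Obstruction

/-- The pictures and the obstructions of the atlas are correct, and every two edges, which may
coincide, either meet in a picture or are the edges of an obstruction. -/
structure Atlas.IsComplete (A : Atlas) : Prop where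
  isDrawing : ∀ P ∈ A.pictures, P.IsDrawing A.edges
  length_vertices : ∀ P ∈ A.pictures, P.vertices.length = 12
  correct : ∀ o ∈ A.obstructions, o.Correct A.edges
  covers : ∀ j < A.edges.length, ∀ i ≤ j,
    (∃ o ∈ A.obstructions, o.fst = i ∧ o.snd = j) ∨ ∃ P ∈ A.pictures, P.Meets i j

section Atlas

variable {A : Atlas} {α β : Type*} {K K' : Graph α β} {v : ℕ → α} {es : List β}
  {L : List (ℕ × ℕ)} {i j : ℕ}

theorem isomorphicToH_of_presents (hL : L ∈ edgesH) (h : Presents K v es (List.range 14) L) :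
    IsomorphicToH K := by
  simp only [edgesH, List.mem_cons, List.not_mem_nil, or_false] at hL
  rcases hL with rfl | rfl | rfl | rfl | rfl | rfl
  · exact Or.inl (h.isomorphic (by decide +kernel))
  · exact Or.inr (Or.inl (h.isomorphic (by decide +kernel)))
  · exact Or.inr (Or.inr (Or.inl (h.isomorphic (by decide +kernel))))
  · exact Or.inr (Or.inr (Or.inr (Or.inl (h.isomorphic (by decide +kernel)))))
  · exact Or.inr (Or.inr (Or.inr (Or.inr (Or.inl (h.isomorphic (by decide +kernel))))))
  · exact Or.inr (Or.inr (Or.inr (Or.inr (Or.inr (h.isomorphic (by decide +kernel))))))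

theorem Obstruction.Correct.isomorphicToH {o : Obstruction} (h : o.Correct L)
    (hK : Presents K v es (List.range 14) (addChord L o.fst o.snd 12 13)) : IsomorphicToH K := by
  obtain ⟨-, -, htarget, hperm⟩ := h
  obtain ⟨v', es', hK'⟩ := hK.relabel hperm
  refine isomorphicToH_of_presents ?_ hK'
  rw [List.getD_eq_getElem _ _ htarget]
  exact List.getElem_mem htarget

theorem Obstruction.Correct.isomorphicToH_swap {o : Obstruction} (h : o.Correct L)
    (hK : Presents K v es (List.range 14) (addChord L o.snd o.fst 13 12)) : IsomorphicToH K := by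
  obtain ⟨hlt, hsnd, -⟩ := id h
  obtain ⟨es', hK'⟩ := hK.perm_edges (addChord_perm_symm hlt.ne (hlt.trans hsnd) hsnd 12 13)
  exact h.isomorphicToH hK'

theorem Atlas.IsComplete.obstructed_or_cofacial (h : A.IsComplete) (hi : i < A.edges.length)
    (hj : j < A.edges.length) :
    (∃ o ∈ A.obstructions, o.fst = i ∧ o.snd = j ∨ o.fst = j ∧ o.snd = i) ∨
      ∃ P ∈ A.pictures, P.mesh.Cofacial (P.paths.getD i []) (P.paths.getD j []) := by
  rcases le_total i j with hij | hji
  · exact (h.covers j hj i hij).imp (fun ⟨o, ho, hends⟩ => ⟨o, ho, Or.inl hends⟩)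
      fun ⟨P, hP, hmeets⟩ => ⟨P, hP, hmeets.cofacial⟩
  · exact (h.covers i hi j hji).imp (fun ⟨o, ho, hends⟩ => ⟨o, ho, Or.inr hends⟩)
      fun ⟨P, hP, hmeets⟩ => ⟨P, hP, hmeets.cofacial.symm⟩

theorem Atlas.IsComplete.exists_cofacial_self (h : A.IsComplete) (hi : i < A.edges.length) :
    ∃ P ∈ A.pictures, P.mesh.Cofacial (P.paths.getD i []) (P.paths.getD i []) := by
  rcases h.obstructed_or_cofacial hi hi with ⟨o, ho, hio⟩ | hcofacial
  · have := (h.correct o ho).1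
    omega
  · exact hcofacial

theorem Atlas.IsComplete.toroidal_or_isomorphicToH (h : A.IsComplete)
    (hK : Presents K v es (List.range 12) A.edges) (hK' : IsAddEdge K K') :
    Toroidal K' ∨ IsomorphicToH K' := by
  rcases hK.addEdge hK' with ⟨i, hi, j, hj, hchord⟩ | ⟨i, hi, hloop⟩
  · obtain ⟨v', es', hK'⟩ := hchord 12 (by simp) 13 (by simp) (by norm_num)
    rcases eq_or_ne j A.edges.length with rfl | hjne
    · obtain ⟨P, hP, hcofacial⟩ := h.exists_cofacial_self hi
      exact Or.inl ((h.isDrawing P hP).toroidal_addChord (h.length_vertices P hP) hi hj hK'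
        (by rwa [if_pos rfl]))
    rcases h.obstructed_or_cofacial hi (j := j) (by omega) with
      ⟨o, ho, ⟨rfl, rfl⟩ | ⟨rfl, rfl⟩⟩ | ⟨P, hP, hcofacial⟩
    · exact Or.inr ((h.correct o ho).isomorphicToH hK')
    · obtain ⟨v', es', hK'⟩ := hchord 13 (by simp) 12 (by simp) (by norm_num)
      exact Or.inr ((h.correct o ho).isomorphicToH_swap (hK'.perm_vertices (by decide)))
    · exact Or.inl ((h.isDrawing P hP).toroidal_addChord (h.length_vertices P hP) hi hj hK'
        (by rwa [if_neg hjne]))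
  · obtain ⟨v', es', hK'⟩ := hloop 12 (by simp) 13 (by simp) (by norm_num)
    obtain ⟨P, hP, hcofacial⟩ := h.exists_cofacial_self hi
    exact Or.inl ((h.isDrawing P hP).toroidal_addLoop (h.length_vertices P hP) hK' hcofacial)

end Atlas

/-! ### Atlases for the graphs `G₁ ∪ e` -/

/-- A case of adding a pendant loop to `G₁`, with data for pictures of the graph that arises. -/
structure LoopCase where
  /-- The edge of `G₁` that is subdivided. -/
  edge : ℕ
  /-- For every picture, the number in `symmetriesG1` of the symmetry by which `G₁` is relabelled,
  the cell in which the loop is drawn, and the position on this cell to which it is attached. -/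
  positions : List (ℕ × ℕ × ℕ)

/-- A case of joining two edges of `G₁`, with data for pictures of the graph that arises. The second
edge has number `15` if it is the second half of the first edge. -/
structure ChordCase where
  /-- The first edge of `G₁` that is subdivided. -/
  fst : ℕ
  /-- The second edge of `G₁` that is subdivided. -/
  snd : ℕ
  /-- For every picture, the number in `symmetriesG1` of the symmetry by which `G₁` is relabelled,
  the cell in which the new edge is drawn, and the positions of its ends on this cell. -/
  positions : List (ℕ × ℕ × ℕ × ℕ)
  /-- The obstructions to joining two further edges. -/
  obstructions : List Obstruction

/-- The atlas of `G₁` with a pendant loop. -/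
def LoopCase.atlas (c : LoopCase) : Atlas where
  edges := addLoop edgesG1 c.edge 10 11
  pictures := c.positions.map fun s =>
    (pictureG1 (symmetriesG1.getD s.1 [])).addLoop c.edge s.2.1 s.2.2
  obstructions := []

/-- The atlas of `G₁` with a new edge that joins two edges. -/
def ChordCase.atlas (c : ChordCase) : Atlas where
  edges := addChord edgesG1 c.fst c.snd 10 11
  pictures := c.positions.map fun s =>
    (pictureG1 (symmetriesG1.getD s.1 [])).addChord c.fst c.snd s.2.1 s.2.2.1 s.2.2.2
  obstructions := c.obstructions

/-- Representatives, up to the symmetries of `G₁`, of the ways of adding a pendant loop. -/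
def loopCases : List LoopCase :=
  [⟨0, [(16, 2, 13), (2, 1, 40), (8, 1, 40), (17, 2, 12)]⟩,
    ⟨3, [(1, 2, 84), (18, 2, 21), (8, 0, 30), (0, 4, 50)]⟩]

/-- Representatives, up to the symmetries of `G₁`, of the ways of joining two edges. -/
def chordCases : List ChordCase :=
  [⟨0, 15,
      [(16, 2, 56, 59), (2, 4, 3, 6), (8, 4, 3, 6), (17, 2, 11, 14)],
      []⟩,
    ⟨3, 15,
      [(1, 2, 83, 86), (18, 2, 20, 23), (10, 0, 29, 32), (3, 4, 12, 15), (11, 4, 12, 15)],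
      []⟩,
    ⟨0, 1,
      [(8, 4, 4, 32), (9, 4, 5, 31), (10, 4, 4, 32), (12, 4, 4, 32)],
      [⟨0, 2, 0, [0, 1, 2, 3, 4, 5, 6, 7, 8, 9, 10, 11, 12, 13]⟩,
        ⟨0, 7, 1, [12, 1, 2, 3, 4, 5, 13, 6, 8, 9, 10, 11, 0, 7]⟩,
        ⟨0, 8, 1, [12, 1, 2, 3, 4, 5, 6, 13, 8, 9, 10, 11, 0, 7]⟩,
        ⟨0, 13, 2, [5, 3, 4, 11, 12, 1, 8, 9, 10, 13, 7, 0, 2, 6]⟩,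
        ⟨0, 14, 2, [5, 3, 4, 11, 12, 1, 8, 9, 13, 10, 7, 0, 2, 6]⟩,
        ⟨1, 2, 0, [1, 0, 2, 4, 3, 5, 6, 7, 8, 9, 11, 10, 12, 13]⟩,
        ⟨1, 7, 1, [0, 13, 2, 3, 4, 5, 12, 7, 8, 9, 10, 11, 1, 6]⟩,
        ⟨1, 8, 1, [0, 13, 2, 3, 4, 5, 7, 12, 8, 9, 10, 11, 1, 6]⟩,
        ⟨1, 13, 2, [3, 5, 4, 12, 11, 1, 8, 9, 10, 13, 0, 7, 2, 6]⟩,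
        ⟨1, 14, 2, [3, 5, 4, 12, 11, 1, 8, 9, 13, 10, 0, 7, 2, 6]⟩,
        ⟨2, 15, 0, [0, 2, 1, 3, 5, 4, 6, 7, 8, 9, 12, 13, 11, 10]⟩,
        ⟨2, 16, 0, [2, 0, 1, 5, 3, 4, 6, 7, 8, 9, 13, 12, 11, 10]⟩,
        ⟨2, 17, 5, [0, 1, 2, 3, 4, 5, 6, 7, 8, 9, 10, 11, 13, 12]⟩,
        ⟨3, 6, 1, [0, 1, 2, 3, 4, 5, 6, 7, 8, 9, 10, 11, 12, 13]⟩,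
        ⟨4, 5, 1, [0, 1, 2, 3, 4, 5, 7, 6, 8, 9, 10, 11, 12, 13]⟩,
        ⟨7, 15, 2, [10, 13, 0, 5, 4, 3, 11, 12, 8, 9, 6, 1, 7, 2]⟩,
        ⟨7, 16, 2, [12, 11, 1, 3, 5, 4, 10, 13, 8, 9, 0, 7, 6, 2]⟩,
        ⟨7, 17, 3, [6, 12, 1, 5, 3, 4, 10, 13, 8, 9, 2, 0, 11, 7]⟩,
        ⟨8, 15, 2, [10, 13, 0, 5, 4, 3, 12, 11, 8, 9, 6, 1, 7, 2]⟩,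
        ⟨8, 16, 2, [12, 11, 1, 3, 5, 4, 13, 10, 8, 9, 0, 7, 6, 2]⟩,
        ⟨8, 17, 3, [6, 12, 1, 5, 3, 4, 13, 10, 8, 9, 2, 0, 11, 7]⟩,
        ⟨9, 12, 1, [3, 4, 5, 0, 1, 2, 8, 9, 6, 7, 10, 11, 12, 13]⟩,
        ⟨10, 11, 1, [3, 4, 5, 0, 1, 2, 8, 9, 7, 6, 10, 11, 12, 13]⟩,
        ⟨13, 15, 1, [3, 4, 5, 12, 1, 2, 8, 9, 13, 6, 10, 11, 7, 0]⟩,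
        ⟨13, 16, 1, [3, 4, 5, 0, 13, 2, 8, 9, 12, 7, 10, 11, 6, 1]⟩,
        ⟨13, 17, 3, [3, 5, 4, 12, 6, 1, 8, 9, 10, 13, 0, 2, 11, 7]⟩,
        ⟨14, 15, 1, [3, 4, 5, 12, 1, 2, 8, 9, 6, 13, 10, 11, 7, 0]⟩,
        ⟨14, 16, 1, [3, 4, 5, 0, 13, 2, 8, 9, 7, 12, 10, 11, 6, 1]⟩,
        ⟨14, 17, 3, [3, 5, 4, 12, 6, 1, 8, 9, 13, 10, 0, 2, 11, 7]⟩]⟩,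
    ⟨0, 3,
      [(16, 2, 13, 21), (11, 4, 5, 13), (19, 2, 12, 66), (0, 4, 4, 50), (3, 4, 5, 13)],
      []⟩,
    ⟨0, 5,
      [(8, 4, 4, 40), (19, 2, 12, 76), (11, 4, 5, 23), (17, 2, 12, 84)],
      [⟨0, 2, 2, [10, 0, 13, 5, 3, 4, 11, 12, 8, 9, 2, 7, 6, 1]⟩,
        ⟨0, 7, 2, [10, 2, 1, 3, 5, 4, 11, 6, 8, 9, 0, 7, 12, 13]⟩,
        ⟨0, 8, 3, [10, 2, 1, 3, 5, 4, 11, 6, 8, 9, 0, 7, 12, 13]⟩,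
        ⟨1, 3, 4, [6, 11, 0, 5, 4, 3, 12, 10, 8, 9, 2, 7, 1, 13]⟩,
        ⟨2, 15, 1, [12, 2, 1, 3, 5, 4, 13, 6, 8, 9, 0, 7, 11, 10]⟩,
        ⟨2, 17, 3, [6, 1, 12, 5, 4, 3, 10, 13, 8, 9, 2, 11, 0, 7]⟩,
        ⟨3, 5, 3, [11, 0, 2, 4, 3, 5, 6, 7, 8, 9, 1, 13, 10, 12]⟩,
        ⟨3, 6, 3, [6, 0, 1, 5, 3, 4, 11, 13, 8, 9, 2, 7, 10, 12]⟩,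
        ⟨4, 16, 2, [12, 2, 1, 3, 5, 4, 13, 6, 8, 9, 0, 7, 10, 11]⟩,
        ⟨7, 15, 2, [10, 1, 2, 3, 4, 5, 11, 6, 8, 9, 12, 13, 7, 0]⟩,
        ⟨7, 17, 3, [11, 2, 0, 4, 5, 3, 10, 7, 8, 9, 1, 6, 12, 13]⟩,
        ⟨8, 15, 3, [10, 1, 2, 3, 4, 5, 6, 11, 8, 9, 12, 13, 7, 0]⟩,
        ⟨8, 17, 4, [6, 1, 0, 5, 4, 3, 10, 13, 8, 9, 2, 11, 12, 7]⟩]⟩,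
    ⟨3, 4,
      [(16, 0, 4, 12), (11, 2, 76, 84), (3, 2, 76, 84), (19, 3, 13, 21), (16, 2, 21, 49)],
      []⟩,
    ⟨3, 5,
      [(11, 4, 13, 23), (16, 0, 4, 30), (19, 2, 66, 76), (33, 1, 21, 31), (43, 3, 3, 13)],
      [⟨0, 16, 3, [11, 0, 2, 4, 3, 5, 6, 7, 8, 9, 10, 12, 1, 13]⟩,
        ⟨1, 15, 3, [0, 11, 2, 3, 4, 5, 6, 7, 8, 9, 12, 10, 1, 13]⟩,
        ⟨2, 17, 3, [0, 2, 11, 3, 5, 4, 10, 7, 8, 9, 12, 6, 1, 13]⟩,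
        ⟨3, 16, 5, [10, 11, 13, 0, 1, 2, 5, 12, 6, 7, 8, 4, 3, 9]⟩,
        ⟨4, 16, 3, [1, 0, 2, 4, 3, 5, 6, 7, 8, 9, 13, 12, 11, 10]⟩,
        ⟨5, 15, 5, [10, 11, 13, 0, 1, 2, 5, 12, 6, 7, 3, 8, 4, 9]⟩,
        ⟨6, 15, 3, [0, 1, 2, 3, 4, 5, 6, 7, 8, 9, 12, 13, 11, 10]⟩,
        ⟨7, 17, 5, [10, 11, 13, 0, 1, 2, 8, 12, 6, 7, 3, 4, 5, 9]⟩,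
        ⟨8, 17, 3, [0, 2, 1, 3, 5, 4, 13, 7, 8, 9, 12, 6, 11, 10]⟩]⟩,
    ⟨3, 6,
      [(16, 0, 4, 22), (42, 2, 31, 49), (47, 3, 3, 21), (17, 2, 4, 76)],
      [⟨0, 1, 1, [0, 1, 2, 3, 4, 5, 6, 7, 8, 9, 12, 13, 10, 11]⟩,
        ⟨0, 5, 3, [6, 0, 1, 5, 3, 4, 11, 13, 8, 9, 10, 12, 2, 7]⟩,
        ⟨0, 6, 2, [12, 2, 1, 3, 5, 4, 6, 13, 8, 9, 10, 11, 0, 7]⟩,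
        ⟨1, 3, 2, [2, 12, 1, 5, 3, 4, 13, 6, 8, 9, 11, 10, 0, 7]⟩,
        ⟨1, 4, 3, [0, 6, 1, 3, 5, 4, 13, 11, 8, 9, 12, 10, 2, 7]⟩,
        ⟨2, 17, 4, [0, 1, 6, 3, 4, 5, 13, 10, 8, 9, 12, 11, 2, 7]⟩,
        ⟨3, 5, 3, [0, 1, 2, 3, 4, 5, 6, 7, 8, 9, 10, 11, 12, 13]⟩,
        ⟨3, 6, 2, [0, 1, 2, 3, 4, 5, 6, 7, 8, 9, 10, 11, 12, 13]⟩,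
        ⟨4, 5, 4, [0, 1, 2, 3, 4, 5, 6, 7, 8, 9, 10, 11, 12, 13]⟩,
        ⟨4, 6, 3, [1, 0, 2, 4, 3, 5, 7, 6, 8, 9, 11, 10, 13, 12]⟩,
        ⟨7, 17, 3, [0, 1, 2, 3, 4, 5, 13, 7, 8, 9, 12, 11, 6, 10]⟩,
        ⟨8, 17, 3, [1, 2, 0, 4, 5, 3, 7, 13, 8, 9, 11, 6, 12, 10]⟩,
        ⟨15, 16, 2, [0, 1, 2, 3, 4, 5, 6, 7, 8, 9, 12, 13, 10, 11]⟩]⟩,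
    ⟨3, 9,
      [(17, 2, 4, 21), (3, 4, 13, 50), (18, 2, 21, 66), (35, 4, 23, 40), (11, 4, 13, 50),
       (43, 4, 23, 40)],
      []⟩,
    ⟨3, 11,
      [(11, 4, 13, 40), (16, 2, 21, 84), (42, 2, 31, 66), (32, 2, 31, 84), (35, 4, 23, 50)],
      []⟩]

theorem getD_symmetriesG1_mem {s : ℕ} (h : s < symmetriesG1.length) :
    symmetriesG1.getD s [] ∈ symmetriesG1 := by
  rw [List.getD_eq_getElem _ _ h]
  exact List.getElem_mem h

theorem canAddLoop_of_mem_loopCases : ∀ c ∈ loopCases, ∀ s ∈ c.positions,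
    s.1 < symmetriesG1.length ∧
      (pictureG1 (symmetriesG1.getD s.1 [])).CanAddLoop c.edge s.2.1 s.2.2 := by
  decide +kernel

theorem covers_of_mem_loopCases : ∀ c ∈ loopCases, ∀ j < 18, ∀ i ≤ j,
    ∃ P ∈ c.atlas.pictures, P.Meets i j := by
  decide +kernel

theorem isDrawing_of_mem_loopCases {c : LoopCase} (hc : c ∈ loopCases) {P : Picture}
    (hP : P ∈ c.atlas.pictures) : P.IsDrawing c.atlas.edges ∧ P.vertices.length = 12 := by
  obtain ⟨s, hs, rfl⟩ := List.mem_map.1 hP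
  obtain ⟨hlt, hadd⟩ := canAddLoop_of_mem_loopCases c hc s hs
  have hmem := getD_symmetriesG1_mem hlt
  have hlength := length_vertices_pictureG1 hmem
  exact ⟨(pictureG1_isDrawing hmem).addLoop hlength hadd,
    by rw [Picture.length_vertices_addLoop, hlength]⟩

theorem isComplete_of_mem_loopCases {c : LoopCase} (hc : c ∈ loopCases) : c.atlas.IsComplete where
  isDrawing P hP := (isDrawing_of_mem_loopCases hc hP).1
  length_vertices P hP := (isDrawing_of_mem_loopCases hc hP).2
  correct o ho := absurd ho List.not_mem_nil
  covers j hj i hij := by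
    have hlength : c.atlas.edges.length = 18 := by
      simp [LoopCase.atlas, addLoop, subdivide, edgesG1]
    exact Or.inr (covers_of_mem_loopCases c hc j (hlength ▸ hj) i hij)

theorem canAddChord_of_mem_chordCases : ∀ c ∈ chordCases, ∀ s ∈ c.positions,
    s.1 < symmetriesG1.length ∧ (pictureG1 (symmetriesG1.getD s.1 [])).CanAddChord
      c.fst c.snd s.2.1 s.2.2.1 s.2.2.2 := by
  decide +kernel

theorem correct_of_mem_chordCases : ∀ c ∈ chordCases, ∀ o ∈ c.atlas.obstructions,
    o.Correct c.atlas.edges := by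
  decide +kernel

theorem covers_of_mem_chordCases : ∀ c ∈ chordCases, ∀ j < 18, ∀ i ≤ j,
    (∃ o ∈ c.atlas.obstructions, o.fst = i ∧ o.snd = j) ∨
      ∃ P ∈ c.atlas.pictures, P.Meets i j := by
  decide +kernel

theorem isDrawing_of_mem_chordCases {c : ChordCase} (hc : c ∈ chordCases) {P : Picture}
    (hP : P ∈ c.atlas.pictures) : P.IsDrawing c.atlas.edges ∧ P.vertices.length = 12 := by
  obtain ⟨s, hs, rfl⟩ := List.mem_map.1 hP
  obtain ⟨hlt, hadd⟩ := canAddChord_of_mem_chordCases c hc s hs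
  have hmem := getD_symmetriesG1_mem hlt
  have hlength := length_vertices_pictureG1 hmem
  exact ⟨(pictureG1_isDrawing hmem).addChord hlength hadd,
    by rw [Picture.length_vertices_addChord, hlength]⟩

theorem isComplete_of_mem_chordCases {c : ChordCase} (hc : c ∈ chordCases) :
    c.atlas.IsComplete where
  isDrawing P hP := (isDrawing_of_mem_chordCases hc hP).1
  length_vertices P hP := (isDrawing_of_mem_chordCases hc hP).2
  correct := correct_of_mem_chordCases c hc
  covers j hj i hij := by
    have hlength : c.atlas.edges.length = 18 := by
      simp [ChordCase.atlas, addChord, subdivide, edgesG1]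
    exact covers_of_mem_chordCases c hc j (hlength ▸ hj) i hij

/-- The index in `edgesG1` of the image under `τ` of the edge number `i`. -/
def edgeImage (τ : List ℕ) (i : ℕ) : ℕ := imageIndex τ (edgesG1.getD i (0, 0))

/-- The extensions of a symmetry of `G₁` to two new vertices. -/
def extendedSymmetries (τ : List ℕ) : List (List ℕ) := [τ ++ [10, 11], τ ++ [11, 10]]

-- In the next two statements, the equation of edge images only makes the search by computation
-- fast.
theorem exists_loopCase : ∀ i < 15, ∃ τ ∈ symmetriesG1, ∃ c ∈ loopCases,
    edgeImage τ i = c.edge ∧ ∃ τ' ∈ extendedSymmetries τ,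
      Relabels 12 τ' (addLoop edgesG1 i 10 11) c.atlas.edges := by
  decide +kernel

theorem exists_chordCase : ∀ i < 15, ∀ j < 16, ∃ τ ∈ symmetriesG1, ∃ c ∈ chordCases,
    unoriented (edgeImage τ i, edgeImage τ (if j = 15 then i else j)) =
        unoriented (c.fst, if c.snd = 15 then c.fst else c.snd) ∧
      ∃ τ' ∈ extendedSymmetries τ,
        Relabels 12 τ' (addChord edgesG1 i j 10 11) c.atlas.edges := by
  decide +kernel

theorem exists_complete_atlas {α β : Type*} {K K₁ : Graph α β} (hK : Isomorphic K G1)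
    (h₁ : IsAddEdge K K₁) : ∃ (A : Atlas) (v : ℕ → α) (es : List β), A.IsComplete ∧
      Presents K₁ v es (List.range 12) A.edges := by
  obtain ⟨v, es, hpresents⟩ := exists_presents_of_isomorphic (L := edgesG1) hK (by decide +kernel)
  rcases hpresents.addEdge h₁ with ⟨i, hi, j, hj, hchord⟩ | ⟨i, hi, hloop⟩
  · obtain ⟨v', es', hK₁⟩ := hchord 10 (by simp) 11 (by simp) (by norm_num)
    obtain ⟨τ, -, c, hc, -, τ', -, hτ'⟩ := exists_chordCase i hi j hj
    obtain ⟨v'', es'', hK₁⟩ := hK₁.relabel hτ'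
    exact ⟨c.atlas, v'', es'', isComplete_of_mem_chordCases hc, hK₁⟩
  · obtain ⟨v', es', hK₁⟩ := hloop 10 (by simp) 11 (by simp) (by norm_num)
    obtain ⟨τ, -, c, hc, -, τ', -, hτ'⟩ := exists_loopCase i hi
    obtain ⟨v'', es'', hK₁⟩ := hK₁.relabel hτ'
    exact ⟨c.atlas, v'', es'', isComplete_of_mem_loopCases hc, hK₁⟩

end CubicTorus

theorem mainTheorem5 {α β : Type*} (K K₁ K₂ : Graph α β)
    (hK : CubicTorus.Isomorphic K CubicTorus.G1)
    (h₁ : CubicTorus.IsAddEdge K K₁) (h₂ : CubicTorus.IsAddEdge K₁ K₂)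
    (hH : ¬ (CubicTorus.Isomorphic K₂ CubicTorus.H4 ∨ CubicTorus.Isomorphic K₂ CubicTorus.H5 ∨
      CubicTorus.Isomorphic K₂ CubicTorus.H6 ∨ CubicTorus.Isomorphic K₂ CubicTorus.H7 ∨
      CubicTorus.Isomorphic K₂ CubicTorus.H8 ∨ CubicTorus.Isomorphic K₂ CubicTorus.H9)) :
    CubicTorus.Toroidal K₂ := by
  obtain ⟨A, v, es, hA, hp⟩ := CubicTorus.exists_complete_atlas hK h₁
  exact (hA.toroidal_or_isomorphicToH hp h₂).resolve_right hH
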